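/- **Setting.** Let $Mod$ be an abelian category with a bi-additive monoidal structure $\otimes_R$ with unit object $R$ (for instance $Mod_R$, or the category $Mod_R(G)$ of $R$-modules with an action of a group object $G$), such that $P\otimes_R Q$ is projective whenever $P$, $Q$ are projective. For a projective resolution $B_\bullet$ of $B$ let $\widetilde B_k$ ($k\ge 0$, $\widetilde B_0=B$) denote its syzygies, so that there are short exact sequences $0\to\widetilde B_{k+1}\to B_k\to\widetilde B_k\to 0$. The completed unenriched Ext groups are $\widehat{\mathrm{Ext}}^n(A,B)=\varinjlim_k \mathrm{Ext}^{n+k}(A,\widetilde B_k)$ for $n\in\mathbb Z$, the limit being taken along the connecting homomorphisms, where $\mathrm{Ext}^j=0$ for $j<0$. Call $B_\bullet$ *admissible* if the functors $-\otimes_R\widetilde B_k$ and $\widetilde B_k\otimes_R-$ are exact and preserve projectives for all $k\geq 0$. If $A_\bullet\otimes_R C_\bullet$ is a projective resolution of $A\otimes_R C$ (with the tensor product of the augmentations as augmentation) and $B_\bullet$, $E_\bullet$ are admissible, the external product $$\vee:\widehat{\mathrm{Ext}}^m(A,B)\otimes\widehat{\mathrm{Ext}}^n(C,E)\to\widehat{\mathrm{Ext}}^{m+n}(A\otimes_R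 C,B\otimes_R E)\qquad(m,n\in\mathbb Z)$$ is the direct limit, over $k$, of the external products $\mathrm{Ext}^{m+k}(A,\widetilde B_k)\otimes\mathrm{Ext}^{n+k}(C,\widetilde E_k)\to\mathrm{Ext}^{m+n+2k}(A\otimes_R C,\widetilde B_k\otimes_R\widetilde E_k)$, $[u]\vee[v]=(-1)^{(m+k)(n+k)}[u\otimes_R v]$, multiplied by the sign $\prod_{t=1}^{k}(-1)^{m+t}$ that makes them compatible with the connecting homomorphisms; here $B\otimes_R E$ is resolved by splicing, alternatingly, the short exact sequences of $B_\bullet$ tensored with the syzygies of $E_\bullet$ and vice versa, so that its syzygies are $B\otimes_R E,\ \widetilde B_1\otimes_R E,\ \widetilde B_1\otimes_R\widetilde E_1,\ \widetilde B_2\otimes_R\widetilde E_1,\dots$ **Lemma 6.2 (Associativity).** 1. Let $A_\bullet$, $C_\bullet$, $F_\bullet$ be projective resolutions of objects $A$, $C$, $F$ of $Mod$ such that $A_\bullet\otimes_R C_\bullet$, $C_\bullet\otimes_R F_\bullet$ and $A_\bullet\otimes_R C_\bullet\otimes_R F_\bullet$ are projective resolutions of $A\otimes_R C$, $C\otimes_R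 F$ and $A\otimes_R C\otimes_R F$, and let $B_\bullet$, $E_\bullet$, $H_\bullet$ be admissible projective resolutions of objects $B$, $E$, $H$. Then for all $m,n,p\in\mathbb Z$, $$\forall x\in\widehat{\mathrm{Ext}}^m(A,B),\ y\in\widehat{\mathrm{Ext}}^n(C,E),\ z\in\widehat{\mathrm{Ext}}^p(F,H):\quad (x\vee y)\vee z=x\vee(y\vee z)$$ in $\widehat{\mathrm{Ext}}^{m+n+p}(A\otimes_R C\otimes_R F,\,B\otimes_R E\otimes_R H)$, where the two sides are identified through the associativity isomorphisms of $\otimes_R$ in both variables. Suppose moreover that there is an exact, faithful, monoidal functor $Mod\to Mod'$ that preserves projectives (such as the restriction functor $Mod_R(G)\to Mod_R$), where $Mod'$ is an abelian category with a bi-additive monoidal structure whose unit object is projective. Then for every projective resolution $R_\bullet$ of $R$ the complex $R_\bullet\otimes_R R_\bullet$ is a projective resolution of $R\otimes_R R\cong R$, and the cup products $$\smile:\widehat H^m_R(G,M)\otimes\widehat H^n_R(G,N)\to\widehat H^{m+n}_R(G,M\otimes_R N)$$ on complete cohomology $\widehat H^n_R(G,M)=\widehat{\mathrm{Ext}}^n(R,M)$,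 which are the external products pulled back along $R\cong R\otimes_R R$, are associative: for admissible projective resolutions of $M$, $N$, $L$, all $m,n,p\in\mathbb Z$ and all $x\in\widehat H_R^m(G,M)$, $y\in\widehat H_R^n(G,N)$, $z\in\widehat H_R^p(G,L)$ one has $(x\smile y)\smile z=x\smile(y\smile z)$ in $\widehat H_R^{m+n+p}(G,M\otimes_R N\otimes_R L)$, again up to the associativity isomorphism in the coefficients. 2. Let $\mathcal C$ be an abelian category and let objects $F,H,J,K$ of $\mathcal C$ have projective resolutions. Realise $\widehat{\mathrm{Ext}}^n_{\mathcal C}(F,H)$ as the $n$-th cohomology of the Hom complex of the projective resolutions $F_\bullet$, $H_\bullet$ (extended by zero to negative degrees) modulo the subcomplex of cochains with only finitely many nonzero components, and let the Yoneda product $\circ:\widehat{\mathrm{Ext}}_{\mathcal C}^n(H,J)\otimes\widehat{\mathrm{Ext}}_{\mathcal C}^m(F,H)\to\widehat{\mathrm{Ext}}_{\mathcal C}^{m+n}(F,J)$ be induced by composition of cochains. Then Yoneda products are associative: $z\circ(y\circ x)=(z\circ y)\circ x$ for all $m,n,p\in\mathbb Z$, $x\in\widehat{\mathrm{Ext}}_{\mathcal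 C}^m(F,H)$, $y\in\widehat{\mathrm{Ext}}_{\mathcal C}^n(H,J)$, $z\in\widehat{\mathrm{Ext}}_{\mathcal C}^p(J,K)$. -/

import Mathlib

open CategoryTheory Limits MonoidalCategory

universe u v u₁ v₁

namespace CompletedExt

noncomputable section

section Cochains

variable {C : Type u} [Category.{v} C] [Abelian C]

/-- All (inhomogeneous) cochains on the chain complex `K` with values in `X`. -/
abbrev Coch (K : ChainComplex C ℕ) (X : C) : Type v := ∀ i : ℕ, K.X i ⟶ X

/-- The differential of the Hom complex: `d u = - (-1) ^ n • (u ∘ d)` for `u` of degree `n`. -/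
def codiff (K : ChainComplex C ℕ) (X : C) : Coch K X →+ Coch K X where
  toFun u
    | 0 => 0
    | i + 1 => (-1 : ℤˣ) ^ (i + 1) • (K.d (i + 1) i ≫ u i)
  map_zero' := by
    funext i
    cases i <;> simp
  map_add' u v := by
    funext i
    cases i <;> simp

variable {K L : ChainComplex C ℕ} {X Y Z : C}

@[simp]
lemma codiff_zero (u : Coch K X) : codiff K X u 0 = 0 := rfl

lemma codiff_succ (u : Coch K X) (i : ℕ) :
    codiff K X u (i + 1) = (-1 : ℤˣ) ^ (i + 1) • (K.d (i + 1) i ≫ u i) := rfl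

lemma codiff_codiff (u : Coch K X) : codiff K X (codiff K X u) = 0 := by
  funext i
  rcases i with _ | _ | i
  · rfl
  · simp [codiff_succ]
  · simp [codiff_succ]

variable (K X) in
/-- The cochains that are concentrated in degree `n`, i.e. `Hom(K_n, X)`
(which is zero if `n < 0`). -/
def degPart (n : ℤ) : AddSubgroup (Coch K X) where
  carrier := {u | ∀ i : ℕ, (i : ℤ) ≠ n → u i = 0}
  zero_mem' _ _ := rfl
  add_mem' hu hv i hi := by simp [hu i hi, hv i hi]
  neg_mem' hu i hi := by simp [hu i hi]

variable (K X) in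
/-- The cocycles of degree `n`. -/
def cocycles (n : ℤ) : AddSubgroup (Coch K X) := degPart K X n ⊓ (codiff K X).ker

variable (K X) in
/-- The coboundaries of degree `n`. -/
def coboundaries (n : ℤ) : AddSubgroup (Coch K X) := (degPart K X (n - 1)).map (codiff K X)

variable (K X) in
/-- The cohomology in degree `n` of the Hom complex from `K` to `X`. If `K` is a projective
resolution of `A`, this is the unenriched `Ext^n(A, X)`; it is zero for `n < 0`. -/
abbrev ExtGrp (n : ℤ) : Type v := cocycles K X n ⧸ (coboundaries K X n).addSubgroupOf (cocycles K X n)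

/-- The class of a cocycle. -/
def cls {n : ℤ} (u : Coch K X) (hu : u ∈ cocycles K X n) : ExtGrp K X n :=
  QuotientAddGroup.mk ⟨u, hu⟩

lemma cls_surj {n : ℤ} (x : ExtGrp K X n) : ∃ u hu, x = cls (n := n) u hu := by
  obtain ⟨⟨u, hu⟩, rfl⟩ := QuotientAddGroup.mk_surjective x
  exact ⟨u, hu, rfl⟩

lemma cls_eq {n : ℤ} {u v : Coch K X} (hu : u ∈ cocycles K X n) (hv : v ∈ cocycles K X n)
    {c : Coch K X} (hc : c ∈ degPart K X (n - 1)) (h : codiff K X c = v - u) :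
    cls u hu = cls v hv := by
  refine QuotientAddGroup.eq.2 ?_
  rw [AddSubgroup.mem_addSubgroupOf]
  exact ⟨c, hc, by rw [h]; simp [sub_eq_neg_add]⟩

lemma cls_add {n : ℤ} {u v : Coch K X} (hu : u ∈ cocycles K X n) (hv : v ∈ cocycles K X n) :
    cls (u + v) (add_mem hu hv) = cls u hu + cls v hv := rfl

/-- An additive map on cochains that preserves cocycles and coboundaries induces a map
on cohomology. -/
def liftCls {K' : ChainComplex C ℕ} {n m : ℤ} (F : Coch K X →+ Coch K' Y)
    (h₁ : ∀ u ∈ cocycles K X n, F u ∈ cocycles K' Y m)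
    (h₂ : ∀ u ∈ coboundaries K X n, F u ∈ coboundaries K' Y m) :
    ExtGrp K X n →+ ExtGrp K' Y m :=
  QuotientAddGroup.map _ _
    ((F.comp (cocycles K X n).subtype).codRestrict (cocycles K' Y m) (fun u => h₁ _ u.2))
    (fun _ hu => h₂ _ hu)

@[simp]
lemma liftCls_cls {K' : ChainComplex C ℕ} {n m : ℤ} (F : Coch K X →+ Coch K' Y)
    (h₁ : ∀ u ∈ cocycles K X n, F u ∈ cocycles K' Y m)
    (h₂ : ∀ u ∈ coboundaries K X n, F u ∈ coboundaries K' Y m)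
    (u : Coch K X) (hu : u ∈ cocycles K X n) :
    liftCls F h₁ h₂ (cls u hu) = cls (F u) (h₁ u hu) := rfl

/-- Postcomposition of cochains with `f`. -/
def postCoch (K : ChainComplex C ℕ) (f : X ⟶ Y) : Coch K X →+ Coch K Y where
  toFun u i := u i ≫ f
  map_zero' := by funext i; simp
  map_add' u v := by funext i; simp

/-- Precomposition of cochains with the chain map `φ`. -/
def preCoch (φ : K ⟶ L) (X : C) : Coch L X →+ Coch K X where
  toFun u i := φ.f i ≫ u i
  map_zero' := by funext i; simp
  map_add' u v := by funext i; simp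

@[simp]
lemma postCoch_apply (f : X ⟶ Y) (u : Coch K X) (i : ℕ) : postCoch K f u i = u i ≫ f := rfl

@[simp]
lemma preCoch_apply (φ : K ⟶ L) (u : Coch L X) (i : ℕ) : preCoch φ X u i = φ.f i ≫ u i := rfl

lemma codiff_postCoch (f : X ⟶ Y) (u : Coch K X) :
    codiff K Y (postCoch K f u) = postCoch K f (codiff K X u) := by
  funext i
  cases i <;> simp [codiff_succ]

lemma codiff_preCoch (φ : K ⟶ L) (u : Coch L X) :
    codiff K X (preCoch φ X u) = preCoch φ X (codiff L X u) := by
  funext i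
  cases i <;> simp [codiff_succ]

lemma postCoch_mem_degPart (f : X ⟶ Y) {n : ℤ} {u : Coch K X} (hu : u ∈ degPart K X n) :
    postCoch K f u ∈ degPart K Y n := fun i hi => by simp [hu i hi]

lemma preCoch_mem_degPart (φ : K ⟶ L) {n : ℤ} {u : Coch L X} (hu : u ∈ degPart L X n) :
    preCoch φ X u ∈ degPart K X n := fun i hi => by simp [hu i hi]

lemma postCoch_mem_cocycles (f : X ⟶ Y) {n : ℤ} {u : Coch K X} (hu : u ∈ cocycles K X n) :
    postCoch K f u ∈ cocycles K Y n :=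
  ⟨postCoch_mem_degPart f hu.1, by
    change codiff K Y _ = 0
    rw [codiff_postCoch, show codiff K X u = 0 from hu.2, map_zero]⟩

lemma preCoch_mem_cocycles (φ : K ⟶ L) {n : ℤ} {u : Coch L X} (hu : u ∈ cocycles L X n) :
    preCoch φ X u ∈ cocycles K X n :=
  ⟨preCoch_mem_degPart φ hu.1, by
    change codiff K X _ = 0
    rw [codiff_preCoch, show codiff L X u = 0 from hu.2, map_zero]⟩

variable (K) in
/-- The covariant functoriality `Ext^n(A, X) ⟶ Ext^n(A, Y)`. -/
def ExtGrp.post (f : X ⟶ Y) (n : ℤ) : ExtGrp K X n →+ ExtGrp K Y n :=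
  liftCls (postCoch K f) (fun _ hu => postCoch_mem_cocycles f hu) (by
    rintro _ ⟨c, hc, rfl⟩
    exact ⟨_, postCoch_mem_degPart f hc, codiff_postCoch f c⟩)

variable (X) in
/-- The contravariant functoriality of `Ext^n` induced by a chain map of resolutions. -/
def ExtGrp.pre (φ : K ⟶ L) (n : ℤ) : ExtGrp L X n →+ ExtGrp K X n :=
  liftCls (preCoch φ X) (fun _ hu => preCoch_mem_cocycles φ hu) (by
    rintro _ ⟨c, hc, rfl⟩
    exact ⟨_, preCoch_mem_degPart φ hc, codiff_preCoch φ c⟩)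

/-- The cocycle `w` represents the image of the cocycle `u` under the connecting homomorphism of
the short exact sequence `S`: it arises by lifting `u` to a cochain with values in `S.X₂` and
applying the differential. -/
def IsConn (K : ChainComplex C ℕ) (S : ShortComplex C) (n : ℤ) (u : Coch K S.X₃)
    (w : Coch K S.X₁) : Prop :=
  ∃ t ∈ degPart K S.X₂ n, postCoch K S.g t = u ∧ postCoch K S.f w = codiff K S.X₂ t

lemma codiff_mem_degPart {n n' : ℤ} (h : n + 1 = n') {u : Coch K X} (hu : u ∈ degPart K X n) :
    codiff K X u ∈ degPart K X n' := by
  intro i hi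
  cases i with
  | zero => rfl
  | succ i => rw [codiff_succ, hu i (by push_cast at hi; omega)]; simp

lemma postCoch_injective (f : X ⟶ Y) [Mono f] : Function.Injective (postCoch K f) := by
  intro u v h
  funext i
  rw [← cancel_mono f]
  exact congrFun h i

lemma exists_isConn [∀ i, Projective (K.X i)] {S : ShortComplex C} (hS : S.ShortExact) {n : ℤ}
    {u : Coch K S.X₃} (hu : u ∈ cocycles K S.X₃ n) : ∃ w, IsConn K S n u w := by
  have := hS.epi_g
  have := hS.mono_f
  classical
  let t : Coch K S.X₂ := fun i => if (i : ℤ) = n then Projective.factorThru (u i) S.g else 0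
  have ht : postCoch K S.g t = u := by
    funext i
    by_cases hi : (i : ℤ) = n
    · simp [t, hi]
    · simp [t, hi, hu.1 i hi]
  have h0 : ∀ i, codiff K S.X₂ t i ≫ S.g = 0 := fun i => by
    have h1 := congrFun (codiff_postCoch S.g t) i
    rw [ht, show codiff K S.X₃ u = 0 from hu.2] at h1
    exact h1.symm
  refine ⟨fun i => hS.exact.lift (codiff K S.X₂ t i) (h0 i), t, fun i hi => by simp [t, hi], ht, ?_⟩
  funext i
  exact hS.exact.lift_f _ _

lemma IsConn.mem {S : ShortComplex C} (hS : S.ShortExact) {n n' : ℤ} (h : n + 1 = n')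
    {u : Coch K S.X₃} {w : Coch K S.X₁} (hw : IsConn K S n u w) : w ∈ cocycles K S.X₁ n' := by
  have := hS.mono_f
  obtain ⟨t, ht, -, h2⟩ := hw
  constructor
  · intro i hi
    rw [← cancel_mono S.f, zero_comp]
    exact (congrFun h2 i).trans (codiff_mem_degPart h ht i hi)
  · apply postCoch_injective S.f
    rw [← codiff_postCoch, h2, codiff_codiff, map_zero]

lemma IsConn.add {S : ShortComplex C} {n : ℤ} {u u' : Coch K S.X₃} {w w' : Coch K S.X₁}
    (h : IsConn K S n u w) (h' : IsConn K S n u' w') : IsConn K S n (u + u') (w + w') := by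
  obtain ⟨t, ht, h1, h2⟩ := h
  obtain ⟨t', ht', h1', h2'⟩ := h'
  exact ⟨t + t', add_mem ht ht', by simp [h1, h1'], by simp [h2, h2']⟩

/-- The class of `w` depends only on the class of `u`. -/
lemma IsConn.cls_eq [∀ i, Projective (K.X i)] {S : ShortComplex C} (hS : S.ShortExact)
    {n n' : ℤ} (h : n + 1 = n') {u u' : Coch K S.X₃} {w w' : Coch K S.X₁}
    (hw : IsConn K S n u w) (hw' : IsConn K S n u' w') {c : Coch K S.X₃}
    (hc : c ∈ degPart K S.X₃ (n - 1)) (huu' : codiff K S.X₃ c = u' - u) :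
    cls w (hw.mem hS h) = cls w' (hw'.mem hS h) := by
  have := hS.epi_g
  have := hS.mono_f
  classical
  obtain ⟨t, ht, h1, h2⟩ := hw
  obtain ⟨t', ht', h1', h2'⟩ := hw'
  let e : Coch K S.X₂ := fun i => if (i : ℤ) = n - 1 then Projective.factorThru (c i) S.g else 0
  have he : postCoch K S.g e = c := by
    funext i
    by_cases hi : (i : ℤ) = n - 1
    · simp [e, hi]
    · simp [e, hi, hc i hi]
  have he' : e ∈ degPart K S.X₂ (n - 1) := fun i hi => by simp [e, hi]
  have h0 : ∀ i, (t' - t - codiff K S.X₂ e) i ≫ S.g = 0 := fun i => by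
    have : postCoch K S.g (t' - t - codiff K S.X₂ e) = 0 := by
      rw [map_sub, map_sub, h1, h1', ← codiff_postCoch, he, huu', sub_self]
    exact congrFun this i
  let r : Coch K S.X₁ := fun i => hS.exact.lift _ (h0 i)
  have hr : postCoch K S.f r = t' - t - codiff K S.X₂ e := by
    funext i
    exact hS.exact.lift_f _ _
  refine CompletedExt.cls_eq _ _ (c := r) ?_ ?_
  · intro i hi
    rw [← cancel_mono S.f, zero_comp]
    refine (congrFun hr i).trans ?_
    have h3 : (i : ℤ) ≠ n := by omega
    simp [ht i h3, ht' i h3, codiff_mem_degPart (n := n - 1) (by omega) he' i h3]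
  · apply postCoch_injective S.f
    rw [← codiff_postCoch, hr, map_sub, map_sub, codiff_codiff, map_sub, h2, h2', sub_zero]

variable (K) in
/-- The connecting homomorphism `Ext^n(A, S.X₃) ⟶ Ext^{n+1}(A, S.X₁)` of a short exact
sequence `S`, taken with respect to the differential of the Hom complex. -/
def conn [∀ i, Projective (K.X i)] {S : ShortComplex C} (hS : S.ShortExact) {n n' : ℤ}
    (h : n + 1 = n') : ExtGrp K S.X₃ n →+ ExtGrp K S.X₁ n' :=
  QuotientAddGroup.lift _
    (AddMonoidHom.mk'
      (fun u => cls (exists_isConn hS u.2).choose ((exists_isConn hS u.2).choose_spec.mem hS h))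
      (fun u v => by
        rw [← cls_add]
        exact IsConn.cls_eq hS h (exists_isConn hS (u + v).2).choose_spec
          ((exists_isConn hS u.2).choose_spec.add (exists_isConn hS v.2).choose_spec)
          (zero_mem _) (by simp)))
    (by
      rintro ⟨u, hu⟩ ⟨c, hc, hcu⟩
      have h1 : IsConn K S n 0 0 := ⟨0, zero_mem _, by simp, by simp⟩
      exact IsConn.cls_eq hS h (exists_isConn hS hu).choose_spec h1 (neg_mem hc) (by
        simpa using hcu))

lemma conn_cls [∀ i, Projective (K.X i)] {S : ShortComplex C} (hS : S.ShortExact) {n n' : ℤ}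
    (h : n + 1 = n') {u : Coch K S.X₃} (hu : u ∈ cocycles K S.X₃ n) {w : Coch K S.X₁}
    (hw : IsConn K S n u w) : conn K hS h (cls u hu) = cls w (hw.mem hS h) :=
  IsConn.cls_eq hS h (exists_isConn hS hu).choose_spec hw (zero_mem _) (by simp)

/-- Naturality of connecting homomorphisms in the short exact sequence. -/
lemma conn_post [∀ i, Projective (K.X i)] {S T : ShortComplex C} (hS : S.ShortExact)
    (hT : T.ShortExact) (φ : S ⟶ T) {n n' : ℤ} (h : n + 1 = n') (x : ExtGrp K S.X₃ n) :
    conn K hT h (ExtGrp.post K φ.τ₃ n x) = ExtGrp.post K φ.τ₁ n' (conn K hS h x) := by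
  obtain ⟨u, hu, rfl⟩ := cls_surj x
  obtain ⟨w, hw⟩ := exists_isConn hS hu
  rw [conn_cls hS h hu hw]
  obtain ⟨t, ht, h1, h2⟩ := hw
  refine conn_cls hT h (postCoch_mem_cocycles φ.τ₃ hu) (w := postCoch K φ.τ₁ w)
    ⟨postCoch K φ.τ₂ t, postCoch_mem_degPart _ ht, ?_, ?_⟩
  · rw [← h1]; funext i; simp [φ.comm₂₃]
  · rw [codiff_postCoch, ← h2]; funext i; simp [φ.comm₁₂]

/-- Naturality of connecting homomorphisms in the resolution. -/
lemma conn_pre [∀ i, Projective (K.X i)] [∀ i, Projective (L.X i)] (φ : K ⟶ L)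
    {S : ShortComplex C} (hS : S.ShortExact) {n n' : ℤ} (h : n + 1 = n') (x : ExtGrp L S.X₃ n) :
    conn K hS h (ExtGrp.pre S.X₃ φ n x) = ExtGrp.pre S.X₁ φ n' (conn L hS h x) := by
  obtain ⟨u, hu, rfl⟩ := cls_surj x
  obtain ⟨w, hw⟩ := exists_isConn hS hu
  rw [conn_cls hS h hu hw]
  obtain ⟨t, ht, h1, h2⟩ := hw
  refine conn_cls hS h (preCoch_mem_cocycles φ hu) (w := preCoch φ _ w)
    ⟨preCoch φ _ t, preCoch_mem_degPart _ ht, ?_, ?_⟩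
  · rw [← h1]; funext i; simp
  · rw [codiff_preCoch, ← h2]; funext i; simp

lemma smul_mem_degPart (r : ℤˣ) {u : Coch K X} {n : ℤ} (hu : u ∈ degPart K X n) :
    r • u ∈ degPart K X n := fun i hi => by simp [hu i hi]

lemma smul_mem_cocycles (r : ℤˣ) {u : Coch K X} {n : ℤ} (hu : u ∈ cocycles K X n) :
    r • u ∈ cocycles K X n := by
  rcases Int.units_eq_one_or r with rfl | rfl
  · rwa [one_smul]
  · rw [Units.neg_smul, one_smul]; exact neg_mem hu

lemma cls_congr {n : ℤ} {u u' : Coch K X} (hu : u ∈ cocycles K X n) (h : u = u') :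
    cls u hu = cls u' (h ▸ hu) := by
  subst h; rfl

lemma smul_cls (r : ℤˣ) {u : Coch K X} {n : ℤ} (hu : u ∈ cocycles K X n) :
    r • cls u hu = cls (r • u) (smul_mem_cocycles r hu) := by
  rcases Int.units_eq_one_or r with rfl | rfl
  · rw [one_smul]
    exact cls_congr _ (one_smul _ _).symm
  · rw [Units.neg_smul, one_smul]
    change cls (-u) (neg_mem hu) = _
    exact cls_congr _ (by rw [Units.neg_smul, one_smul])

end Cochains

section Tensor

variable {C : Type u} [Category.{v} C] [Abelian C] [MonoidalCategory C] [MonoidalPreadditive C]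

/-- The tensor product of chain complexes, with differential `d ⊗ 1 + (-1) ^ i • (1 ⊗ d)` on
the summand `K_i ⊗ L_j`. -/
abbrev tensorCx (K L : ChainComplex C ℕ) : ChainComplex C ℕ := HomologicalComplex.tensorObj K L

variable {K L : ChainComplex C ℕ} {X Y : C}

/-- The inclusion of the summand `K_i ⊗ L_j`. -/
abbrev ιT (K L : ChainComplex C ℕ) (i j n : ℕ) (h : i + j = n) :
    K.X i ⊗ L.X j ⟶ (tensorCx K L).X n :=
  HomologicalComplex.ιTensorObj K L i j n h

/-- The product of cochains: on the summand `K_i ⊗ L_j` of `K ⊗ L` it is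
`(-1) ^ (i * j) • (u_i ⊗ v_j)`. -/
def cross (u : Coch K X) (v : Coch L Y) : Coch (tensorCx K L) (X ⊗ Y) :=
  fun _ => HomologicalComplex.mapBifunctorDesc
    (fun i j _ => (-1 : ℤˣ) ^ (i * j) • (u i ⊗ₘ v j))

lemma ι_cross (u : Coch K X) (v : Coch L Y) (i j n : ℕ) (h : i + j = n) :
    ιT K L i j n h ≫ cross u v n = (-1 : ℤˣ) ^ (i * j) • (u i ⊗ₘ v j) :=
  HomologicalComplex.ι_mapBifunctorDesc _ i j h

/-- Morphisms out of `K ⊗ L` are given by morphisms on the summands. -/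
def tensorDesc {n : ℕ} {Z : C} (g : ∀ i j, i + j = n → (K.X i ⊗ L.X j ⟶ Z)) :
    (tensorCx K L).X n ⟶ Z :=
  HomologicalComplex.mapBifunctorDesc (fun i j h => g i j h)

lemma ι_tensorDesc {n : ℕ} {Z : C} (g : ∀ i j, i + j = n → (K.X i ⊗ L.X j ⟶ Z)) (i j : ℕ)
    (h : i + j = n) : ιT K L i j n h ≫ tensorDesc g = g i j h :=
  HomologicalComplex.ι_mapBifunctorDesc _ i j h

lemma tensor_ext {n : ℕ} {Z : C} {f g : (tensorCx K L).X n ⟶ Z}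
    (h : ∀ i j (hij : i + j = n), ιT K L i j n hij ≫ f = ιT K L i j n hij ≫ g) :
    f = g :=
  HomologicalComplex.mapBifunctor.hom_ext h

lemma cross_add_left (u u' : Coch K X) (v : Coch L Y) :
    cross (u + u') v = cross u v + cross u' v := by
  funext n
  refine tensor_ext fun i j hij => ?_
  rw [Pi.add_apply, Preadditive.comp_add, ι_cross, ι_cross, ι_cross, Pi.add_apply,
    MonoidalPreadditive.add_tensor, smul_add]

lemma cross_add_right (u : Coch K X) (v v' : Coch L Y) :
    cross u (v + v') = cross u v + cross u v' := by
  funext n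
  refine tensor_ext fun i j hij => ?_
  rw [Pi.add_apply, Preadditive.comp_add, ι_cross, ι_cross, ι_cross, Pi.add_apply,
    MonoidalPreadditive.tensor_add, smul_add]

/-- The product of cochains as a bi-additive map. -/
def crossHom : Coch K X →+ Coch L Y →+ Coch (tensorCx K L) (X ⊗ Y) :=
  AddMonoidHom.mk' (fun u => AddMonoidHom.mk' (cross u) (cross_add_right u))
    (fun u u' => by ext v : 1; exact cross_add_left u u' v)

@[simp]
lemma crossHom_apply (u : Coch K X) (v : Coch L Y) : crossHom u v = cross u v := rfl

lemma cross_zero_left (v : Coch L Y) : cross (0 : Coch K X) v = 0 := by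
  rw [← crossHom_apply, map_zero]; rfl

lemma cross_zero_right (u : Coch K X) : cross u (0 : Coch L Y) = 0 := by
  rw [← crossHom_apply, map_zero]

lemma smul_tensorHom (r : ℤˣ) {X X' Y Y' : C} (f : X ⟶ X') (g : Y ⟶ Y') :
    (r • f) ⊗ₘ g = r • (f ⊗ₘ g) := by
  rcases Int.units_eq_one_or r with rfl | rfl
  · simp
  · rw [Units.neg_smul, one_smul, Units.neg_smul, one_smul, eq_neg_iff_add_eq_zero,
      ← MonoidalPreadditive.add_tensor, neg_add_cancel, MonoidalPreadditive.zero_tensor]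

lemma tensorHom_smul (r : ℤˣ) {X X' Y Y' : C} (f : X ⟶ X') (g : Y ⟶ Y') :
    f ⊗ₘ (r • g) = r • (f ⊗ₘ g) := by
  rcases Int.units_eq_one_or r with rfl | rfl
  · simp
  · rw [Units.neg_smul, one_smul, Units.neg_smul, one_smul, eq_neg_iff_add_eq_zero,
      ← MonoidalPreadditive.tensor_add, neg_add_cancel, MonoidalPreadditive.tensor_zero]

lemma ι_d_cross (u : Coch K X) (v : Coch L Y) (i j n : ℕ) (h : i + j = n + 1) :
    ιT K L i j (n + 1) h ≫ (tensorCx K L).d (n + 1) n ≫ cross u v n =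
      HomologicalComplex.mapBifunctor.d₁ K L (curriedTensor C) (.down ℕ) i j n ≫ cross u v n +
      HomologicalComplex.mapBifunctor.d₂ K L (curriedTensor C) (.down ℕ) i j n ≫ cross u v n := by
  rw [← Preadditive.add_comp, ← Category.assoc, HomologicalComplex.mapBifunctor.d_eq]
  congr 1
  rw [Preadditive.comp_add]
  congr 1
  · exact HomologicalComplex.mapBifunctor.ι_D₁ K L (curriedTensor C) (.down ℕ) (n + 1) n i j h
  · exact HomologicalComplex.mapBifunctor.ι_D₂ K L (curriedTensor C) (.down ℕ) (n + 1) n i j h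

lemma d₁_cross (u : Coch K X) (v : Coch L Y) (i j n : ℕ) (h : i + j = n + 1) :
    HomologicalComplex.mapBifunctor.d₁ K L (curriedTensor C) (.down ℕ) i j n ≫ cross u v n =
      ((-1 : ℤˣ) ^ (n + 1) * (-1 : ℤˣ) ^ (i * j)) • (codiff K X u i ⊗ₘ v j) := by
  cases i with
  | zero =>
    rw [HomologicalComplex.mapBifunctor.d₁_eq_zero _ _ _ _ _ _ _ (by simp)]
    simp
  | succ i =>
    have h1 : i + j = n := by omega
    rw [HomologicalComplex.mapBifunctor.d₁_eq K L (curriedTensor C) (.down ℕ)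
      (i₁ := i + 1) (i₁' := i) rfl j n h1]
    have e : (-1 : ℤˣ) ^ (n + 1) * (-1 : ℤˣ) ^ ((i + 1) * j) * (-1 : ℤˣ) ^ (i + 1) =
        (-1 : ℤˣ) ^ (i * j) := by
      subst h1
      rw [← pow_add, ← pow_add, show i + j + 1 + (i + 1) * j + (i + 1) =
        i * j + 2 * (i + j + 1) by ring, pow_add, pow_mul]
      simp
    have e1 : ComplexShape.ε₁ (.down ℕ) (.down ℕ) (.down ℕ) (i + 1, j) = 1 := rfl
    rw [codiff_succ, smul_tensorHom, smul_smul, e, e1, one_smul]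
    refine (Category.assoc _ _ _).trans ?_
    refine (congrArg (fun f => ((curriedTensor C).map (K.d (i + 1) i)).app (L.X j) ≫ f)
      (ι_cross u v i j n h1)).trans ?_
    simp only [curriedTensor_map_app, Linear.comp_units_smul, MonoidalCategory.tensorHom_def,
      comp_whiskerRight, Category.assoc]

lemma d₂_cross (u : Coch K X) (v : Coch L Y) (i j n : ℕ) (h : i + j = n + 1) :
    HomologicalComplex.mapBifunctor.d₂ K L (curriedTensor C) (.down ℕ) i j n ≫ cross u v n =
      ((-1 : ℤˣ) ^ (n + 1) * (-1 : ℤˣ) ^ (i * j) * (-1 : ℤˣ) ^ i) • (u i ⊗ₘ codiff L Y v j) := by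
  cases j with
  | zero =>
    rw [HomologicalComplex.mapBifunctor.d₂_eq_zero _ _ _ _ _ _ _ (by simp)]
    simp
  | succ j =>
    have h1 : i + j = n := by omega
    rw [HomologicalComplex.mapBifunctor.d₂_eq K L (curriedTensor C) (.down ℕ)
      i (i₂ := j + 1) (i₂' := j) rfl n h1]
    have e : (-1 : ℤˣ) ^ (n + 1) * (-1 : ℤˣ) ^ (i * (j + 1)) * (-1 : ℤˣ) ^ i *
        (-1 : ℤˣ) ^ (j + 1) = (-1 : ℤˣ) ^ i * (-1 : ℤˣ) ^ (i * j) := by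
      subst h1
      rw [← pow_add, ← pow_add, ← pow_add, ← pow_add,
        show i + j + 1 + i * (j + 1) + i + (j + 1) =
        i + i * j + 2 * (i + j + 1) by ring, pow_add, pow_mul]
      simp
    have e1 : ComplexShape.ε₂ (.down ℕ) (.down ℕ) (.down ℕ) (i, j + 1) = (-1 : ℤˣ) ^ i := rfl
    rw [codiff_succ, tensorHom_smul, smul_smul, e, e1, Linear.units_smul_comp, mul_smul]
    congr 1
    refine (Category.assoc _ _ _).trans ?_
    refine (congrArg (fun f => ((curriedTensor C).obj (K.X i)).map (L.d (j + 1) j) ≫ f)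
      (ι_cross u v i j n h1)).trans ?_
    simp only [curriedTensor_obj_map, Linear.comp_units_smul, MonoidalCategory.tensorHom_def',
      MonoidalCategory.whiskerLeft_comp, Category.assoc]

/-- The Leibniz rule `d (u × v) = d u × v + (-1) ^ |u| u × d v`. -/
lemma codiff_cross (u : Coch K X) (v : Coch L Y) {m : ℤ} (hu : u ∈ degPart K X m) :
    codiff _ _ (cross u v) =
      cross (codiff K X u) v + m.negOnePow • cross u (codiff L Y v) := by
  funext n
  cases n with
  | zero =>
    refine tensor_ext fun i j hij => ?_
    obtain rfl : i = 0 := by omega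
    obtain rfl : j = 0 := by omega
    rw [Pi.add_apply, Pi.smul_apply, Preadditive.comp_add, Linear.comp_units_smul, ι_cross, ι_cross]
    simp
  | succ n =>
    refine tensor_ext fun i j hij => ?_
    rw [Pi.add_apply, Pi.smul_apply, Preadditive.comp_add, Linear.comp_units_smul, ι_cross, ι_cross,
      codiff_succ, Linear.comp_units_smul, ι_d_cross u v i j n hij, d₁_cross u v i j n hij,
      d₂_cross u v i j n hij, smul_add, smul_smul, smul_smul, smul_smul]
    have e : (-1 : ℤˣ) ^ (n + 1) * (-1 : ℤˣ) ^ (n + 1) = 1 := Int.units_mul_self _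
    rw [← mul_assoc, e, one_mul, ← mul_assoc, ← mul_assoc, e, one_mul]
    congr 1
    by_cases hi : (i : ℤ) = m
    · subst hi
      congr 1
      exact mul_comm _ _
    · rw [hu i hi]
      simp

lemma cross_mem_degPart {u : Coch K X} {v : Coch L Y} {m n s : ℤ} (h : m + n = s)
    (hu : u ∈ degPart K X m) (hv : v ∈ degPart L Y n) :
    cross u v ∈ degPart (tensorCx K L) (X ⊗ Y) s := by
  intro k hk
  refine tensor_ext fun i j hij => ?_
  rw [ι_cross, comp_zero]
  by_cases hi : (i : ℤ) = m
  · rw [hv j (by omega)]; simp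
  · rw [hu i hi]; simp

lemma cross_mem_cocycles {u : Coch K X} {v : Coch L Y} {m n s : ℤ} (h : m + n = s)
    (hu : u ∈ cocycles K X m) (hv : v ∈ cocycles L Y n) :
    cross u v ∈ cocycles (tensorCx K L) (X ⊗ Y) s := by
  refine ⟨cross_mem_degPart h hu.1 hv.1, ?_⟩
  change codiff _ _ _ = 0
  rw [codiff_cross u v hu.1, show codiff K X u = 0 from hu.2, show codiff L Y v = 0 from hv.2,
    cross_zero_left, cross_zero_right, smul_zero, add_zero]

/-- The external product `Ext^m(A, X) ⊗ Ext^n(B, Y) ⟶ Ext^{m + n}(A ⊗ B, X ⊗ Y)`,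
`[u] ∨ [v] = (-1) ^ (m * n) • [u ⊗ v]`. -/
def ExtGrp.cross (K L : ChainComplex C ℕ) (X Y : C) {m n s : ℤ} (h : m + n = s) :
    ExtGrp K X m →+ ExtGrp L Y n →+ ExtGrp (tensorCx K L) (X ⊗ Y) s :=
  QuotientAddGroup.lift _
    (AddMonoidHom.mk' (fun u =>
      liftCls (crossHom u.1) (fun _ hv => cross_mem_cocycles h u.2 hv) (by
        rintro _ ⟨c, hc, rfl⟩
        refine ⟨m.negOnePow • CompletedExt.cross u.1 c,
          smul_mem_degPart _ (cross_mem_degPart (by omega) u.2.1 hc), ?_⟩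
        have h1 : codiff K X u.1 = 0 := u.2.2
        rcases Int.units_eq_one_or m.negOnePow with e | e <;>
        · have h2 := codiff_cross u.1 c u.2.1
          rw [e, h1, cross_zero_left, zero_add] at h2
          simp only [one_smul, Units.neg_smul] at h2
          simp [e, h2]))
      (fun u u' => by
        ext ⟨v, hv⟩
        exact (cls_congr _ (cross_add_left u.1 u'.1 v)).trans
          (cls_add (cross_mem_cocycles h u.2 hv) (cross_mem_cocycles h u'.2 hv))))
    (by
      rintro ⟨u, hu⟩ ⟨c, hc, hcu⟩
      change codiff K X c = u at hcu
      rw [AddMonoidHom.mem_ker]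
      ext ⟨v, hv⟩
      change cls _ _ = cls (K := tensorCx K L) (X := X ⊗ Y) 0 (zero_mem _)
      refine cls_eq (K := tensorCx K L) (X := X ⊗ Y) _ _ (c := - CompletedExt.cross c v)
        (neg_mem (cross_mem_degPart (by omega) hc hv.1)) ?_
      rw [map_neg, codiff_cross c v hc, show codiff L Y v = 0 from hv.2, cross_zero_right, hcu]
      simp)

lemma ExtGrp.cross_cls {m n s : ℤ} (h : m + n = s) {u : Coch K X} (hu : u ∈ cocycles K X m)
    {v : Coch L Y} (hv : v ∈ cocycles L Y n) :
    ExtGrp.cross K L X Y h (cls u hu) (cls v hv) =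
      cls (CompletedExt.cross u v) (cross_mem_cocycles h hu hv) := rfl

lemma post_cross_left {X' : C} (f : X ⟶ X') (u : Coch K X) (v : Coch L Y) :
    postCoch _ (f ▷ Y) (cross u v) = cross (postCoch K f u) v := by
  funext n
  refine tensor_ext fun i j hij => ?_
  have h := ι_cross u v i j n hij
  rw [ι_cross, postCoch_apply, ← Category.assoc, h, Linear.units_smul_comp]
  simp [MonoidalCategory.tensorHom_def']

lemma post_cross_right {Y' : C} (f : Y ⟶ Y') (u : Coch K X) (v : Coch L Y) :
    postCoch _ (X ◁ f) (cross u v) = cross u (postCoch L f v) := by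
  funext n
  refine tensor_ext fun i j hij => ?_
  have h := ι_cross u v i j n hij
  rw [ι_cross, postCoch_apply, ← Category.assoc, h, Linear.units_smul_comp]
  simp [MonoidalCategory.tensorHom_def]

/-- `δ x ∨ y = δ (x ∨ y)`. -/
lemma conn_cross_left [∀ i, Projective (K.X i)] [∀ i, Projective ((tensorCx K L).X i)]
    {S : ShortComplex C} (hS : S.ShortExact)
    (hS' : (S.map (tensorRight Y)).ShortExact) {m m' n s s' : ℤ} (hm : m + 1 = m') (h : m + n = s)
    (h' : m' + n = s') (hs : s + 1 = s') (x : ExtGrp K S.X₃ m) (y : ExtGrp L Y n) :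
    ExtGrp.cross K L S.X₁ Y h' (conn K hS hm x) y =
      conn (tensorCx K L) hS' hs (ExtGrp.cross K L S.X₃ Y h x y) := by
  obtain ⟨u, hu, rfl⟩ := cls_surj x
  obtain ⟨v, hv, rfl⟩ := cls_surj y
  obtain ⟨w, hw⟩ := exists_isConn hS hu
  rw [conn_cls hS hm hu hw, ExtGrp.cross_cls, ExtGrp.cross_cls]
  obtain ⟨t, ht, h1, h2⟩ := hw
  refine (conn_cls hS' hs (cross_mem_cocycles h hu hv) (w := cross w v)
    ⟨cross t v, cross_mem_degPart h ht hv.1, ?_, ?_⟩).symm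
  · exact (post_cross_left S.g t v).trans (by rw [h1])
  · refine (post_cross_left S.f w v).trans ?_
    rw [h2]
    change _ = codiff (tensorCx K L) (S.X₂ ⊗ Y) (cross t v)
    rw [codiff_cross t v ht, show codiff L Y v = 0 from hv.2, cross_zero_right, smul_zero, add_zero]

/-- `x ∨ δ y = (-1) ^ |x| δ (x ∨ y)`. -/
lemma conn_cross_right [∀ i, Projective (L.X i)] [∀ i, Projective ((tensorCx K L).X i)]
    {S : ShortComplex C} (hS : S.ShortExact)
    (hS' : (S.map (tensorLeft X)).ShortExact) {m n n' s s' : ℤ} (hn : n + 1 = n') (h : m + n = s)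
    (h' : m + n' = s') (hs : s + 1 = s') (x : ExtGrp K X m) (y : ExtGrp L S.X₃ n) :
    ExtGrp.cross K L X S.X₁ h' x (conn L hS hn y) =
      m.negOnePow • conn (tensorCx K L) hS' hs (ExtGrp.cross K L X S.X₃ h x y) := by
  obtain ⟨u, hu, rfl⟩ := cls_surj x
  obtain ⟨v, hv, rfl⟩ := cls_surj y
  obtain ⟨w, hw⟩ := exists_isConn hS hv
  rw [conn_cls hS hn hv hw, ExtGrp.cross_cls, ExtGrp.cross_cls]
  obtain ⟨t, ht, h1, h2⟩ := hw
  have h3 := codiff_cross u t hu.1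
  rw [show codiff K X u = 0 from hu.2, cross_zero_left, zero_add] at h3
  have h4 : IsConn (tensorCx K L) (S.map (tensorLeft X)) s (cross u v)
      (m.negOnePow • cross u w) := by
    refine ⟨cross u t, cross_mem_degPart h hu.1 ht, ?_, ?_⟩
    · exact (post_cross_right S.g u t).trans (by rw [h1])
    · have h5 : postCoch (tensorCx K L) (S.map (tensorLeft X)).f (cross u w) =
          cross u (codiff L S.X₂ t) := (post_cross_right S.f u w).trans (by rw [h2])
      refine Eq.trans ?_ h3.symm
      rw [← h5]
      funext i
      exact Linear.units_smul_comp (R := ℤ) m.negOnePow (cross u w i) _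
  refine Eq.trans ?_ (congrArg (m.negOnePow • ·)
    (conn_cls hS' hs (cross_mem_cocycles h hu hv) h4)).symm
  refine Eq.trans ?_ (smul_cls m.negOnePow (h4.mem hS' hs)).symm
  refine cls_congr _ ?_
  exact ((smul_smul m.negOnePow m.negOnePow (cross u w)).trans
    (by rw [Int.units_mul_self, one_smul])).symm

end Tensor

section DirectLimits

variable (F : ℕ → Type v) [∀ k, AddCommGroup (F k)] (s : ∀ k, F k →+ F (k + 1))

/-- The transition maps of the direct system `F 0 ⟶ F 1 ⟶ F 2 ⟶ ⋯`. -/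
def seqMap (i j : ℕ) (h : i ≤ j) : F i →+ F j :=
  Nat.leRec (motive := fun j _ => F i →+ F j) (AddMonoidHom.id _) (fun j _ g => (s j).comp g) h

lemma seqMap_self (i : ℕ) : seqMap F s i i le_rfl = AddMonoidHom.id _ := Nat.leRec_self _ _

lemma seqMap_succ (i j : ℕ) (h : i ≤ j) :
    seqMap F s i (j + 1) (h.trans j.le_succ) = (s j).comp (seqMap F s i j h) :=
  Nat.leRec_succ _ _ _

instance : DirectedSystem F (fun i j h => seqMap F s i j h) where
  map_self i x := by rw [seqMap_self]; rfl
  map_map k j i hij hjk x := by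
    induction hjk with
    | refl => rw [seqMap_self]; rfl
    | step h ih =>
      rw [seqMap_succ F s _ _ h, seqMap_succ F s _ _ (hij.trans h)]
      simp [ih]

/-- The direct limit of a sequence of abelian groups. -/
abbrev SeqColim : Type v := DirectLimit F (seqMap F s)

variable {F}

/-- The map from a term of the sequence to the direct limit. -/
def SeqColim.of (k : ℕ) (x : F k) : SeqColim F s := ⟦⟨k, x⟩⟧

lemma SeqColim.of_succ (k : ℕ) (x : F k) : of s (k + 1) (s k x) = of s k x := by
  have h := DirectLimit.mk_apply (f := seqMap F s) k (k + 1) x k.le_succ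
  rw [seqMap_succ F s k k le_rfl, seqMap_self] at h
  exact h

lemma seqMap_compat {G : ℕ → Type v} [∀ k, AddCommGroup (G k)] (t : ∀ k, G k →+ G (k + 1))
    {T : Type*} (f : ∀ k, F k → G k → T) (h : ∀ k x y, f k x y = f (k + 1) (s k x) (t k y))
    (i j : ℕ) (hij : i ≤ j) (x : F i) (y : G i) :
    f i x y = f j (seqMap F s i j hij x) (seqMap G t i j hij y) := by
  induction hij with
  | refl => rw [seqMap_self, seqMap_self]; rfl
  | step hij ih =>
    rw [seqMap_succ F s _ _ hij, seqMap_succ G t _ _ hij, ih, h]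
    rfl

end DirectLimits

section Syzygies

variable {C : Type u} [Category.{v} C] [Abelian C]

variable (C) in
/-- A projective resolution `⋯ ⟶ B_1 ⟶ B_0 ⟶ B` of the object `B = syz 0`, recorded together with
its syzygies, i.e. cut into short exact sequences `0 ⟶ syz (k + 1) ⟶ B_k ⟶ syz k ⟶ 0` with
`B_k = proj k` projective. -/
structure SyzRes where
  /-- the syzygies; `syz 0` is the object that is resolved -/
  syz : ℕ → C
  /-- the terms of the resolution -/
  proj : ℕ → C
  projective : ∀ k, Projective (proj k)
  ι : ∀ k, syz (k + 1) ⟶ proj k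
  π : ∀ k, proj k ⟶ syz k
  w : ∀ k, ι k ≫ π k = 0
  exact : ∀ k, (ShortComplex.mk (ι k) (π k) (w k)).ShortExact

namespace SyzRes

/-- The short exact sequence `0 ⟶ syz (k + 1) ⟶ proj k ⟶ syz k ⟶ 0`. -/
abbrev ses (Q : SyzRes C) (k : ℕ) : ShortComplex C := ShortComplex.mk (Q.ι k) (Q.π k) (Q.w k)

/-- A morphism of resolutions. -/
structure Hom (Q R : SyzRes C) where
  /-- the maps on syzygies -/
  syz : ∀ k, Q.syz k ⟶ R.syz k
  /-- the maps on the terms of the resolutions -/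
  proj : ∀ k, Q.proj k ⟶ R.proj k
  comm_ι : ∀ k, syz (k + 1) ≫ R.ι k = Q.ι k ≫ proj k
  comm_π : ∀ k, proj k ≫ R.π k = Q.π k ≫ syz k

/-- The morphism of short exact sequences that belongs to a morphism of resolutions. -/
def Hom.ses {Q R : SyzRes C} (θ : Hom Q R) (k : ℕ) : Q.ses k ⟶ R.ses k where
  τ₁ := θ.syz (k + 1)
  τ₂ := θ.proj k
  τ₃ := θ.syz k
  comm₁₂ := θ.comm_ι k
  comm₂₃ := θ.comm_π k

section Lift

variable (Q R : SyzRes C)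

/-- One step of the comparison theorem on the terms of the resolutions. -/
def liftProj {k : ℕ} (f : Q.syz k ⟶ R.syz k) : Q.proj k ⟶ R.proj k :=
  have := Q.projective k
  have := (R.exact k).epi_g
  Projective.factorThru (Q.π k ≫ f) (R.π k)

lemma liftProj_π {k : ℕ} (f : Q.syz k ⟶ R.syz k) : Q.liftProj R f ≫ R.π k = Q.π k ≫ f :=
  have := Q.projective k
  have := (R.exact k).epi_g
  Projective.factorThru_comp _ _

/-- One step of the comparison theorem on syzygies. -/
def liftNext {k : ℕ} (f : Q.syz k ⟶ R.syz k) : Q.syz (k + 1) ⟶ R.syz (k + 1) :=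
  have := (R.exact k).mono_f
  (R.exact k).exact.lift (Q.ι k ≫ Q.liftProj R f) (by
    change (Q.ι k ≫ Q.liftProj R f) ≫ R.π k = 0
    rw [Category.assoc, liftProj_π, ← Category.assoc, Q.w, zero_comp])

lemma liftNext_ι {k : ℕ} (f : Q.syz k ⟶ R.syz k) :
    Q.liftNext R f ≫ R.ι k = Q.ι k ≫ Q.liftProj R f :=
  have := (R.exact k).mono_f
  (R.exact k).exact.lift_f _ _

/-- The maps on syzygies of a lift of `f`. -/
def liftSyz (f : Q.syz 0 ⟶ R.syz 0) : ∀ k, Q.syz k ⟶ R.syz k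
  | 0 => f
  | k + 1 => Q.liftNext R (liftSyz f k)

/-- A lift of `f` to a morphism of resolutions. -/
def lift (f : Q.syz 0 ⟶ R.syz 0) : Hom Q R where
  syz := Q.liftSyz R f
  proj k := Q.liftProj R (Q.liftSyz R f k)
  comm_ι k := Q.liftNext_ι R (Q.liftSyz R f k)
  comm_π k := Q.liftProj_π R (Q.liftSyz R f k)

end Lift

end SyzRes

variable {A A' : C}

/-- The augmentation `P_0 ⟶ A` of a projective resolution as a cochain of degree `0`. -/
def aug (P : ProjectiveResolution A) : Coch P.complex A
  | 0 => (ChainComplex.toSingle₀Equiv P.complex A P.π).1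
  | _ + 1 => 0

lemma aug_mem (P : ProjectiveResolution A) : aug P ∈ cocycles P.complex A 0 := by
  constructor
  · intro i hi
    cases i with
    | zero => simp at hi
    | succ i => rfl
  · change codiff _ _ _ = 0
    funext i
    rcases i with _ | _ | i
    · rfl
    · rw [codiff_succ]
      have h : P.complex.d 1 0 ≫ aug P 0 = 0 := (ChainComplex.toSingle₀Equiv P.complex A P.π).2
      rw [h, smul_zero]
      rfl
    · rw [codiff_succ, show aug P (i + 1) = 0 from rfl, comp_zero, smul_zero]
      rfl

/-- The completed unenriched Ext group `Êxt^n(A, B)` with `B = Q.syz 0`, given by the resolution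
construction: the direct limit of the groups `Ext^{n+k}(A, Q.syz k)` along the connecting
homomorphisms of the short exact sequences `0 ⟶ Q.syz (k + 1) ⟶ Q.proj k ⟶ Q.syz k ⟶ 0`. -/
abbrev ExtHat (P : ProjectiveResolution A) (Q : SyzRes C) (n : ℤ) : Type v :=
  SeqColim (fun k : ℕ => ExtGrp P.complex (Q.syz k) (n + k))
    (fun k => conn P.complex (Q.exact k) (by push_cast; ring))

/-- The canonical map `Ext^{n + k}(A, Q.syz k) ⟶ Êxt^n(A, B)`. -/
def ExtHat.of (P : ProjectiveResolution A) (Q : SyzRes C) (n : ℤ) (k : ℕ)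
    (x : ExtGrp P.complex (Q.syz k) (n + k)) : ExtHat P Q n :=
  SeqColim.of (F := fun k : ℕ => ExtGrp P.complex (Q.syz k) (n + k)) _ k x

lemma ExtHat.of_succ (P : ProjectiveResolution A) (Q : SyzRes C) (n : ℤ) (k : ℕ)
    (x : ExtGrp P.complex (Q.syz k) (n + k)) :
    ExtHat.of P Q n (k + 1) (conn P.complex (Q.exact k) (by push_cast; ring) x) =
      ExtHat.of P Q n k x :=
  SeqColim.of_succ (F := fun k : ℕ => ExtGrp P.complex (Q.syz k) (n + k)) _ k x

lemma ExtHat.of_neg (P : ProjectiveResolution A) (Q : SyzRes C) (n : ℤ) (k : ℕ)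
    (x : ExtGrp P.complex (Q.syz k) (n + k)) : of P Q n k (-x) = -of P Q n k x := rfl

lemma ExtHat.of_smul (P : ProjectiveResolution A) (Q : SyzRes C) (n : ℤ) (k : ℕ) (r : ℤˣ)
    (x : ExtGrp P.complex (Q.syz k) (n + k)) : of P Q n k (r • x) = r • of P Q n k x := by
  rcases Int.units_eq_one_or r with rfl | rfl
  · rw [one_smul, one_smul]
  · rw [Units.neg_smul, one_smul, Units.neg_smul, one_smul, of_neg]

/-- A map of direct limits given by compatible maps of the terms. -/
def SeqColim.map {F G : ℕ → Type v} [∀ k, AddCommGroup (F k)] [∀ k, AddCommGroup (G k)]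
    (s : ∀ k, F k →+ F (k + 1)) (t : ∀ k, G k →+ G (k + 1)) (f : ∀ k, F k →+ G k)
    (h : ∀ k x, t k (f k x) = f (k + 1) (s k x)) : SeqColim F s →+ SeqColim G t :=
  AddMonoidHom.mk' (DirectLimit.map (seqMap F s) (seqMap G t) (fun k => f k) (by
    intro i j hij x
    induction hij with
    | refl => rw [seqMap_self, seqMap_self]; rfl
    | step hij ih =>
      rw [seqMap_succ F s _ _ hij, seqMap_succ G t _ _ hij, AddMonoidHom.comp_apply, ih, h]
      rfl)) (by
    refine DirectLimit.induction₂ _ fun i x y => ?_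
    rw [DirectLimit.add_def]
    simp only [DirectLimit.map_def]
    rw [DirectLimit.add_def, map_add])

/-- The map on `Êxt^n(A, -)` induced by a morphism of resolutions. -/
def ExtHat.mapHom (P : ProjectiveResolution A) {Q R : SyzRes C} (θ : SyzRes.Hom Q R) (n : ℤ) :
    ExtHat P Q n →+ ExtHat P R n :=
  SeqColim.map _ _ (fun k : ℕ => ExtGrp.post P.complex (θ.syz k) (n + k))
    (fun k x => conn_post (Q.exact k) (R.exact k) (θ.ses k) _ x)

/-- The functoriality `Êxt^n(A, f) : Êxt^n(A, B) ⟶ Êxt^n(A, B')` for `f : B ⟶ B'`, obtained by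
lifting `f` to the given resolutions. -/
def ExtHat.map (P : ProjectiveResolution A) {Q R : SyzRes C} (f : Q.syz 0 ⟶ R.syz 0) (n : ℤ) :
    ExtHat P Q n →+ ExtHat P R n :=
  ExtHat.mapHom P (Q.lift R f) n

/-- The functoriality `Êxt^n(r, B) : Êxt^n(A', B) ⟶ Êxt^n(A, B)` for `r : A ⟶ A'`, obtained by
lifting `r` to the given resolutions. -/
def ExtHat.comap {P : ProjectiveResolution A} {P' : ProjectiveResolution A'} (r : A ⟶ A')
    (Q : SyzRes C) (n : ℤ) : ExtHat P' Q n →+ ExtHat P Q n :=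
  SeqColim.map _ _
    (fun k : ℕ => ExtGrp.pre (Q.syz k) (ProjectiveResolution.lift r P P') (n + k))
    (fun k x => conn_pre _ (Q.exact k) _ x)

end Syzygies

section Products

variable {C : Type u} [Category.{v} C] [Abelian C] [MonoidalCategory C] [MonoidalPreadditive C]

/-- Tensoring with `X` from either side is exact and preserves projective objects. -/
class TensorAdmissible (X : C) : Prop where
  exact_left : ∀ S : ShortComplex C, S.ShortExact → (S.map (tensorLeft X)).ShortExact
  exact_right : ∀ S : ShortComplex C, S.ShortExact → (S.map (tensorRight X)).ShortExact
  projective_left : ∀ P : C, Projective P → Projective (X ⊗ P)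
  projective_right : ∀ P : C, Projective P → Projective (P ⊗ X)

instance (X Y : C) [TensorAdmissible X] [TensorAdmissible Y] : TensorAdmissible (X ⊗ Y) where
  exact_left S hS :=
    ShortComplex.shortExact_of_iso (S.mapNatIso (tensorLeftTensor X Y)).symm
      (TensorAdmissible.exact_left (X := X) _ (TensorAdmissible.exact_left (X := Y) S hS))
  exact_right S hS :=
    ShortComplex.shortExact_of_iso (S.mapNatIso (tensorRightTensor X Y)).symm
      (TensorAdmissible.exact_right (X := Y) _ (TensorAdmissible.exact_right (X := X) S hS))
  projective_left P hP := Projective.of_iso (α_ X Y P).symm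
    (TensorAdmissible.projective_left _ (TensorAdmissible.projective_left _ hP))
  projective_right P hP := Projective.of_iso (α_ P X Y)
    (TensorAdmissible.projective_right _ (TensorAdmissible.projective_right _ hP))

/-- All syzygies of the resolution are such that tensoring with them is exact and preserves
projective objects. -/
class SyzRes.Admissible (Q : SyzRes C) : Prop where
  out : ∀ k, TensorAdmissible (Q.syz k)

attribute [instance] SyzRes.Admissible.out

/-- A position `(i, j)` in the double system of the `syz i ⊗ syz j`, together with the information
which of the two indices is increased next (the first one for `false`). -/
abbrev Pos : Type := ℕ × ℕ × Bool

/-- Increase the first and the second index alternatingly. -/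
def Pos.next : Pos → Pos
  | (i, j, false) => (i + 1, j, true)
  | (i, j, true) => (i, j + 1, false)

/-- The alternating sequence of positions `(0, 0), (1, 0), (1, 1), (2, 1), …`. -/
def alt : ℕ → Pos
  | 0 => (0, 0, false)
  | k + 1 => (alt k).next

lemma alt_two_mul : ∀ k : ℕ, alt (2 * k) = (k, k, false)
  | 0 => rfl
  | k + 1 => by
    change ((alt (2 * k)).next).next = _
    rw [alt_two_mul k]
    rfl

namespace SyzRes

variable (Q R : SyzRes C)

/-- The syzygy `Q.syz i ⊗ R.syz j` at a position. -/
abbrev posSyz (s : Pos) : C := Q.syz s.1 ⊗ R.syz s.2.1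

/-- The term `Q.proj i ⊗ R.syz j` or `Q.syz i ⊗ R.proj j` at a position. -/
def posProj : Pos → C
  | (i, j, false) => Q.proj i ⊗ R.syz j
  | (i, j, true) => Q.syz i ⊗ R.proj j

/-- The inclusion of the next syzygy. -/
def posι : ∀ s : Pos, posSyz Q R s.next ⟶ posProj Q R s
  | (i, j, false) => Q.ι i ▷ R.syz j
  | (i, j, true) => Q.syz i ◁ R.ι j

/-- The projection to the syzygy. -/
def posπ : ∀ s : Pos, posProj Q R s ⟶ posSyz Q R s
  | (i, j, false) => Q.π i ▷ R.syz j
  | (i, j, true) => Q.syz i ◁ R.π j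

lemma pos_w : ∀ s : Pos, posι Q R s ≫ posπ Q R s = 0
  | (i, j, false) => ((Q.ses i).map (tensorRight (R.syz j))).zero
  | (i, j, true) => ((R.ses j).map (tensorLeft (Q.syz i))).zero

lemma pos_exact [Q.Admissible] [R.Admissible] :
    ∀ s : Pos, (ShortComplex.mk (posι Q R s) (posπ Q R s) (pos_w Q R s)).ShortExact
  | (i, j, false) => TensorAdmissible.exact_right (X := R.syz j) _ (Q.exact i)
  | (i, j, true) => TensorAdmissible.exact_left (X := Q.syz i) _ (R.exact j)

lemma pos_projective [Q.Admissible] [R.Admissible] : ∀ s : Pos, Projective (posProj Q R s)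
  | (i, j, false) => TensorAdmissible.projective_right (X := R.syz j) _ (Q.projective i)
  | (i, j, true) => TensorAdmissible.projective_left (X := Q.syz i) _ (R.projective j)

/-- The projective resolution of `B ⊗ E` built from resolutions of `B` and `E` by splicing
the tensor products of the one resolution with the syzygies of the other, alternatingly. Its
syzygies are the `Q.syz i ⊗ R.syz j` with `(i, j) = (0, 0), (1, 0), (1, 1), (2, 1), …`. -/
def tensor [Q.Admissible] [R.Admissible] : SyzRes C where
  syz k := posSyz Q R (alt k)
  proj k := posProj Q R (alt k)
  projective k := pos_projective Q R (alt k)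
  ι k := posι Q R (alt k)
  π k := posπ Q R (alt k)
  w k := pos_w Q R (alt k)
  exact k := pos_exact Q R (alt k)

instance [Q.Admissible] [R.Admissible] : (Q.tensor R).Admissible where
  out k := inferInstanceAs (TensorAdmissible (Q.syz (alt k).1 ⊗ R.syz (alt k).2.1))

end SyzRes

variable (C) in
/-- Tensor products of projective objects are projective. -/
class TensorProjective : Prop where
  out : ∀ P Q : C, Projective P → Projective Q → Projective (P ⊗ Q)

instance [TensorProjective C] (K L : ChainComplex C ℕ) [∀ i, Projective (K.X i)]
    [∀ i, Projective (L.X i)] (n : ℕ) : Projective ((tensorCx K L).X n) where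
  factors {E X} f e he := by
    have : ∀ i j, Projective (K.X i ⊗ L.X j) := fun i j =>
      TensorProjective.out _ _ inferInstance inferInstance
    let g : ∀ i j, i + j = n → (K.X i ⊗ L.X j ⟶ E) := fun i j h =>
      @Projective.factorThru C _ (K.X i ⊗ L.X j) X E (this i j) (ιT K L i j n h ≫ f) e he
    refine ⟨tensorDesc g, ?_⟩
    refine tensor_ext fun i j h => ?_
    have h1 := ι_tensorDesc g i j h
    rw [← Category.assoc, h1]
    exact @Projective.factorThru_comp C _ (K.X i ⊗ L.X j) X E (this i j) (ιT K L i j n h ≫ f) e he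

variable {A B : C}

/-- The augmentation `P ⊗ P' ⟶ A ⊗ B` of the tensor product of two projective resolutions, given
in degree `0` by the tensor product `P_0 ⊗ P'_0 ⟶ A ⊗ B` of the augmentations. -/
def tensorAug (P : ProjectiveResolution A) (P' : ProjectiveResolution B) :
    tensorCx P.complex P'.complex ⟶ (ChainComplex.single₀ C).obj (A ⊗ B) :=
  (ChainComplex.toSingle₀Equiv _ _).symm ⟨cross (aug P) (aug P') 0, by
    have h : codiff _ _ (cross (aug P) (aug P')) = 0 :=
      (cross_mem_cocycles (zero_add 0) (aug_mem P) (aug_mem P')).2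
    have h1 := congrFun h 1
    change (-1 : ℤˣ) ^ 1 • ((tensorCx P.complex P'.complex).d 1 0 ≫ cross (aug P) (aug P') 0) = 0
      at h1
    rw [pow_one, Units.neg_smul, one_smul] at h1
    exact neg_eq_zero.1 h1⟩

/-- The tensor product of the projective resolutions `P` of `A` and `P'` of `B` is a (projective)
resolution of `A ⊗ B`. -/
class IsTensorResolution (P : ProjectiveResolution A) (P' : ProjectiveResolution B) : Prop where
  quasiIso : QuasiIso (tensorAug P P')

/-- The projective resolution `P ⊗ P'` of `A ⊗ B`. -/
abbrev tensorRes [TensorProjective C] (P : ProjectiveResolution A) (P' : ProjectiveResolution B)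
    [h : IsTensorResolution P P'] : ProjectiveResolution (A ⊗ B) where
  complex := tensorCx P.complex P'.complex
  projective := inferInstance
  hasHomology := inferInstance
  π := tensorAug P P'
  quasiIso := h.quasiIso

/-- The sign that relates the external product of representatives at stage `k` to the external
product in the limit: the product of the signs `(-1) ^ (m + 1), (-1) ^ (m + 2), …, (-1) ^ (m + k)`
that occur in `x ∨ δ y = (-1) ^ |x| δ (x ∨ y)` when `x` and `y` are moved from stage `0` to stage
`k` alternatingly. -/
def stageSign (m : ℤ) : ℕ → ℤˣ
  | 0 => 1
  | k + 1 => (m + (k + 1 : ℕ)).negOnePow * stageSign m k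

/-- The identification of `Q.syz k ⊗ R.syz k` with the syzygy in degree `2 * k`. -/
def SyzRes.tensorEq (Q R : SyzRes C) [Q.Admissible] [R.Admissible] (k : ℕ) :
    Q.syz k ⊗ R.syz k ⟶ (Q.tensor R).syz (2 * k) :=
  eqToHom (congrArg (SyzRes.posSyz Q R) (alt_two_mul k).symm)

lemma conn_pos (K : ChainComplex C ℕ) [∀ i, Projective (K.X i)] (Q R : SyzRes C) [Q.Admissible]
    [R.Admissible] {s s' : Pos} (h : s = s') {n n' : ℤ} (hn : n + 1 = n')
    (x : ExtGrp K (SyzRes.posSyz Q R s) n) :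
    conn K (SyzRes.pos_exact Q R s') hn (ExtGrp.post K (eqToHom (congrArg _ h)) n x) =
      ExtGrp.post K (eqToHom (congrArg (fun t : Pos => SyzRes.posSyz Q R t.next) h)) n'
        (conn K (SyzRes.pos_exact Q R s) hn x) := by
  subst h
  have e : ∀ (X : C) (m : ℤ) (y : ExtGrp K X m), ExtGrp.post K (𝟙 X) m y = y := by
    intro X m y
    obtain ⟨u, hu, rfl⟩ := cls_surj y
    exact cls_congr _ (by funext i; simp)
  rw [eqToHom_refl, eqToHom_refl, e, e]

lemma stage_succ (n : ℤ) (k : ℕ) : n + k + 1 = n + (k + 1 : ℕ) := by push_cast; ring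

lemma stage_add {m n s : ℤ} (h : m + n = s) (k : ℕ) : m + k + (n + k) = s + (2 * k : ℕ) := by
  push_cast; omega

variable {A₁ A₂ : C} [TensorProjective C]

/-- The external product of classes at stage `k`. -/
def stageProd (P : ProjectiveResolution A₁) (P' : ProjectiveResolution A₂)
    [IsTensorResolution P P'] (Q R : SyzRes C) [Q.Admissible] [R.Admissible] {m n s : ℤ}
    (h : m + n = s) (k : ℕ) (x : ExtGrp P.complex (Q.syz k) (m + k))
    (y : ExtGrp P'.complex (R.syz k) (n + k)) : ExtHat (tensorRes P P') (Q.tensor R) s :=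
  stageSign m k • ExtHat.of (tensorRes P P') (Q.tensor R) s (2 * k)
    (ExtGrp.post _ (Q.tensorEq R k) _
      (ExtGrp.cross P.complex P'.complex (Q.syz k) (R.syz k) (stage_add h k) x y))

lemma stageProd_aux (P : ProjectiveResolution A₁) (P' : ProjectiveResolution A₂)
    [IsTensorResolution P P'] (Q R : SyzRes C) [Q.Admissible] [R.Admissible] {m n s : ℤ}
    (h : m + n = s) (k : ℕ) (x : ExtGrp P.complex (Q.syz k) (m + k))
    (y : ExtGrp P'.complex (R.syz k) (n + k)) :
    ExtHat.of (tensorRes P P') (Q.tensor R) s (2 * k)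
      (ExtGrp.post _ (Q.tensorEq R k) _
        (ExtGrp.cross P.complex P'.complex (Q.syz k) (R.syz k) (stage_add h k) x y)) =
      (m + (k + 1 : ℕ)).negOnePow • ExtHat.of (tensorRes P P') (Q.tensor R) s (2 * (k + 1))
        (ExtGrp.post _ (Q.tensorEq R (k + 1)) _
          (ExtGrp.cross P.complex P'.complex (Q.syz (k + 1)) (R.syz (k + 1))
            (stage_add h (k + 1)) (conn P.complex (Q.exact k) (stage_succ m k) x)
            (conn P'.complex (R.exact k) (stage_succ n k) y))) := by
  rw [← ExtHat.of_succ, ← ExtHat.of_succ, ← ExtHat.of_smul]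
  change ExtHat.of (tensorRes P P') (Q.tensor R) s (2 * k + 1 + 1) _ =
    ExtHat.of (tensorRes P P') (Q.tensor R) s (2 * k + 1 + 1) _
  congr 1
  have a0 : m + (k + 1 : ℕ) + (n + k) = s + (2 * k + 1 : ℕ) := by push_cast; omega
  have h1 := conn_pos (tensorCx P.complex P'.complex) Q R (alt_two_mul k).symm
    (stage_succ s (2 * k))
    (ExtGrp.cross P.complex P'.complex (Q.syz k) (R.syz k) (stage_add h k) x y)
  have h2 := conn_pos (tensorCx P.complex P'.complex) Q R
    (congrArg Pos.next (alt_two_mul k).symm) (stage_succ s (2 * k + 1))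
    (conn (tensorCx P.complex P'.complex) (SyzRes.pos_exact Q R (k, k, false))
      (stage_succ s (2 * k))
      (ExtGrp.cross P.complex P'.complex (Q.syz k) (R.syz k) (stage_add h k) x y))
  refine (congrArg (conn _ _ _) h1).trans (h2.trans ?_)
  have h3 := conn_cross_left (K := P.complex) (L := P'.complex) (Q.exact k)
    (TensorAdmissible.exact_right (X := R.syz k) _ (Q.exact k))
    (stage_succ m k) (stage_add h k) a0 (stage_succ s (2 * k)) x y
  have h4 := conn_cross_right (K := P.complex) (L := P'.complex) (R.exact k)
    (TensorAdmissible.exact_left (X := Q.syz (k + 1)) _ (R.exact k))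
    (stage_succ n k) a0 (stage_add h (k + 1)) (stage_succ s (2 * k + 1))
    (conn P.complex (Q.exact k) (stage_succ m k) x) y
  rw [h3] at h4
  have h5 : ∀ (X : C) (l : ℤ) (r : ℤˣ) (f g : ExtGrp (tensorCx P.complex P'.complex) X l),
      f = r • g → g = r • f := by
    rintro X l r f g rfl
    rw [smul_smul, Int.units_mul_self, one_smul]
  have h6 := h5 _ _ _ _ _ h4
  have h7 : ∀ (X X' : C) (φ : X ⟶ X') (l : ℤ) (r : ℤˣ)
      (f g : ExtGrp (tensorCx P.complex P'.complex) X l), f = r • g →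
      ExtGrp.post (tensorCx P.complex P'.complex) φ l f = r • ExtGrp.post _ φ l g := by
    rintro X X' φ l r f g rfl
    rcases Int.units_eq_one_or r with rfl | rfl
    · rw [one_smul, one_smul]
    · rw [Units.neg_smul, one_smul, Units.neg_smul, one_smul, map_neg]
  exact h7 _ _ _ _ _ _ _ h6

lemma stageProd_succ (P : ProjectiveResolution A₁) (P' : ProjectiveResolution A₂)
    [IsTensorResolution P P'] (Q R : SyzRes C) [Q.Admissible] [R.Admissible] {m n s : ℤ}
    (h : m + n = s) (k : ℕ) (x : ExtGrp P.complex (Q.syz k) (m + k))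
    (y : ExtGrp P'.complex (R.syz k) (n + k)) :
    stageProd P P' Q R h k x y =
      stageProd P P' Q R h (k + 1) (conn P.complex (Q.exact k) (stage_succ m k) x)
        (conn P'.complex (R.exact k) (stage_succ n k) y) := by
  rw [stageProd, stageProd_aux P P' Q R h, smul_smul, mul_comm]
  rfl

/-- The external product `Êxt^m(A₁, B) ⊗ Êxt^n(A₂, E) ⟶ Êxt^{m + n}(A₁ ⊗ A₂, B ⊗ E)` of completed
Ext groups, obtained by passing to the limit over the external products of Ext groups at the
stages `k`. -/
def extProd (P : ProjectiveResolution A₁) (P' : ProjectiveResolution A₂)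
    [IsTensorResolution P P'] (Q R : SyzRes C) [Q.Admissible] [R.Admissible] {m n s : ℤ}
    (h : m + n = s) (x : ExtHat P Q m) (y : ExtHat P' R n) :
    ExtHat (tensorRes P P') (Q.tensor R) s :=
  DirectLimit.lift₂ _ _ (stageProd P P' Q R h)
    (fun i j hij x y => seqMap_compat _ _ (stageProd P P' Q R h)
      (fun k x y => stageProd_succ P P' Q R h k x y) i j hij x y) x y

lemma extProd_of (P : ProjectiveResolution A₁) (P' : ProjectiveResolution A₂)
    [IsTensorResolution P P'] (Q R : SyzRes C) [Q.Admissible] [R.Admissible] {m n s : ℤ}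
    (h : m + n = s) (k : ℕ) (x : ExtGrp P.complex (Q.syz k) (m + k))
    (y : ExtGrp P'.complex (R.syz k) (n + k)) :
    extProd P P' Q R h (ExtHat.of P Q m k x) (ExtHat.of P' R n k y) =
      stageProd P P' Q R h k x y :=
  DirectLimit.lift₂_def _ _ _ _ _ _ _

/-- Complete cohomology `Ĥ^n(G, M) = Êxt^n(𝟙, M)` with `M = Q.syz 0`. Here `C` is the category of
`R`-modules with a `G`-action and the unit `𝟙` is `R`. -/
abbrev HHat (P : ProjectiveResolution (𝟙_ C)) (Q : SyzRes C) (n : ℤ) : Type v := ExtHat P Q n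

/-- The cup product `Ĥ^m(G, M) ⊗ Ĥ^n(G, N) ⟶ Ĥ^{m + n}(G, M ⊗ N)`: the external product, pulled back
along `𝟙 ≅ 𝟙 ⊗ 𝟙`. -/
def cup (P : ProjectiveResolution (𝟙_ C)) [IsTensorResolution P P] (Q R : SyzRes C)
    [Q.Admissible] [R.Admissible] {m n s : ℤ} (h : m + n = s) (x : HHat P Q m) (y : HHat P R n) :
    HHat P (Q.tensor R) s :=
  ExtHat.comap (λ_ (𝟙_ C)).inv _ s (extProd P P Q R h x y)

end Products

section Yoneda

open CochainComplex.HomComplex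

variable {C : Type u} [Category.{v} C] [Abelian C] (F G H : CochainComplex C ℤ)

/-- The bounded cochains of degree `n`: those with only finitely many nonzero components. -/
def bdd (n : ℤ) : AddSubgroup (Cochain F G n) where
  carrier := {z | {p : ℤ | ∃ (q : ℤ) (hpq : p + n = q), z.v p q hpq ≠ 0}.Finite}
  zero_mem' := by simp
  add_mem' {z z'} hz hz' := by
    refine (hz.union hz').subset ?_
    rintro p ⟨q, hpq, h⟩
    by_contra h'
    simp only [Set.mem_union, Set.mem_ofPred_eq, not_or, not_exists, not_not] at h'
    exact h (by rw [Cochain.add_v, h'.1 q hpq, h'.2 q hpq, add_zero])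
  neg_mem' {z} hz := by simpa using hz

/-- Cochains of degree `n` whose differential is bounded ("almost chain maps"). -/
def almostCocycles (n : ℤ) : AddSubgroup (Cochain F G n) :=
  (bdd F G (n + 1)).comap (δ_hom ℤ F G n (n + 1)).toAddMonoidHom

/-- Cochains of degree `n` that are a coboundary up to a bounded cochain. -/
def almostCoboundaries (n : ℤ) : AddSubgroup (Cochain F G n) :=
  (δ_hom ℤ F G (n - 1) n).toAddMonoidHom.range ⊔ bdd F G n

/-- The cohomology in degree `n` of the quotient of the Hom complex by the subcomplex of bounded
cochains. -/
abbrev VogelH (n : ℤ) : Type v :=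
  almostCocycles F G n ⧸ (almostCoboundaries F G n).addSubgroupOf (almostCocycles F G n)

variable {F G H}

lemma comp_mem_bdd_left {m n s : ℤ} (h : m + n = s) {z : Cochain F G m} (hz : z ∈ bdd F G m)
    (w : Cochain G H n) : z.comp w h ∈ bdd F H s := by
  refine Set.Finite.subset hz ?_
  rintro p ⟨q, hpq, hne⟩
  refine ⟨p + m, rfl, fun h0 => hne ?_⟩
  rw [Cochain.comp_v z w h p (p + m) q rfl (by omega), h0, zero_comp]

lemma comp_mem_bdd_right {m n s : ℤ} (h : m + n = s) (z : Cochain F G m) {w : Cochain G H n}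
    (hw : w ∈ bdd G H n) : z.comp w h ∈ bdd F H s := by
  refine Set.Finite.subset (Set.Finite.image (fun p => p - m) hw) ?_
  rintro p ⟨q, hpq, hne⟩
  refine ⟨p + m, ⟨q, by omega, fun h0 => hne ?_⟩, by simp⟩
  rw [Cochain.comp_v z w h p (p + m) q rfl (by omega), h0, comp_zero]

lemma units_smul_mem {T : Type*} [AddCommGroup T] (N : AddSubgroup T) (r : ℤˣ) {x : T}
    (hx : x ∈ N) : r • x ∈ N := by
  rcases Int.units_eq_one_or r with rfl | rfl
  · rwa [one_smul]
  · rw [Units.neg_smul, one_smul]; exact neg_mem hx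

lemma comp_mem_almostCocycles {m n s : ℤ} (h : m + n = s) {z : Cochain F G m}
    (hz : z ∈ almostCocycles F G m) {w : Cochain G H n} (hw : w ∈ almostCocycles G H n) :
    z.comp w h ∈ almostCocycles F H s := by
  change δ s (s + 1) (z.comp w h) ∈ bdd F H (s + 1)
  rw [δ_comp z w h (m + 1) (n + 1) (s + 1) rfl rfl rfl]
  exact add_mem (comp_mem_bdd_right _ _ hw) (units_smul_mem _ _ (comp_mem_bdd_left _ hz _))

lemma comp_mem_left {m n s : ℤ} (h : m + n = s) {z : Cochain F G m}
    (hz : z ∈ almostCoboundaries F G m) {w : Cochain G H n} (hw : w ∈ almostCocycles G H n) :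
    z.comp w h ∈ almostCoboundaries F H s := by
  obtain ⟨_, ⟨c, rfl⟩, b, hb, rfl⟩ := AddSubgroup.mem_sup.1 hz
  rw [Cochain.add_comp]
  refine add_mem ?_ (le_sup_right (a := (δ_hom ℤ F H (s - 1) s).toAddMonoidHom.range)
    (comp_mem_bdd_left h hb w))
  have h1 := δ_comp c w (n₁₂ := s - 1) (by omega) m (n + 1) s (by omega) (by omega) rfl
  have h2 : (δ (m - 1) m c).comp w h =
      n.negOnePow • (δ (s - 1) s (c.comp w (by omega)) - c.comp (δ n (n + 1) w) (by omega)) := by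
    rw [h1, add_sub_cancel_left, smul_smul, Int.units_mul_self, one_smul]
  change (δ (m - 1) m c).comp w h ∈ _
  rw [h2]
  exact units_smul_mem _ _ (sub_mem (le_sup_left (b := bdd F H s) ⟨_, rfl⟩)
    (le_sup_right (a := (δ_hom ℤ F H (s - 1) s).toAddMonoidHom.range)
      (comp_mem_bdd_right _ _ hw)))

lemma comp_mem_right {m n s : ℤ} (h : m + n = s) {z : Cochain F G m}
    (hz : z ∈ almostCocycles F G m) {w : Cochain G H n} (hw : w ∈ almostCoboundaries G H n) :
    z.comp w h ∈ almostCoboundaries F H s := by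
  obtain ⟨_, ⟨c, rfl⟩, b, hb, rfl⟩ := AddSubgroup.mem_sup.1 hw
  rw [Cochain.comp_add]
  refine add_mem ?_ (le_sup_right (a := (δ_hom ℤ F H (s - 1) s).toAddMonoidHom.range)
    (comp_mem_bdd_right h z hb))
  have h1 := δ_comp z c (n₁₂ := s - 1) (by omega) (m + 1) n s (by omega) rfl (by omega)
  have h2 : z.comp (δ (n - 1) n c) h = δ (s - 1) s (z.comp c (by omega)) -
      (n - 1).negOnePow • (δ m (m + 1) z).comp c (by omega) := by
    rw [h1, add_sub_cancel_right]
  change z.comp (δ (n - 1) n c) h ∈ _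
  rw [h2]
  exact sub_mem (le_sup_left (b := bdd F H s) ⟨_, rfl⟩)
    (le_sup_right (a := (δ_hom ℤ F H (s - 1) s).toAddMonoidHom.range)
      (units_smul_mem _ _ (comp_mem_bdd_left _ hz _)))

/-- The composition product on the cohomology of the quotient complexes, `[w] ∘ [z] = [w ∘ z]`. -/
def VogelH.comp {m n s : ℤ} (h : m + n = s) (y : VogelH G H n) (x : VogelH F G m) :
    VogelH F H s :=
  Quotient.liftOn₂' x y
    (fun z w => QuotientAddGroup.mk ⟨z.1.comp w.1 h, comp_mem_almostCocycles h z.2 w.2⟩) (by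
      intro z w z' w' hz hw
      rw [QuotientAddGroup.leftRel_apply, AddSubgroup.mem_addSubgroupOf] at hz hw
      refine QuotientAddGroup.eq.2 ?_
      rw [AddSubgroup.mem_addSubgroupOf]
      have e : -(z.1.comp w.1 h) + z'.1.comp w'.1 h =
          (-z.1 + z'.1).comp w'.1 h + z.1.comp (-w.1 + w'.1) h := by
        rw [Cochain.add_comp, Cochain.comp_add, Cochain.neg_comp, Cochain.comp_neg]
        abel
      change -(z.1.comp w.1 h) + z'.1.comp w'.1 h ∈ almostCoboundaries F H s
      rw [e]
      exact add_mem (comp_mem_left h hz w'.2) (comp_mem_right h z.2 hw))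

variable {A A₁ A₂ : C}

/-- The completed unenriched Ext group `Êxt^n(A, A₁)` given by the hypercohomology construction:
the cohomology of the Hom complex of two projective resolutions (extended by zero to complexes
indexed by `ℤ`) modulo the subcomplex of bounded cochains. -/
abbrev ExtHatV (P : ProjectiveResolution A) (P₁ : ProjectiveResolution A₁) (n : ℤ) : Type v :=
  VogelH P.cochainComplex P₁.cochainComplex n

/-- The Yoneda product `Êxt^n(A₁, A₂) ⊗ Êxt^m(A, A₁) ⟶ Êxt^{m + n}(A, A₂)`: the composition of
almost chain maps. -/
def yoneda {P : ProjectiveResolution A} {P₁ : ProjectiveResolution A₁}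
    {P₂ : ProjectiveResolution A₂} {m n s : ℤ} (h : m + n = s) (y : ExtHatV P₁ P₂ n)
    (x : ExtHatV P P₁ m) : ExtHatV P P₂ s :=
  VogelH.comp h y x

end Yoneda

end

end CompletedExt

/-!
The product of cochains is strictly associative up to the associativity isomorphisms
(`preCoch_assocCx_cross`), so at a finite stage there is nothing to prove beyond bookkeeping. The
content of the associativity of external products is that the two sides live over different
resolutions of `B ⊗ E ⊗ H`, that a comparison map between them is not canonical at any finite
stage, and that the signs in the definition of the products have to match.

The syzygies of both resolutions are among the objects `B_i ⊗ E_j ⊗ H_l`, indexed by the lattice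
points `(i, j, l)` of `ℕ³`, where `B_i` etc. are syzygies. Each unit step in the lattice is a short
exact sequence with projective middle term, and the two resolutions follow two lattice paths
(`tensor_chain_leftPath`, `tensor_chain_rightPath`). Three facts lead to the result.

* A map of objects determines the map of syzygies modulo maps that factor through projective objects
  (`SyzStep.Lifts.stEq`), and such maps vanish on completed Ext groups, because a connecting
  homomorphism kills every class with projective coefficients (`ExtHat.of_post_eq_zero`). So the
  comparison map may be computed modulo projective objects.
* Interchanging two consecutive directions of a path changes the comparison map by the sign `-1`
  modulo projective objects. This is a chase in the `3 × 3` diagram of the tensor product of two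
  short exact sequences (`SyzStep.exists_lifts_swap`), and it gives the comparison map for any two
  paths that differ by a permutation (`latChain_perm`).
* The connecting homomorphism of a step takes a triple product of representatives to the triple
  product at the next lattice point, up to the sign of moving it past the factors on the left
  (`conn_crossAt_path`). The same interchange changes the product of these signs by `-1` as well
  (`Dir.sign_swap`).

Hence the comparison map takes triple products to triple products, up to the quotient of the signs
of the paths (`of_lift_crossAt`). The two paths do not end at the same lattice point, but both can
be extended to end at a common one (`leftPath_perm_rightPath`). The signs of the two paths are
exactly the signs in the definition of the iterated products (`pathSign_leftPath`,
`pathSign_rightPath`), which gives `extProd_assoc`.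

For cup products, the faithful exact monoidal functor turns a resolution of the unit object into a
resolution of a projective object. Such a resolution is homotopy equivalent to the object itself, so
tensor products of such resolutions are resolutions (`isTensorResolution_of_projective`), and the
functor detects this (`isTensorResolution_of_map`). Associativity of cup products (`cup_assoc`)
follows from that of external products, their naturality in the first variables (`extProd_comap`)
and the coherence of the monoidal structure.

For Yoneda products, composition of cochains is associative on representatives
(`VogelH.comp_assoc`).
-/

namespace CompletedExt

noncomputable section

/-! ### Morphisms modulo projective objects -/

section Stable

variable {C : Type u} [Category.{v} C] [Abelian C]

/-- The morphisms `f` and `g` become equal in the stable category: their difference factors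
through a projective object. -/
def StEq {X Y : C} (f g : X ⟶ Y) : Prop :=
  ∃ (P : C) (_ : Projective P) (a : X ⟶ P) (b : P ⟶ Y), f = g + a ≫ b

lemma StEq.refl {X Y : C} (f : X ⟶ Y) : StEq f f :=
  ⟨_, Projective.zero_projective, 0, 0, by simp⟩

lemma StEq.trans {X Y : C} {f g h : X ⟶ Y} (h₁ : StEq f g) (h₂ : StEq g h) : StEq f h := by
  obtain ⟨P, hP, a, b, rfl⟩ := h₁
  obtain ⟨P', hP', a', b', rfl⟩ := h₂
  exact ⟨P ⊞ P', inferInstance, biprod.lift a a', biprod.desc b b', by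
    rw [biprod.lift_desc]; abel⟩

lemma StEq.comp {X Y Z : C} {f f' : X ⟶ Y} {g g' : Y ⟶ Z} (hf : StEq f f') (hg : StEq g g') :
    StEq (f ≫ g) (f' ≫ g') := by
  obtain ⟨P, hP, a, b, rfl⟩ := hf
  obtain ⟨P', hP', a', b', rfl⟩ := hg
  refine StEq.trans (g := f' ≫ (g' + a' ≫ b')) ⟨P, hP, a, b ≫ (g' + a' ≫ b'), by
    rw [Preadditive.add_comp, Category.assoc]⟩
    ⟨P', hP', f' ≫ a', b', by simp⟩

/-- Stably equal morphisms differ on `Ext` by a class that comes from a projective coefficient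
object. -/
lemma StEq.post {K : ChainComplex C ℕ} {X Y : C} {f g : X ⟶ Y} (h : StEq f g) {n : ℤ}
    (x : ExtGrp K X n) : ∃ (P : C) (_ : Projective P) (b : P ⟶ Y) (y : ExtGrp K P n),
      ExtGrp.post K f n x = ExtGrp.post K g n x + ExtGrp.post K b n y := by
  obtain ⟨P, hP, a, b, rfl⟩ := h
  refine ⟨P, hP, b, ExtGrp.post K a n x, ?_⟩
  obtain ⟨u, hu, rfl⟩ := cls_surj x
  exact cls_congr _ (by funext i; simp)

end Stable

/-! ### Functoriality of Ext in the coefficients -/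

section Post

variable {C : Type u} [Category.{v} C] [Abelian C] {K L : ChainComplex C ℕ}

lemma ExtGrp.post_id {X : C} {n : ℤ} (x : ExtGrp K X n) : ExtGrp.post K (𝟙 X) n x = x := by
  obtain ⟨u, hu, rfl⟩ := cls_surj x
  exact cls_congr _ (by funext i; simp)

lemma ExtGrp.post_post {X Y Z : C} (f : X ⟶ Y) (g : Y ⟶ Z) {n : ℤ} (x : ExtGrp K X n) :
    ExtGrp.post K g n (ExtGrp.post K f n x) = ExtGrp.post K (f ≫ g) n x := by
  obtain ⟨u, hu, rfl⟩ := cls_surj x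
  exact cls_congr _ (by funext i; simp)

lemma ExtGrp.post_smul_hom {X Y : C} (r : ℤˣ) (f : X ⟶ Y) {n : ℤ} (x : ExtGrp K X n) :
    ExtGrp.post K (r • f) n x = r • ExtGrp.post K f n x := by
  obtain ⟨u, hu, rfl⟩ := cls_surj x
  refine Eq.trans ?_ (smul_cls r (postCoch_mem_cocycles f hu)).symm
  exact cls_congr _ (by funext i; simp [Linear.comp_units_smul])

lemma map_units_smul {G H : Type*} [AddCommGroup G] [AddCommGroup H] (f : G →+ H) (r : ℤˣ)
    (x : G) : f (r • x) = r • f x := by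
  rcases Int.units_eq_one_or r with rfl | rfl
  · simp
  · simp [Units.neg_smul]

lemma ExtGrp.pre_post (φ : K ⟶ L) {X Y : C} (f : X ⟶ Y) {n : ℤ} (x : ExtGrp L X n) :
    ExtGrp.pre Y φ n (ExtGrp.post L f n x) = ExtGrp.post K f n (ExtGrp.pre X φ n x) := by
  obtain ⟨u, hu, rfl⟩ := cls_surj x
  exact cls_congr _ (by funext i; simp)

variable (K) in
/-- The identification of Ext groups in equal degrees. -/
def ExtGrp.cast (X : C) {n n' : ℤ} (h : n = n') : ExtGrp K X n →+ ExtGrp K X n' :=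
  h ▸ AddMonoidHom.id _

end Post

/-! ### Ladders between chains of short exact sequences -/

section Ladder

variable {C : Type u} [Category.{v} C] [Abelian C]

/-- A short exact sequence `0 ⟶ X' ⟶ mid ⟶ X ⟶ 0` with projective middle term, which exhibits
`X'` as a syzygy of `X`. -/
structure SyzStep (X X' : C) where
  /-- the projective middle term -/
  mid : C
  projective : Projective mid
  /-- the inclusion of the syzygy -/
  ι : X' ⟶ mid
  /-- the projection onto the resolved object -/
  π : mid ⟶ X
  w : ι ≫ π = 0
  exact : (ShortComplex.mk ι π w).ShortExact

/-- The pair `(f, g)` extends to a morphism of short exact sequences. -/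
def SyzStep.Lifts {X X' Y Y' : C} (e : SyzStep X X') (e' : SyzStep Y Y') (f : X ⟶ Y)
    (g : X' ⟶ Y') : Prop :=
  ∃ m : e.mid ⟶ e'.mid, g ≫ e'.ι = e.ι ≫ m ∧ m ≫ e'.π = e.π ≫ f

namespace SyzStep

variable {X X' Y Y' Z Z' : C} {e : SyzStep X X'} {e' : SyzStep Y Y'} {e'' : SyzStep Z Z'}

lemma exists_lifts (e : SyzStep X X') (e' : SyzStep Y Y') (f : X ⟶ Y) :
    ∃ g, e.Lifts e' f g := by
  have := e.projective
  have := e'.exact.epi_g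
  have := e'.exact.mono_f
  let m : e.mid ⟶ e'.mid := Projective.factorThru (e.π ≫ f) e'.π
  have hm : m ≫ e'.π = e.π ≫ f := Projective.factorThru_comp _ _
  have h0 : (e.ι ≫ m) ≫ e'.π = 0 := by rw [Category.assoc, hm, ← Category.assoc, e.w, zero_comp]
  exact ⟨e'.exact.exact.lift _ h0, m, e'.exact.exact.lift_f _ h0, hm⟩

lemma Lifts.id (e : SyzStep X X') : e.Lifts e (𝟙 X) (𝟙 X') := ⟨𝟙 _, by simp, by simp⟩

lemma Lifts.comp {f : X ⟶ Y} {f' : X' ⟶ Y'} {g : Y ⟶ Z} {g' : Y' ⟶ Z'} (h : e.Lifts e' f f')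
    (h' : e'.Lifts e'' g g') : e.Lifts e'' (f ≫ g) (f' ≫ g') := by
  obtain ⟨m, h1, h2⟩ := h
  obtain ⟨m', h1', h2'⟩ := h'
  refine ⟨m ≫ m', ?_, ?_⟩
  · rw [Category.assoc, h1', ← Category.assoc, h1, Category.assoc]
  · rw [Category.assoc, h2', ← Category.assoc, h2, Category.assoc]

lemma Lifts.smul {f : X ⟶ Y} {f' : X' ⟶ Y'} (h : e.Lifts e' f f') (r : ℤˣ) :
    e.Lifts e' (r • f) (r • f') := by
  obtain ⟨m, h1, h2⟩ := h
  refine ⟨r • m, ?_, ?_⟩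
  · rw [Linear.units_smul_comp, Linear.comp_units_smul, h1]
  · rw [Linear.units_smul_comp, Linear.comp_units_smul, h2]

/-- Passing to syzygies is well defined modulo projective objects. -/
lemma Lifts.stEq {f g : X ⟶ Y} {f' g' : X' ⟶ Y'} (h : e.Lifts e' f f') (h' : e.Lifts e' g g')
    (hfg : StEq f g) : StEq f' g' := by
  obtain ⟨m, h1, h2⟩ := h
  obtain ⟨m', h1', h2'⟩ := h'
  obtain ⟨P, hP, a, b, rfl⟩ := hfg
  have := e'.exact.epi_g
  have := e'.exact.mono_f
  have hb : Projective.factorThru b e'.π ≫ e'.π = b := Projective.factorThru_comp _ _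
  have h0 : (m - m' - e.π ≫ a ≫ Projective.factorThru b e'.π) ≫ e'.π = 0 := by
    simp [Preadditive.sub_comp, h2, h2', hb]
  obtain ⟨r, hr⟩ : ∃ r, r ≫ e'.ι = m - m' - e.π ≫ a ≫ Projective.factorThru b e'.π :=
    ⟨_, e'.exact.exact.lift_f _ h0⟩
  refine ⟨e.mid, e.projective, e.ι, r, ?_⟩
  have : Mono e'.ι := e'.exact.mono_f
  rw [← cancel_mono e'.ι, Preadditive.add_comp, Category.assoc, hr, h1, h1']
  simp [Preadditive.comp_sub, ← Category.assoc, e.w]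

/-- The form of `Lifts.id` for steps whose end points are only propositionally equal. -/
lemma lifts_eqToHom {ι : Type*} {S T : ι → C} (e : ∀ i, SyzStep (S i) (T i)) {i j : ι}
    (h : i = j) : (e i).Lifts (e j) (eqToHom (congrArg S h)) (eqToHom (congrArg T h)) := by
  subst h
  exact Lifts.id _

variable (K : ChainComplex C ℕ) [∀ i, Projective (K.X i)]

/-- The connecting homomorphism of a step. -/
def conn (e : SyzStep X X') {n n' : ℤ} (h : n + 1 = n') : ExtGrp K X n →+ ExtGrp K X' n' :=
  CompletedExt.conn K e.exact h

lemma Lifts.conn_post {f : X ⟶ Y} {g : X' ⟶ Y'} (hfg : e.Lifts e' f g) {n n' : ℤ}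
    (h : n + 1 = n') (x : ExtGrp K X n) :
    e'.conn K h (ExtGrp.post K f n x) = ExtGrp.post K g n' (e.conn K h x) := by
  obtain ⟨m, h1, h2⟩ := hfg
  exact CompletedExt.conn_post e.exact e'.exact ⟨g, m, f, h1, h2⟩ h x

/-- The connecting homomorphism of a step vanishes on classes that come from a projective
object, since these lift to the middle term. -/
lemma conn_post_projective (e : SyzStep X X') {P : C} [Projective P] (b : P ⟶ X) {n n' : ℤ}
    (h : n + 1 = n') (y : ExtGrp K P n) : e.conn K h (ExtGrp.post K b n y) = 0 := by
  have : Epi e.π := e.exact.epi_g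
  have := e.exact.mono_f
  obtain ⟨u, hu, rfl⟩ := cls_surj y
  refine (conn_cls e.exact h (postCoch_mem_cocycles b hu) (w := 0)
    ⟨postCoch K (Projective.factorThru b e.π) u, postCoch_mem_degPart _ hu.1, ?_, ?_⟩).trans rfl
  · funext i
    simp
  · rw [map_zero, codiff_postCoch, show codiff K P u = 0 from hu.2, map_zero]

end SyzStep

/-- A finite sequence of steps, which exhibits `Y` as an iterated syzygy of `X`. -/
inductive SyzChain (X : C) : C → Type (max u v)
  | nil : SyzChain X X
  | snoc {Y Z : C} (c : SyzChain X Y) (e : SyzStep Y Z) : SyzChain X Z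

namespace SyzChain

/-- The number of steps. -/
def length {X : C} : ∀ {Y : C}, SyzChain X Y → ℕ
  | _, nil => 0
  | _, snoc c _ => c.length + 1

/-- Concatenation. -/
def append {X Y : C} (c : SyzChain X Y) : ∀ {Z : C}, SyzChain Y Z → SyzChain X Z
  | _, nil => c
  | _, snoc c' e => (c.append c').snoc e

/-- The pair `(f, g)` extends to a morphism of chains; in particular the chains have the same
length. -/
def Lifts {X X' : C} (f : X ⟶ X') :
    ∀ {Y Y' : C}, SyzChain X Y → SyzChain X' Y' → (Y ⟶ Y') → Prop
  | _, _, nil, nil, g => g = f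
  | _, _, snoc c e, snoc c' e', g => ∃ g₀, Lifts f c c' g₀ ∧ e.Lifts e' g₀ g
  | _, _, nil, snoc _ _, _ => False
  | _, _, snoc _ _, nil, _ => False

variable {X X' X'' Y Y' Y'' Z Z' : C}

lemma Lifts.length_eq {f : X ⟶ X'} : ∀ {Y Y' : C} {c : SyzChain X Y} {c' : SyzChain X' Y'}
    {g : Y ⟶ Y'}, Lifts f c c' g → c.length = c'.length
  | _, _, nil, nil, _, _ => rfl
  | _, _, snoc _ _, snoc _ _, _, h => by
    obtain ⟨_, h, _⟩ := h
    exact congrArg (· + 1) h.length_eq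

lemma Lifts.id : ∀ {Y : C} (c : SyzChain X Y), Lifts (𝟙 X) c c (𝟙 Y)
  | _, nil => rfl
  | _, snoc c e => ⟨_, Lifts.id c, SyzStep.Lifts.id e⟩

lemma exists_lifts (f : X ⟶ X') : ∀ {Y Y' : C} (c : SyzChain X Y) (c' : SyzChain X' Y'),
    c.length = c'.length → ∃ g, Lifts f c c' g
  | _, _, nil, nil, _ => ⟨f, rfl⟩
  | _, _, snoc c e, snoc c' e', h => by
    obtain ⟨g, hg⟩ := exists_lifts f c c' (Nat.succ_injective h)
    obtain ⟨g', hg'⟩ := e.exists_lifts e' g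
    exact ⟨g', g, hg, hg'⟩
  | _, _, nil, snoc _ _, h => by simp [length] at h
  | _, _, snoc _ _, nil, h => by simp [length] at h

lemma Lifts.comp {f : X ⟶ X'} {f' : X' ⟶ X''} : ∀ {Y Y' Y'' : C} {c : SyzChain X Y}
    {c' : SyzChain X' Y'} {c'' : SyzChain X'' Y''} {g : Y ⟶ Y'} {g' : Y' ⟶ Y''},
    Lifts f c c' g → Lifts f' c' c'' g' → Lifts (f ≫ f') c c'' (g ≫ g')
  | _, _, _, nil, nil, nil, _, _, rfl, rfl => rfl
  | _, _, _, snoc _ _, snoc _ _, snoc _ _, _, _, h, h' => by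
    obtain ⟨_, h₁, h₂⟩ := h
    obtain ⟨_, h₁', h₂'⟩ := h'
    exact ⟨_, h₁.comp h₁', h₂.comp h₂'⟩

/-- A map of objects determines the map of iterated syzygies modulo projective objects. -/
lemma Lifts.stEq {f f' : X ⟶ X'} (hf : StEq f f') : ∀ {Y Y' : C} {c : SyzChain X Y}
    {c' : SyzChain X' Y'} {g g' : Y ⟶ Y'}, Lifts f c c' g → Lifts f' c c' g' → StEq g g'
  | _, _, nil, nil, _, _, rfl, rfl => hf
  | _, _, snoc _ _, snoc _ _, _, _, h, h' => by
    obtain ⟨_, h₁, h₂⟩ := h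
    obtain ⟨_, h₁', h₂'⟩ := h'
    exact h₂.stEq h₂' (Lifts.stEq hf h₁ h₁')

lemma Lifts.append {f : X ⟶ X'} {g : Y ⟶ Y'} {c : SyzChain X Y} {c' : SyzChain X' Y'}
    (h : Lifts f c c' g) : ∀ {Z Z' : C} {d : SyzChain Y Z} {d' : SyzChain Y' Z'} {k : Z ⟶ Z'},
    Lifts g d d' k → Lifts f (c.append d) (c'.append d') k
  | _, _, nil, nil, _, rfl => h
  | _, _, snoc _ _, snoc _ _, _, h' => by
    obtain ⟨_, h₁, h₂⟩ := h'
    exact ⟨_, h.append h₁, h₂⟩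

variable (K : ChainComplex C ℕ) [∀ i, Projective (K.X i)]

/-- The iterated connecting homomorphism of a chain. -/
def conn : ∀ {Y : C} (c : SyzChain X Y) {n n' : ℤ} (_ : n + c.length = n'),
    ExtGrp K X n →+ ExtGrp K Y n'
  | _, nil, _, _, h => ExtGrp.cast K X (by simpa [length] using h)
  | _, snoc c e, n, n', h =>
    (e.conn K (n := n + c.length) (by rw [← h, length]; push_cast; ring)).comp (c.conn rfl)

lemma conn_snoc (c : SyzChain X Y) (e : SyzStep Y Z) {n n' n'' : ℤ} (h : n + c.length = n')
    (h' : n' + 1 = n'') (h'' : n + (c.snoc e).length = n'') (x : ExtGrp K X n) :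
    (c.snoc e).conn K h'' x = e.conn K h' (c.conn K h x) := by
  subst h
  rfl

/-- Naturality of iterated connecting homomorphisms. -/
lemma Lifts.conn_post {f : X ⟶ X'} : ∀ {Y Y' : C} {c : SyzChain X Y} {c' : SyzChain X' Y'}
    {g : Y ⟶ Y'}, Lifts f c c' g → ∀ {n n' : ℤ} (h : n + c.length = n') (h' : n + c'.length = n')
    (x : ExtGrp K X n), c'.conn K h' (ExtGrp.post K f n x) = ExtGrp.post K g n' (c.conn K h x)
  | _, _, nil, nil, _, rfl, n, n', h, h', x => by
    obtain rfl : n = n' := by simpa [length] using h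
    rfl
  | _, _, snoc c e, snoc c' e', _, hg, n, n', h, h', x => by
    obtain ⟨g₀, h₁, h₂⟩ := hg
    have h3 := h₁.length_eq
    have a : n + c.length + 1 = n' := by rw [← h, length]; push_cast; ring
    rw [conn_snoc K c e rfl a h, conn_snoc K c' e' (n' := n + c.length) (by rw [h3]) a h',
      h₁.conn_post rfl (by rw [h3]), h₂.conn_post K]

end SyzChain

end Ladder

/-! ### Interchanging two steps -/

section Swap

variable {C : Type u} [Category.{v} C] [Abelian C]

/-- Given a commutative `3 × 3` diagram of steps with corners `X₀₀`, `X₁₀`, `X₀₁`, `X₁₁` and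
projective centre `M`, the two ways to exhibit `X₁₁` as a second syzygy of `X₀₀` differ by the
sign `-1` modulo projective objects. -/
lemma SyzStep.exists_lifts_swap {X₀₀ X₁₀ X₀₁ X₁₁ M : C} (p₀ : SyzStep X₀₀ X₁₀)
    (q₁ : SyzStep X₁₀ X₁₁) (q₀ : SyzStep X₀₀ X₀₁) (p₁ : SyzStep X₀₁ X₁₁) (hM : Projective M)
    (a : q₁.mid ⟶ M) (b : p₁.mid ⟶ M) (c : M ⟶ p₀.mid) (d : M ⟶ q₀.mid)
    (hac : a ≫ c = q₁.π ≫ p₀.ι) (had : a ≫ d = 0) (hbd : b ≫ d = p₁.π ≫ q₀.ι) (hbc : b ≫ c = 0)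
    (hcd : c ≫ p₀.π = d ≫ q₀.π) (hab : q₁.ι ≫ a = p₁.ι ≫ b) :
    ∃ f g, p₀.Lifts q₀ (𝟙 X₀₀) f ∧ q₁.Lifts p₁ f g ∧ StEq g (-𝟙 X₁₁) := by
  have := p₀.projective
  have := p₁.projective
  have : Epi q₀.π := q₀.exact.epi_g
  have : Epi p₁.π := p₁.exact.epi_g
  have : Mono q₀.ι := q₀.exact.mono_f
  have : Mono p₁.ι := p₁.exact.mono_f
  have lift₀ : ∀ {T : C} (t : T ⟶ q₀.mid), t ≫ q₀.π = 0 → ∃ r, r ≫ q₀.ι = t := fun t ht =>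
    have := q₀.exact.mono_f
    ⟨_, q₀.exact.exact.lift_f t ht⟩
  have lift₁ : ∀ {T : C} (t : T ⟶ p₁.mid), t ≫ p₁.π = 0 → ∃ r, r ≫ p₁.ι = t := fun t ht =>
    have := p₁.exact.mono_f
    ⟨_, p₁.exact.exact.lift_f t ht⟩
  obtain ⟨φ, hφ⟩ : ∃ φ, φ ≫ q₀.π = p₀.π := ⟨_, Projective.factorThru_comp p₀.π q₀.π⟩
  obtain ⟨f, hf⟩ := lift₀ (p₀.ι ≫ φ) (by rw [Category.assoc, hφ, p₀.w])
  -- The two maps `M ⟶ q₀.mid` agree on `X₀₀`; the difference measures the failure of `φ` to be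
  -- compatible with `d`.
  obtain ⟨k, hk⟩ := lift₀ (c ≫ φ - d) (by
    rw [Preadditive.sub_comp, Category.assoc, hφ, hcd, sub_self])
  obtain ⟨h, hh⟩ : ∃ h, h ≫ p₁.π = k := ⟨_, Projective.factorThru_comp k p₁.π⟩
  have h1 : (a ≫ h) ≫ p₁.π = q₁.π ≫ f := by
    rw [← cancel_mono q₀.ι, Category.assoc a, hh, Category.assoc, hk, Category.assoc, hf,
      Preadditive.comp_sub, had, sub_zero, ← Category.assoc, hac, Category.assoc]
  obtain ⟨g, hg⟩ := lift₁ (q₁.ι ≫ a ≫ h) (by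
    rw [Category.assoc, h1, ← Category.assoc, q₁.w, zero_comp])
  obtain ⟨r, hr⟩ := lift₁ (b ≫ h + 𝟙 _) (by
    rw [← cancel_mono q₀.ι, zero_comp, Preadditive.add_comp, Preadditive.add_comp,
      Category.assoc, Category.assoc, Category.id_comp, ← Category.assoc h, hh, hk,
      Preadditive.comp_sub, ← Category.assoc b c, hbc, zero_comp, hbd, zero_sub, neg_add_cancel])
  refine ⟨f, g, ⟨φ, hf, by rw [hφ, Category.comp_id]⟩, ⟨a ≫ h, hg, h1⟩, p₁.mid, p₁.projective,
    p₁.ι, r, ?_⟩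
  rw [← cancel_mono p₁.ι, hg, Preadditive.add_comp, Category.assoc, hr, Preadditive.comp_add,
    Preadditive.neg_comp, Category.id_comp, Category.comp_id, ← Category.assoc, hab,
    Category.assoc]
  abel

end Swap

/-! ### The lattice of triple tensor products of syzygies -/

section Lattice

variable {C : Type u} [Category.{v} C] [Abelian C]

/-- The steps of a resolution. -/
def SyzRes.step (Q : SyzRes C) (k : ℕ) : SyzStep (Q.syz k) (Q.syz (k + 1)) where
  mid := Q.proj k
  projective := Q.projective k
  ι := Q.ι k
  π := Q.π k
  w := Q.w k
  exact := Q.exact k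

variable [MonoidalCategory C] [MonoidalPreadditive C]

/-- A step tensored with an admissible object from the right. -/
def SyzStep.whiskerRight {X X' : C} (e : SyzStep X X') (Z : C) [TensorAdmissible Z] :
    SyzStep (X ⊗ Z) (X' ⊗ Z) where
  mid := e.mid ⊗ Z
  projective := TensorAdmissible.projective_right _ e.projective
  ι := e.ι ▷ Z
  π := e.π ▷ Z
  w := ((ShortComplex.mk _ _ e.w).map (tensorRight Z)).zero
  exact := TensorAdmissible.exact_right _ e.exact

/-- A step tensored with an admissible object from the left. -/
def SyzStep.whiskerLeft {X X' : C} (Z : C) [TensorAdmissible Z] (e : SyzStep X X') :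
    SyzStep (Z ⊗ X) (Z ⊗ X') where
  mid := Z ⊗ e.mid
  projective := TensorAdmissible.projective_left _ e.projective
  ι := Z ◁ e.ι
  π := Z ◁ e.π
  w := ((ShortComplex.mk _ _ e.w).map (tensorLeft Z)).zero
  exact := TensorAdmissible.exact_left _ e.exact

/-- The three coordinate directions in `ℕ³`. -/
inductive Dir : Type
  | fst
  | snd
  | trd

/-- The next lattice point in a given direction. -/
def Dir.next : Dir → ℕ × ℕ × ℕ → ℕ × ℕ × ℕ
  | fst, p => (p.1 + 1, p.2.1, p.2.2)
  | snd, p => (p.1, p.2.1 + 1, p.2.2)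
  | trd, p => (p.1, p.2.1, p.2.2 + 1)

/-- The end point of the lattice path that starts at `p` and whose directions are given by a
list, which is read from right to left. -/
def endPt (p : ℕ × ℕ × ℕ) : List Dir → ℕ × ℕ × ℕ
  | [] => p
  | d :: w => d.next (endPt p w)

/-- The sign in `δ_d (x ∨ y ∨ z) = ± (⋯)`, where `δ_d` is the connecting homomorphism in the
direction `d` and `x`, `y`, `z` have the degrees `m + p.1`, `n + p.2.1`, `⋯`: the homomorphism has
to be moved past the factors to the left. -/
def Dir.sign (m n : ℤ) : Dir → ℕ × ℕ × ℕ → ℤˣ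
  | fst, _ => 1
  | snd, p => (m + p.1).negOnePow
  | trd, p => (m + p.1 + (n + p.2.1)).negOnePow

/-- The product of the signs along a lattice path. -/
def pathSign (m n : ℤ) (p : ℕ × ℕ × ℕ) : List Dir → ℤˣ
  | [] => 1
  | d :: w => d.sign m n (endPt p w) * pathSign m n p w

/-- The four signs around a unit square multiply to `-1`: interchanging two directions changes the
sign by which connecting homomorphisms act on a triple product. This matches the sign in
`SyzStep.exists_lifts_swap`. -/
lemma Dir.sign_swap (m n : ℤ) {d e : Dir} (h : d ≠ e) (p : ℕ × ℕ × ℕ) :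
    e.sign m n (d.next p) * d.sign m n p * (d.sign m n (e.next p) * e.sign m n p) = -1 := by
  cases d <;> cases e <;> first
    | exact absurd rfl h
    | simp only [Dir.sign, Dir.next, one_mul, mul_one, ← Int.negOnePow_add]
      refine Int.negOnePow_odd _ ?_
      push_cast
      rw [Int.odd_iff]
      omega

variable (Q Q' Q'' : SyzRes C)

/-- The object `Q.syz i ⊗ Q'.syz j ⊗ Q''.syz l` at a lattice point. -/
abbrev latObj (p : ℕ × ℕ × ℕ) : C := (Q.syz p.1 ⊗ Q'.syz p.2.1) ⊗ Q''.syz p.2.2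

variable [Q.Admissible] [Q'.Admissible] [Q''.Admissible]

/-- The step in a given direction. -/
def latStep : ∀ (d : Dir) (p : ℕ × ℕ × ℕ),
    SyzStep (latObj Q Q' Q'' p) (latObj Q Q' Q'' (d.next p))
  | .fst, p => ((Q.step p.1).whiskerRight (Q'.syz p.2.1)).whiskerRight (Q''.syz p.2.2)
  | .snd, p => ((Q'.step p.2.1).whiskerLeft (Q.syz p.1)).whiskerRight (Q''.syz p.2.2)
  | .trd, p => (Q''.step p.2.2).whiskerLeft (Q.syz p.1 ⊗ Q'.syz p.2.1)

/-- The chain of steps along a lattice path. -/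
def latChain (p : ℕ × ℕ × ℕ) :
    ∀ w : List Dir, SyzChain (latObj Q Q' Q'' p) (latObj Q Q' Q'' (endPt p w))
  | [] => .nil
  | d :: w => (latChain p w).snoc (latStep Q Q' Q'' d (endPt p w))

lemma length_latChain (p : ℕ × ℕ × ℕ) :
    ∀ w : List Dir, (latChain Q Q' Q'' p w).length = w.length
  | [] => rfl
  | _ :: w => congrArg (· + 1) (length_latChain p w)

lemma SyzStep.w_whiskerRight {X X' : C} (e : SyzStep X X') (Z : C) :
    e.ι ▷ Z ≫ e.π ▷ Z = 0 := by
  rw [← comp_whiskerRight, e.w, MonoidalPreadditive.zero_whiskerRight]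

lemma SyzStep.w_whiskerLeft {X X' : C} (e : SyzStep X X') (Z : C) :
    Z ◁ e.ι ≫ Z ◁ e.π = 0 := by
  rw [← MonoidalCategory.whiskerLeft_comp, e.w, MonoidalPreadditive.whiskerLeft_zero]

lemma SyzStep.Lifts.whiskerRight {X X' Y Y' : C} {e : SyzStep X X'} {e' : SyzStep Y Y'}
    {f : X ⟶ Y} {g : X' ⟶ Y'} (h : e.Lifts e' f g) (Z : C) [TensorAdmissible Z] :
    (e.whiskerRight Z).Lifts (e'.whiskerRight Z) (f ▷ Z) (g ▷ Z) := by
  obtain ⟨m, h1, h2⟩ := h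
  refine ⟨m ▷ Z, ?_, ?_⟩
  · change g ▷ Z ≫ e'.ι ▷ Z = e.ι ▷ Z ≫ m ▷ Z
    rw [← comp_whiskerRight, h1, comp_whiskerRight]
  · change m ▷ Z ≫ e'.π ▷ Z = e.π ▷ Z ≫ f ▷ Z
    rw [← comp_whiskerRight, h2, comp_whiskerRight]

lemma StEq.whiskerRight {X Y : C} {f g : X ⟶ Y} (h : StEq f g) (Z : C) [TensorAdmissible Z] :
    StEq (f ▷ Z) (g ▷ Z) := by
  obtain ⟨P, hP, a, b, rfl⟩ := h
  exact ⟨P ⊗ Z, TensorAdmissible.projective_right _ hP, a ▷ Z, b ▷ Z, by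
    rw [MonoidalPreadditive.add_whiskerRight, comp_whiskerRight]⟩

variable [TensorProjective C]

/-- The `3 × 3` diagram of the tensor product of two steps. -/
lemma SyzStep.exists_lifts_tensor {X X' Y Y' : C} [TensorAdmissible X] [TensorAdmissible X']
    [TensorAdmissible Y] [TensorAdmissible Y'] (e : SyzStep X X') (e' : SyzStep Y Y') :
    ∃ f g, (e.whiskerRight Y).Lifts (e'.whiskerLeft X) (𝟙 (X ⊗ Y)) f ∧
      (e'.whiskerLeft X').Lifts (e.whiskerRight Y') f g ∧ StEq g (-𝟙 (X' ⊗ Y')) :=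
  SyzStep.exists_lifts_swap (e.whiskerRight Y) (e'.whiskerLeft X') (e'.whiskerLeft X)
    (e.whiskerRight Y') (TensorProjective.out _ _ e.projective e'.projective)
    (e.ι ▷ e'.mid) (e.mid ◁ e'.ι) (e.mid ◁ e'.π) (e.π ▷ e'.mid)
    (whisker_exchange _ _).symm (e.w_whiskerRight _) (whisker_exchange _ _)
    (e'.w_whiskerLeft _) (whisker_exchange _ _) (whisker_exchange _ _)

/-- The same diagram with the two steps taken in the opposite order. -/
lemma SyzStep.exists_lifts_tensor' {X X' Y Y' : C} [TensorAdmissible X] [TensorAdmissible X']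
    [TensorAdmissible Y] [TensorAdmissible Y'] (e : SyzStep X X') (e' : SyzStep Y Y') :
    ∃ f g, (e'.whiskerLeft X).Lifts (e.whiskerRight Y) (𝟙 (X ⊗ Y)) f ∧
      (e.whiskerRight Y').Lifts (e'.whiskerLeft X') f g ∧ StEq g (-𝟙 (X' ⊗ Y')) :=
  SyzStep.exists_lifts_swap (e'.whiskerLeft X) (e.whiskerRight Y') (e.whiskerRight Y)
    (e'.whiskerLeft X') (TensorProjective.out _ _ e.projective e'.projective)
    (e.mid ◁ e'.ι) (e.ι ▷ e'.mid) (e.π ▷ e'.mid) (e.mid ◁ e'.π)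
    (whisker_exchange _ _) (e'.w_whiskerLeft _) (whisker_exchange _ _).symm
    (e.w_whiskerRight _) (whisker_exchange _ _).symm (whisker_exchange _ _).symm

/-- Interchanging two directions at a lattice point. -/
lemma latStep_swap {d e : Dir} (h : d ≠ e) (p : ℕ × ℕ × ℕ)
    (hde : e.next (d.next p) = d.next (e.next p)) :
    ∃ f g, (latStep Q Q' Q'' d p).Lifts (latStep Q Q' Q'' e p) (𝟙 _) f ∧
      (latStep Q Q' Q'' e (d.next p)).Lifts (latStep Q Q' Q'' d (e.next p)) f g ∧
      StEq g (-eqToHom (congrArg (latObj Q Q' Q'') hde)) := by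
  obtain ⟨i, j, l⟩ := p
  have whisker : ∀ {X Y Z W : C} {a : SyzStep X Y} {b : SyzStep X Z} {c : SyzStep Y W}
      {a' : SyzStep Z W} (Z' : C) [TensorAdmissible Z'],
      (∃ f g, a.Lifts b (𝟙 _) f ∧ c.Lifts a' f g ∧ StEq g (-𝟙 W)) →
      ∃ f g, (a.whiskerRight Z').Lifts (b.whiskerRight Z') (𝟙 _) f ∧
        (c.whiskerRight Z').Lifts (a'.whiskerRight Z') f g ∧ StEq g (-𝟙 (W ⊗ Z')) := by
    rintro X Y Z W a b c a' Z' _ ⟨f, g, h1, h2, h3⟩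
    refine ⟨f ▷ Z', g ▷ Z', ?_, h2.whiskerRight Z', ?_⟩
    · simpa using h1.whiskerRight Z'
    · have h4 := h3.whiskerRight Z'
      rwa [show (-𝟙 W) ▷ Z' = -𝟙 (W ⊗ Z') from
        ((tensorRight Z').map_neg (f := 𝟙 W)).trans (by simp)] at h4
  cases d <;> cases e
  · exact absurd rfl h
  · exact whisker (Q''.syz l) ((Q.step i).exists_lifts_tensor (Q'.step j))
  · exact ((Q.step i).whiskerRight (Q'.syz j)).exists_lifts_tensor (Q''.step l)
  · exact whisker (Q''.syz l) ((Q.step i).exists_lifts_tensor' (Q'.step j))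
  · exact absurd rfl h
  · exact ((Q'.step j).whiskerLeft (Q.syz i)).exists_lifts_tensor (Q''.step l)
  · exact ((Q.step i).whiskerRight (Q'.syz j)).exists_lifts_tensor' (Q''.step l)
  · exact ((Q'.step j).whiskerLeft (Q.syz i)).exists_lifts_tensor' (Q''.step l)
  · exact absurd rfl h

lemma endPt_perm {w w' : List Dir} (h : w.Perm w') (p : ℕ × ℕ × ℕ) : endPt p w = endPt p w' := by
  induction h with
  | nil => rfl
  | cons d _ ih => exact congrArg d.next ih
  | swap d e w => cases d <;> cases e <;> rfl
  | trans _ _ ih ih' => exact ih.trans ih'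

/-- Along two lattice paths that use the same directions in a different order, the identity lifts
to the identity up to the quotient of the signs of the paths, modulo projective objects. -/
lemma latChain_perm (m n : ℤ) (p : ℕ × ℕ × ℕ) {w w' : List Dir} (h : w.Perm w') :
    ∃ g, SyzChain.Lifts (𝟙 _) (latChain Q Q' Q'' p w) (latChain Q Q' Q'' p w') g ∧
      StEq g ((pathSign m n p w * pathSign m n p w') •
        eqToHom (congrArg (latObj Q Q' Q'') (endPt_perm h p))) := by
  induction h with
  | nil => exact ⟨𝟙 _, rfl, by simpa [pathSign] using StEq.refl _⟩
  | @cons d w w' hw ih =>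
    obtain ⟨g, hg, hg'⟩ := ih
    obtain ⟨k, hk⟩ := SyzStep.exists_lifts (latStep Q Q' Q'' d (endPt p w))
      (latStep Q Q' Q'' d (endPt p w')) g
    refine ⟨k, ⟨g, hg, hk⟩, ?_⟩
    have h1 := SyzStep.lifts_eqToHom (latStep Q Q' Q'' d) (endPt_perm hw p)
    have h2 : pathSign m n p (d :: w) * pathSign m n p (d :: w') =
        pathSign m n p w * pathSign m n p w' := by
      rw [pathSign, pathSign, ← endPt_perm hw, mul_mul_mul_comm, Int.units_mul_self, one_mul]
    rw [h2]
    exact hk.stEq (h1.smul _) hg'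
  | swap d e w =>
    by_cases hde : d = e
    · subst hde
      refine ⟨𝟙 _, SyzChain.Lifts.id _, ?_⟩
      rw [Int.units_mul_self, one_smul]
      exact StEq.refl _
    · obtain ⟨f, g, hf, hg, hgs⟩ := latStep_swap Q Q' Q'' hde (endPt p w)
        (endPt_perm (List.Perm.swap d e []) _)
      refine ⟨g, ⟨f, ⟨𝟙 _, SyzChain.Lifts.id _, hf⟩, hg⟩, ?_⟩
      have h2 : pathSign m n p (e :: d :: w) * pathSign m n p (d :: e :: w) = -1 := by
        rw [← Dir.sign_swap m n hde (endPt p w)]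
        simp only [pathSign, endPt]
        have key : ∀ a b c f s : ℤˣ, a * (b * s) * (c * (f * s)) = a * b * (c * f) :=
          fun a b c f s => by
            rw [← mul_assoc a b, ← mul_assoc c, mul_mul_mul_comm, Int.units_mul_self, mul_one]
        exact key _ _ _ _ _
      rw [h2, Units.neg_smul, one_smul]
      exact hgs
  | @trans l₁ l₂ l₃ h h' ih ih' =>
    obtain ⟨g, hg, hg'⟩ := ih
    obtain ⟨k, hk, hk'⟩ := ih'
    refine ⟨g ≫ k, by simpa using hg.comp hk, (hg'.comp hk').trans ?_⟩
    rw [Linear.units_smul_comp, Linear.comp_units_smul, smul_smul, eqToHom_trans]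
    rw [show pathSign m n p l₁ * pathSign m n p l₂ * (pathSign m n p l₂ * pathSign m n p l₃) =
      pathSign m n p l₁ * (pathSign m n p l₂ * pathSign m n p l₂) * pathSign m n p l₃ by
        simp only [mul_assoc], Int.units_mul_self, mul_one]
    exact StEq.refl _

end Lattice

/-! ### Completed Ext groups and chains of steps -/

section ExtHat

variable {C : Type u} [Category.{v} C] [Abelian C]

/-- The chain of the first `t` steps of a resolution. -/
def SyzRes.chain (R : SyzRes C) : ∀ t : ℕ, SyzChain (R.syz 0) (R.syz t)
  | 0 => .nil
  | t + 1 => (R.chain t).snoc (R.step t)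

/-- The chain of `l` steps of a resolution that starts at the `k`-th syzygy. -/
def SyzRes.chainFrom (R : SyzRes C) (k : ℕ) : ∀ l : ℕ, SyzChain (R.syz k) (R.syz (k + l))
  | 0 => .nil
  | l + 1 => (R.chainFrom k l).snoc (R.step (k + l))

lemma SyzRes.length_chain (R : SyzRes C) : ∀ t, (R.chain t).length = t
  | 0 => rfl
  | t + 1 => congrArg (· + 1) (R.length_chain t)

lemma SyzRes.length_chainFrom (R : SyzRes C) (k : ℕ) : ∀ l, (R.chainFrom k l).length = l
  | 0 => rfl
  | l + 1 => congrArg (· + 1) (R.length_chainFrom k l)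

lemma SyzRes.lifts_lift (R S : SyzRes C) (f : R.syz 0 ⟶ S.syz 0) :
    ∀ t, SyzChain.Lifts f (R.chain t) (S.chain t) ((R.lift S f).syz t)
  | 0 => rfl
  | t + 1 => ⟨_, R.lifts_lift S f t, (R.lift S f).proj t, (R.lift S f).comm_ι t,
      (R.lift S f).comm_π t⟩

namespace ExtHat

variable {A A' A'' : C} (P : ProjectiveResolution A) (Q : SyzRes C) (n : ℤ)

lemma of_add (k : ℕ) (x y : ExtGrp P.complex (Q.syz k) (n + k)) :
    of P Q n k (x + y) = of P Q n k x + of P Q n k y :=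
  (DirectLimit.add_def _ _ _).symm

lemma of_sub (k : ℕ) (x y : ExtGrp P.complex (Q.syz k) (n + k)) :
    of P Q n k (x - y) = of P Q n k x - of P Q n k y := by
  rw [sub_eq_add_neg, of_add, of_neg, sub_eq_add_neg]

/-- A class and its image under iterated connecting homomorphisms represent the same element. -/
lemma of_conn_chainFrom (k : ℕ) (x : ExtGrp P.complex (Q.syz k) (n + k)) :
    ∀ (l : ℕ) (h : n + k + (Q.chainFrom k l).length = n + (k + l : ℕ)),
      of P Q n (k + l) ((Q.chainFrom k l).conn P.complex h x) = of P Q n k x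
  | 0, _ => rfl
  | l + 1, h => by
    have h1 : n + k + (Q.chainFrom k l).length = n + (k + l : ℕ) := by
      rw [Q.length_chainFrom]; push_cast; ring
    have h2 : (n + (k + l : ℕ)) + 1 = n + (k + (l + 1) : ℕ) := by push_cast; ring
    refine Eq.trans (congrArg (of P Q n (k + l + 1))
      (SyzChain.conn_snoc P.complex (Q.chainFrom k l) (Q.step (k + l)) h1 h2 h x)) ?_
    exact (of_succ P Q n (k + l) _).trans (of_conn_chainFrom k x l h1)

/-- A class vanishes in the completed Ext group as soon as its image under the iterated connecting
homomorphism of some chain of steps comes from a projective object. -/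
lemma of_post_eq_zero {k : ℕ} {X Y Z : C} (c : SyzChain X Y) (g : X ⟶ Q.syz k)
    (x : ExtGrp P.complex X (n + k)) [Projective Z] {n' : ℤ} (h : n + k + c.length = n')
    (b : Z ⟶ Y) (y : ExtGrp P.complex Z n')
    (hx : c.conn P.complex h x = ExtGrp.post P.complex b n' y) :
    of P Q n k (ExtGrp.post P.complex g _ x) = 0 := by
  obtain ⟨f, hf⟩ := SyzChain.exists_lifts g c (Q.chainFrom k c.length)
    (Q.length_chainFrom k _).symm
  obtain rfl : n + (k + c.length : ℕ) = n' := by rw [← h]; push_cast; ring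
  have h' : n + k + (Q.chainFrom k c.length).length = n + (k + c.length : ℕ) := by
    rw [Q.length_chainFrom]; push_cast; ring
  rw [← of_conn_chainFrom P Q n k _ c.length h', hf.conn_post P.complex h h', hx,
    ExtGrp.post_post, ← of_succ]
  have h1 := (Q.step (k + c.length)).conn_post_projective P.complex (b ≫ f)
    (n' := n + (k + c.length + 1 : ℕ)) (by push_cast; ring) y
  refine (congrArg (of P Q n (k + c.length + 1)) h1).trans ?_
  simpa using of_sub P Q n (k + c.length + 1) 0 0

end ExtHat

end ExtHat

/-! ### Triple products along lattice paths -/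

section Cross

variable {C : Type u} [Category.{v} C] [Abelian C] [MonoidalCategory C] [MonoidalPreadditive C]
variable {K K' K'' : ChainComplex C ℕ} {Q Q' Q'' : SyzRes C} {m n r : ℤ}

/-- The triple product of the members of three families of classes at a lattice point. -/
def crossAt (x : ∀ i : ℕ, ExtGrp K (Q.syz i) (m + i)) (y : ∀ i : ℕ, ExtGrp K' (Q'.syz i) (n + i))
    (z : ∀ i : ℕ, ExtGrp K'' (Q''.syz i) (r + i)) (p : ℕ × ℕ × ℕ) {a : ℤ}
    (h : m + p.1 + (n + p.2.1) + (r + p.2.2) = a) :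
    ExtGrp (tensorCx (tensorCx K K') K'') (latObj Q Q' Q'' p) a :=
  ExtGrp.cross (tensorCx K K') K'' _ _ h (ExtGrp.cross K K' _ _ rfl (x p.1) (y p.2.1)) (z p.2.2)

/-- From the index `k` on, the family `x` represents a fixed element of the completed Ext group. -/
def IsStable [∀ i, Projective (K.X i)] (k : ℕ) (x : ∀ i : ℕ, ExtGrp K (Q.syz i) (m + i)) : Prop :=
  ∀ i, k ≤ i → conn K (Q.exact i) (stage_succ m i) (x i) = x (i + 1)

lemma cross_smul_left {X Y : C} {m n s : ℤ} (h : m + n = s) (e : ℤˣ) (x : ExtGrp K X m)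
    (y : ExtGrp K' Y n) : ExtGrp.cross K K' X Y h (e • x) y = e • ExtGrp.cross K K' X Y h x y :=
  map_units_smul ((ExtGrp.cross K K' X Y h).flip y) e x

lemma crossAt_congr (x : ∀ i : ℕ, ExtGrp K (Q.syz i) (m + i))
    (y : ∀ i : ℕ, ExtGrp K' (Q'.syz i) (n + i)) (z : ∀ i : ℕ, ExtGrp K'' (Q''.syz i) (r + i))
    {p q : ℕ × ℕ × ℕ} (hpq : p = q) {a : ℤ}
    (h : m + p.1 + (n + p.2.1) + (r + p.2.2) = a)
    (h' : m + q.1 + (n + q.2.1) + (r + q.2.2) = a) :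
    ExtGrp.post _ (eqToHom (congrArg (latObj Q Q' Q'') hpq)) a (crossAt x y z p h) =
      crossAt x y z q h' := by
  subst hpq
  exact ExtGrp.post_id _

lemma le_endPt (p : ℕ × ℕ × ℕ) : ∀ w : List Dir,
    p.1 ≤ (endPt p w).1 ∧ p.2.1 ≤ (endPt p w).2.1 ∧ p.2.2 ≤ (endPt p w).2.2
  | [] => ⟨le_rfl, le_rfl, le_rfl⟩
  | d :: w => by
    obtain ⟨h1, h2, h3⟩ := le_endPt p w
    cases d <;> simp only [endPt, Dir.next] <;> omega

lemma sum_endPt (p : ℕ × ℕ × ℕ) : ∀ w : List Dir,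
    (endPt p w).1 + (endPt p w).2.1 + (endPt p w).2.2 = p.1 + p.2.1 + p.2.2 + w.length
  | [] => rfl
  | d :: w => by
    have h := sum_endPt p w
    cases d <;> simp only [endPt, Dir.next, List.length_cons] <;> omega

variable [TensorProjective C] [∀ i, Projective (K.X i)] [∀ i, Projective (K'.X i)]
  [∀ i, Projective (K''.X i)] [Q.Admissible] [Q'.Admissible] [Q''.Admissible]
variable {x : ∀ i : ℕ, ExtGrp K (Q.syz i) (m + i)} {y : ∀ i : ℕ, ExtGrp K' (Q'.syz i) (n + i)}
  {z : ∀ i : ℕ, ExtGrp K'' (Q''.syz i) (r + i)}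

lemma eq_units_smul_of_eq {G : Type*} [AddCommGroup G] {s : ℤˣ} {a b : G} (h : a = s • b) :
    b = s • a := by
  rw [h, smul_smul, Int.units_mul_self, one_smul]

/-- On a triple product of representatives, the connecting homomorphism in the direction `d` is the
passage to the next lattice point, up to the sign of `d`. -/
lemma conn_crossAt {k : ℕ} (hx : IsStable k x) (hy : IsStable k y) (hz : IsStable k z) (d : Dir)
    {p : ℕ × ℕ × ℕ} (h₁ : k ≤ p.1) (h₂ : k ≤ p.2.1) (h₃ : k ≤ p.2.2) {a a' : ℤ}
    (h : m + p.1 + (n + p.2.1) + (r + p.2.2) = a)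
    (h' : m + (d.next p).1 + (n + (d.next p).2.1) + (r + (d.next p).2.2) = a')
    (ha : a + 1 = a') :
    (latStep Q Q' Q'' d p).conn (tensorCx (tensorCx K K') K'') ha (crossAt x y z p h) =
      d.sign m n p • crossAt x y z (d.next p) h' := by
  obtain ⟨i, j, l⟩ := p
  cases d
  · rw [Dir.sign, one_smul, crossAt, crossAt]
    have h1 := conn_cross_left (K := K) (L := K') (Q.exact i)
      (TensorAdmissible.exact_right (X := Q'.syz j) _ (Q.exact i)) (stage_succ m i) rfl rfl
      (by push_cast; ring : m + i + (n + j) + 1 = m + (i + 1 : ℕ) + (n + j)) (x i) (y j)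
    have h2 := conn_cross_left (K := tensorCx K K') (L := K'')
      (TensorAdmissible.exact_right (X := Q'.syz j) _ (Q.exact i))
      (TensorAdmissible.exact_right (X := Q''.syz l) _
        (TensorAdmissible.exact_right (X := Q'.syz j) _ (Q.exact i)))
      (by push_cast; ring : m + i + (n + j) + 1 = m + (i + 1 : ℕ) + (n + j)) h h' ha
      (ExtGrp.cross K K' _ _ rfl (x i) (y j)) (z l)
    rw [← h1, hx i h₁] at h2
    exact h2.symm
  -- The connecting homomorphism of the second factor passes `x` and then leaves the pair `x ∨ y`
  -- as a left factor, where it causes no sign.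
  · have h1 := conn_cross_right (K := K) (L := K') (Q'.exact j)
      (TensorAdmissible.exact_left (X := Q.syz i) _ (Q'.exact j)) (stage_succ n j) rfl rfl
      (by push_cast; ring : m + i + (n + j) + 1 = m + i + (n + (j + 1 : ℕ))) (x i) (y j)
    have h2 := conn_cross_left (K := tensorCx K K') (L := K'')
      (TensorAdmissible.exact_left (X := Q.syz i) _ (Q'.exact j))
      (TensorAdmissible.exact_right (X := Q''.syz l) _
        (TensorAdmissible.exact_left (X := Q.syz i) _ (Q'.exact j)))
      (by push_cast; ring : m + i + (n + j) + 1 = m + i + (n + (j + 1 : ℕ))) h h' ha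
      (ExtGrp.cross K K' _ _ rfl (x i) (y j)) (z l)
    rw [hy j h₂] at h1
    refine h2.symm.trans ?_
    refine (congrArg (fun t => ExtGrp.cross (tensorCx K K') K'' (Q.syz i ⊗ Q'.syz (j + 1))
      (Q''.syz l) h' t (z l)) (eq_units_smul_of_eq h1)).trans ?_
    exact cross_smul_left _ _ _ _
  · have h2 := conn_cross_right (K := tensorCx K K') (L := K'') (Q''.exact l)
      (TensorAdmissible.exact_left (X := Q.syz i ⊗ Q'.syz j) _ (Q''.exact l)) (stage_succ r l)
      h h' ha (ExtGrp.cross K K' _ _ rfl (x i) (y j)) (z l)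
    rw [hz l h₃] at h2
    exact eq_units_smul_of_eq h2

/-- The iterated version of `conn_crossAt` along a lattice path. -/
lemma conn_crossAt_path {k : ℕ} (hx : IsStable k x) (hy : IsStable k y) (hz : IsStable k z)
    {p : ℕ × ℕ × ℕ} (h₁ : k ≤ p.1) (h₂ : k ≤ p.2.1) (h₃ : k ≤ p.2.2) {a : ℤ}
    (h : m + p.1 + (n + p.2.1) + (r + p.2.2) = a) : ∀ (w : List Dir) {a' : ℤ}
    (h' : m + (endPt p w).1 + (n + (endPt p w).2.1) + (r + (endPt p w).2.2) = a')
    (ha : a + (latChain Q Q' Q'' p w).length = a'),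
    (latChain Q Q' Q'' p w).conn (tensorCx (tensorCx K K') K'') ha (crossAt x y z p h) =
      pathSign m n p w • crossAt x y z (endPt p w) h'
  | [], a', h', ha => by
    obtain rfl : a = a' := h.symm.trans h'
    rw [pathSign, one_smul]
    rfl
  | d :: w, a', h', ha => by
    have e₁ := le_endPt p w
    have h1 : m + (endPt p w).1 + (n + (endPt p w).2.1) + (r + (endPt p w).2.2) =
        a + (latChain Q Q' Q'' p w).length := by
      rw [← h, length_latChain]
      have := sum_endPt p w
      omega
    have h2 : a + (latChain Q Q' Q'' p w).length + 1 = a' := by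
      rw [← ha, length_latChain, length_latChain, List.length_cons]; push_cast; ring
    refine (SyzChain.conn_snoc _ (latChain Q Q' Q'' p w) (latStep Q Q' Q'' d (endPt p w)) rfl h2
      ha _).trans ?_
    rw [conn_crossAt_path hx hy hz h₁ h₂ h₃ h w h1 rfl, map_units_smul,
      conn_crossAt hx hy hz d (h₁.trans e₁.1) (h₂.trans e₁.2.1) (h₃.trans e₁.2.2) h1 h' h2,
      smul_smul, mul_comm, pathSign]
    rfl

end Cross

/-! ### Comparison of resolutions along lattice paths -/

section Compare

variable {C : Type u} [Category.{v} C] [Abelian C] [MonoidalCategory C] [MonoidalPreadditive C]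

lemma endPt_append (p : ℕ × ℕ × ℕ) (w : List Dir) :
    ∀ v : List Dir, endPt p (v ++ w) = endPt (endPt p w) v
  | [] => rfl
  | d :: v => congrArg d.next (endPt_append p w v)

lemma pathSign_append (m n : ℤ) (p : ℕ × ℕ × ℕ) (w : List Dir) :
    ∀ v : List Dir, pathSign m n p (v ++ w) = pathSign m n (endPt p w) v * pathSign m n p w
  | [] => (one_mul _).symm
  | d :: v => by
    rw [List.cons_append, pathSign, pathSign, pathSign_append m n p w v, endPt_append, mul_assoc]

variable (Q Q' Q'' : SyzRes C) [Q.Admissible] [Q'.Admissible] [Q''.Admissible]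

/-- Restarting a lattice path at an intermediate point. The end points agree only propositionally,
whence the `eqToHom`. -/
lemma latChain_append (p : ℕ × ℕ × ℕ) (w : List Dir) : ∀ v : List Dir,
    SyzChain.Lifts (𝟙 _) (latChain Q Q' Q'' p (v ++ w))
      ((latChain Q Q' Q'' p w).append (latChain Q Q' Q'' (endPt p w) v))
      (eqToHom (congrArg (latObj Q Q' Q'') (endPt_append p w v)))
  | [] => SyzChain.Lifts.id _
  | d :: v => ⟨_, latChain_append p w v,
      SyzStep.lifts_eqToHom (latStep Q Q' Q'' d) (endPt_append p w v)⟩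

/-- The inverse of the ladder in `latChain_append`. -/
lemma append_latChain (p : ℕ × ℕ × ℕ) (w : List Dir) : ∀ v : List Dir,
    SyzChain.Lifts (𝟙 _) ((latChain Q Q' Q'' p w).append (latChain Q Q' Q'' (endPt p w) v))
      (latChain Q Q' Q'' p (v ++ w))
      (eqToHom (congrArg (latObj Q Q' Q'') (endPt_append p w v).symm))
  | [] => SyzChain.Lifts.id _
  | d :: v => ⟨_, append_latChain p w v,
      SyzStep.lifts_eqToHom (latStep Q Q' Q'' d) (endPt_append p w v).symm⟩

variable {Q Q' Q''} [TensorProjective C]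
variable {A A' A'' : C} {P : ProjectiveResolution A} {P' : ProjectiveResolution A'}
  {P'' : ProjectiveResolution A''} [IsTensorResolution P P']
  [IsTensorResolution (tensorRes P P') P''] {m n r : ℤ}
  {x : ∀ i : ℕ, ExtGrp P.complex (Q.syz i) (m + i)}
  {y : ∀ i : ℕ, ExtGrp P'.complex (Q'.syz i) (n + i)}
  {z : ∀ i : ℕ, ExtGrp P''.complex (Q''.syz i) (r + i)}

/-- Let the resolutions `R` and `S` follow lattice paths `w` and `w'` up to stage `t`. Then a
comparison map `R ⟶ S` over the identity takes the triple product at the end point of `w` to the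
triple product at the end point of `w'`, up to the quotient of the signs of the paths. The paths
need not have the same end point; it suffices that they have extensions by paths `v` and `v'`
which do. -/
theorem of_lift_crossAt {R S : SyzRes C} {f : R.syz 0 ⟶ S.syz 0} {p : ℕ × ℕ × ℕ}
    {i : latObj Q Q' Q'' p ⟶ R.syz 0} {j : S.syz 0 ⟶ latObj Q Q' Q'' p} (hij : i ≫ f ≫ j = 𝟙 _)
    {t : ℕ} {w w' v v' : List Dir} (hperm : (v ++ w).Perm (v' ++ w'))
    {e : latObj Q Q' Q'' (endPt p w) ⟶ R.syz t}
    (he : SyzChain.Lifts i (latChain Q Q' Q'' p w) (R.chain t) e)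
    {e' : S.syz t ⟶ latObj Q Q' Q'' (endPt p w')} {e'' : latObj Q Q' Q'' (endPt p w') ⟶ S.syz t}
    (hee : e' ≫ e'' = 𝟙 _) (he' : SyzChain.Lifts j (S.chain t) (latChain Q Q' Q'' p w') e')
    {k : ℕ} (hx : IsStable k x) (hy : IsStable k y) (hz : IsStable k z)
    (hw₁ : k ≤ (endPt p w).1) (hw₂ : k ≤ (endPt p w).2.1) (hw₃ : k ≤ (endPt p w).2.2)
    (hw₁' : k ≤ (endPt p w').1) (hw₂' : k ≤ (endPt p w').2.1) (hw₃' : k ≤ (endPt p w').2.2)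
    {s : ℤ} (h : m + (endPt p w).1 + (n + (endPt p w).2.1) + (r + (endPt p w).2.2) = s + t)
    (h' : m + (endPt p w').1 + (n + (endPt p w').2.1) + (r + (endPt p w').2.2) = s + t) :
    ExtHat.of (tensorRes (tensorRes P P') P'') S s t
      (ExtGrp.post _ ((R.lift S f).syz t) _ (ExtGrp.post _ e _ (crossAt x y z (endPt p w) h))) =
    (pathSign m n p w * pathSign m n p w') • ExtHat.of (tensorRes (tensorRes P P') P'') S s t
      (ExtGrp.post _ e'' _ (crossAt x y z (endPt p w') h')) := by
  set K := tensorCx (tensorCx P.complex P'.complex) P''.complex with hK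
  have hwl : w.length = t := by
    rw [← length_latChain Q Q' Q'' p w, he.length_eq, R.length_chain]
  have hwl' : w'.length = t := by
    rw [← length_latChain Q Q' Q'' p w', ← he'.length_eq, S.length_chain]
  have hvl : v.length = v'.length := by
    have := hperm.length_eq
    simp only [List.length_append] at this
    omega
  -- the comparison map, transported to the lattice
  set φ := e ≫ (R.lift S f).syz t ≫ e' with hφ
  have hφ' : SyzChain.Lifts (𝟙 _) (latChain Q Q' Q'' p w) (latChain Q Q' Q'' p w') φ := by
    rw [← hij]
    exact he.comp ((R.lifts_lift S f t).comp he')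
  obtain ⟨g, hg⟩ := SyzChain.exists_lifts φ (latChain Q Q' Q'' (endPt p w) v)
    (latChain Q Q' Q'' (endPt p w') v') (by rw [length_latChain, length_latChain, hvl])
  -- On the common end point of the extended paths, `g` is the identity up to sign and projective
  -- objects, since there it is a lift of the identity of the starting point.
  have hend : endPt (endPt p w) v = endPt (endPt p w') v' := by
    rw [← endPt_append, ← endPt_append, endPt_perm hperm]
  have hg' : StEq g ((pathSign m n p (v ++ w) * pathSign m n p (v' ++ w')) •
      eqToHom (congrArg (latObj Q Q' Q'') hend)) := by
    obtain ⟨g₁, hg₁, hg₁'⟩ := latChain_perm Q Q' Q'' m n p hperm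
    have h1 := ((append_latChain Q Q' Q'' p w v).comp hg₁).comp (latChain_append Q Q' Q'' p w' v')
    have h2 := SyzChain.Lifts.stEq (by simpa using StEq.refl _) (hφ'.append hg) h1
    refine h2.trans ((((StEq.refl _).comp hg₁').comp (StEq.refl _)).trans ?_)
    rw [Linear.comp_units_smul, Linear.units_smul_comp, eqToHom_trans, eqToHom_trans]
    exact StEq.refl _
  have hl : s + t + (latChain Q Q' Q'' (endPt p w) v).length = s + t + v.length := by
    rw [length_latChain]
  have hl' : s + t + (latChain Q Q' Q'' (endPt p w') v').length = s + t + v.length := by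
    rw [length_latChain, hvl]
  have hs : m + (endPt (endPt p w) v).1 + (n + (endPt (endPt p w) v).2.1) +
      (r + (endPt (endPt p w) v).2.2) = s + t + v.length := by
    have := sum_endPt (endPt p w) v
    omega
  have hs' : m + (endPt (endPt p w') v').1 + (n + (endPt (endPt p w') v').2.1) +
      (r + (endPt (endPt p w') v').2.2) = s + t + v.length := by
    rw [← hs, hend]
  obtain ⟨Z, hZ, b, c, hb⟩ := hg'.post (K := K)
    ((latChain Q Q' Q'' (endPt p w) v).conn K hl (crossAt x y z (endPt p w) h))
  -- So the difference of the two sides comes from a projective object after finitely many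
  -- connecting homomorphisms, hence vanishes in the limit.
  have key : (latChain Q Q' Q'' (endPt p w') v').conn K hl'
      (ExtGrp.post K φ _ (crossAt x y z (endPt p w) h) -
        (pathSign m n p w * pathSign m n p w') • crossAt x y z (endPt p w') h') =
      ExtGrp.post K b _ c := by
    rw [map_sub, hg.conn_post K hl hl', hb, map_units_smul,
      conn_crossAt_path hx hy hz hw₁ hw₂ hw₃ h v hs hl,
      conn_crossAt_path hx hy hz hw₁' hw₂' hw₃' h' v' hs' hl',
      ExtGrp.post_smul_hom, map_units_smul, crossAt_congr x y z hend hs hs', smul_smul, smul_smul,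
      pathSign_append, pathSign_append]
    have hsign : ∀ a b c d : ℤˣ, a * b * (c * d) * a = b * d * c := fun a b c d => by
      rw [mul_comm, ← mul_assoc a, ← mul_assoc a a, Int.units_mul_self, one_mul, mul_comm c,
        mul_assoc]
    rw [hsign, add_sub_cancel_left]
  have h0 := ExtHat.of_post_eq_zero (tensorRes (tensorRes P P') P'') S s (k := t)
    (latChain Q Q' Q'' (endPt p w') v') e'' _ hl' b c key
  rw [map_sub, ExtHat.of_sub, sub_eq_zero, map_units_smul, ExtHat.of_smul] at h0
  rw [← h0, ExtGrp.post_post, ExtGrp.post_post]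
  congr 2
  rw [hφ, Category.assoc, Category.assoc, hee, Category.comp_id]

end Compare

/-! ### The lattice paths of iterated tensor products of resolutions -/

section Paths

variable {C : Type u} [Category.{v} C] [Abelian C]

/-- Equality of chains whose end points are only propositionally equal is expressed in the sigma
type of chains with a given starting point. -/
lemma SyzChain.lifts_eqToHom {X Y Y' : C} {c : SyzChain X Y} {c' : SyzChain X Y'}
    (h : (⟨Y, c⟩ : Σ Z, SyzChain X Z) = ⟨Y', c'⟩) :
    SyzChain.Lifts (𝟙 X) c c' (eqToHom (congrArg Sigma.fst h)) := by
  cases h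
  exact SyzChain.Lifts.id c

variable [MonoidalCategory C] [MonoidalPreadditive C]

variable (Q Q' Q'' : SyzRes C) [Q.Admissible] [Q'.Admissible] [Q''.Admissible]

/-- The step of `Q.tensor Q'` at a position. -/
def SyzRes.posStep (s : Pos) : SyzStep (SyzRes.posSyz Q Q' s) (SyzRes.posSyz Q Q' s.next) where
  mid := SyzRes.posProj Q Q' s
  projective := SyzRes.pos_projective Q Q' s
  ι := SyzRes.posι Q Q' s
  π := SyzRes.posπ Q Q' s
  w := SyzRes.pos_w Q Q' s
  exact := SyzRes.pos_exact Q Q' s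

/-- The step in a given direction for the bracketing `Q.syz i ⊗ (Q'.syz j ⊗ Q''.syz l)`. -/
def latStep' : ∀ (d : Dir) (p : ℕ × ℕ × ℕ),
    SyzStep (Q.syz p.1 ⊗ (Q'.syz p.2.1 ⊗ Q''.syz p.2.2))
      (Q.syz (d.next p).1 ⊗ (Q'.syz (d.next p).2.1 ⊗ Q''.syz (d.next p).2.2))
  | .fst, p => (Q.step p.1).whiskerRight (Q'.syz p.2.1 ⊗ Q''.syz p.2.2)
  | .snd, p => ((Q'.step p.2.1).whiskerRight (Q''.syz p.2.2)).whiskerLeft (Q.syz p.1)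
  | .trd, p => ((Q''.step p.2.2).whiskerLeft (Q'.syz p.2.1)).whiskerLeft (Q.syz p.1)

/-- The chain of steps along a lattice path for the bracketing
`Q.syz i ⊗ (Q'.syz j ⊗ Q''.syz l)`. -/
def latChain' (p : ℕ × ℕ × ℕ) : ∀ w : List Dir,
    SyzChain (Q.syz p.1 ⊗ (Q'.syz p.2.1 ⊗ Q''.syz p.2.2))
      (Q.syz (endPt p w).1 ⊗ (Q'.syz (endPt p w).2.1 ⊗ Q''.syz (endPt p w).2.2))
  | [] => .nil
  | d :: w => (latChain' p w).snoc (latStep' Q Q' Q'' d (endPt p w))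

lemma latStep'_lifts (d : Dir) (p : ℕ × ℕ × ℕ) :
    (latStep' Q Q' Q'' d p).Lifts (latStep Q Q' Q'' d p) (α_ _ _ _).inv (α_ _ _ _).inv := by
  cases d
  · exact ⟨(α_ _ _ _).inv, (associator_inv_naturality_left _ _ _).symm,
      (associator_inv_naturality_left _ _ _).symm⟩
  · exact ⟨(α_ _ _ _).inv, (associator_inv_naturality_middle _ _ _).symm,
      (associator_inv_naturality_middle _ _ _).symm⟩
  · exact ⟨(α_ _ _ _).inv, (associator_inv_naturality_right _ _ _).symm,
      (associator_inv_naturality_right _ _ _).symm⟩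

/-- The associator is a ladder between the chains of the two bracketings. -/
lemma latChain'_lifts (p : ℕ × ℕ × ℕ) : ∀ w : List Dir,
    SyzChain.Lifts (α_ _ _ _).inv (latChain' Q Q' Q'' p w) (latChain Q Q' Q'' p w)
      (α_ _ _ _).inv
  | [] => rfl
  | d :: w => ⟨_, latChain'_lifts p w, latStep'_lifts Q Q' Q'' d _⟩

variable {Q Q' Q''}

/-- Suppose that the first `t` steps of `(Q.tensor Q').tensor Q''` form the chain `c` that ends at
the lattice point `p`, and that the alternation makes the next step act on the first factor. Then
the first `t + 1` steps form `c` followed by the step in that direction. As the position `alt t` is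
computed by recursion on `t`, its value is known only propositionally; the proof generalizes the
positions in the outer and in the inner tensor product before it substitutes their values. -/
lemma tensor_chain_fst {t i : ℕ} {p : ℕ × ℕ × ℕ} (ht : alt t = (i, p.2.2, false))
    (hi : alt i = (p.1, p.2.1, false))
    {c : SyzChain (latObj Q Q' Q'' (0, 0, 0)) (latObj Q Q' Q'' p)}
    (h : (⟨_, ((Q.tensor Q').tensor Q'').chain t⟩ :
      Σ Z, SyzChain (latObj Q Q' Q'' (0, 0, 0)) Z) = ⟨_, c⟩) :
    (⟨_, ((Q.tensor Q').tensor Q'').chain (t + 1)⟩ :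
      Σ Z, SyzChain (latObj Q Q' Q'' (0, 0, 0)) Z) =
        ⟨_, c.snoc (latStep Q Q' Q'' .fst p)⟩ := by
  obtain ⟨a, b, l⟩ := p
  have inner : ∀ (s : Pos) (_ : s = (a, b, false))
      (c' : SyzChain (latObj Q Q' Q'' (0, 0, 0)) (SyzRes.posSyz Q Q' s ⊗ Q''.syz l))
      (_ : (⟨_, c'⟩ : Σ Z, SyzChain (latObj Q Q' Q'' (0, 0, 0)) Z) = ⟨_, c⟩),
      (⟨_, c'.snoc ((SyzRes.posStep Q Q' s).whiskerRight (Q''.syz l))⟩ :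
        Σ Z, SyzChain (latObj Q Q' Q'' (0, 0, 0)) Z) =
          ⟨_, c.snoc (latStep Q Q' Q'' .fst (a, b, l))⟩ := by
    rintro s rfl c' hc
    obtain rfl := eq_of_heq (Sigma.mk.inj hc).2
    rfl
  have outer : ∀ (s : Pos) (_ : s = (i, l, false))
      (c' : SyzChain (latObj Q Q' Q'' (0, 0, 0)) (SyzRes.posSyz (Q.tensor Q') Q'' s))
      (_ : (⟨_, c'⟩ : Σ Z, SyzChain (latObj Q Q' Q'' (0, 0, 0)) Z) = ⟨_, c⟩),
      (⟨_, c'.snoc (SyzRes.posStep (Q.tensor Q') Q'' s)⟩ :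
        Σ Z, SyzChain (latObj Q Q' Q'' (0, 0, 0)) Z) =
          ⟨_, c.snoc (latStep Q Q' Q'' .fst (a, b, l))⟩ := by
    rintro s rfl c' hc
    exact inner (alt i) hi c' hc
  exact outer (alt t) ht _ h

/-- The analogue of `tensor_chain_fst` for a step in the second factor. -/
lemma tensor_chain_snd {t i : ℕ} {p : ℕ × ℕ × ℕ} (ht : alt t = (i, p.2.2, false))
    (hi : alt i = (p.1, p.2.1, true))
    {c : SyzChain (latObj Q Q' Q'' (0, 0, 0)) (latObj Q Q' Q'' p)}
    (h : (⟨_, ((Q.tensor Q').tensor Q'').chain t⟩ :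
      Σ Z, SyzChain (latObj Q Q' Q'' (0, 0, 0)) Z) = ⟨_, c⟩) :
    (⟨_, ((Q.tensor Q').tensor Q'').chain (t + 1)⟩ :
      Σ Z, SyzChain (latObj Q Q' Q'' (0, 0, 0)) Z) =
        ⟨_, c.snoc (latStep Q Q' Q'' .snd p)⟩ := by
  obtain ⟨a, b, l⟩ := p
  have inner : ∀ (s : Pos) (_ : s = (a, b, true))
      (c' : SyzChain (latObj Q Q' Q'' (0, 0, 0)) (SyzRes.posSyz Q Q' s ⊗ Q''.syz l))
      (_ : (⟨_, c'⟩ : Σ Z, SyzChain (latObj Q Q' Q'' (0, 0, 0)) Z) = ⟨_, c⟩),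
      (⟨_, c'.snoc ((SyzRes.posStep Q Q' s).whiskerRight (Q''.syz l))⟩ :
        Σ Z, SyzChain (latObj Q Q' Q'' (0, 0, 0)) Z) =
          ⟨_, c.snoc (latStep Q Q' Q'' .snd (a, b, l))⟩ := by
    rintro s rfl c' hc
    obtain rfl := eq_of_heq (Sigma.mk.inj hc).2
    rfl
  have outer : ∀ (s : Pos) (_ : s = (i, l, false))
      (c' : SyzChain (latObj Q Q' Q'' (0, 0, 0)) (SyzRes.posSyz (Q.tensor Q') Q'' s))
      (_ : (⟨_, c'⟩ : Σ Z, SyzChain (latObj Q Q' Q'' (0, 0, 0)) Z) = ⟨_, c⟩),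
      (⟨_, c'.snoc (SyzRes.posStep (Q.tensor Q') Q'' s)⟩ :
        Σ Z, SyzChain (latObj Q Q' Q'' (0, 0, 0)) Z) =
          ⟨_, c.snoc (latStep Q Q' Q'' .snd (a, b, l))⟩ := by
    rintro s rfl c' hc
    exact inner (alt i) hi c' hc
  exact outer (alt t) ht _ h

/-- The analogue of `tensor_chain_fst` for a step in the third factor. Here the inner resolution does
not move, so that its flag `β` is arbitrary. -/
lemma tensor_chain_trd {t i : ℕ} {p : ℕ × ℕ × ℕ} (β : Bool) (ht : alt t = (i, p.2.2, true))
    (hi : alt i = (p.1, p.2.1, β))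
    {c : SyzChain (latObj Q Q' Q'' (0, 0, 0)) (latObj Q Q' Q'' p)}
    (h : (⟨_, ((Q.tensor Q').tensor Q'').chain t⟩ :
      Σ Z, SyzChain (latObj Q Q' Q'' (0, 0, 0)) Z) = ⟨_, c⟩) :
    (⟨_, ((Q.tensor Q').tensor Q'').chain (t + 1)⟩ :
      Σ Z, SyzChain (latObj Q Q' Q'' (0, 0, 0)) Z) =
        ⟨_, c.snoc (latStep Q Q' Q'' .trd p)⟩ := by
  obtain ⟨a, b, l⟩ := p
  have inner : ∀ (s : Pos) (_ : s = (a, b, β))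
      (c' : SyzChain (latObj Q Q' Q'' (0, 0, 0)) (SyzRes.posSyz Q Q' s ⊗ Q''.syz l))
      (_ : (⟨_, c'⟩ : Σ Z, SyzChain (latObj Q Q' Q'' (0, 0, 0)) Z) = ⟨_, c⟩),
      (⟨_, c'.snoc ((Q''.step l).whiskerLeft (SyzRes.posSyz Q Q' s))⟩ :
        Σ Z, SyzChain (latObj Q Q' Q'' (0, 0, 0)) Z) =
          ⟨_, c.snoc (latStep Q Q' Q'' .trd (a, b, l))⟩ := by
    rintro s rfl c' hc
    obtain rfl := eq_of_heq (Sigma.mk.inj hc).2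
    rfl
  have outer : ∀ (s : Pos) (_ : s = (i, l, true))
      (c' : SyzChain (latObj Q Q' Q'' (0, 0, 0)) (SyzRes.posSyz (Q.tensor Q') Q'' s))
      (_ : (⟨_, c'⟩ : Σ Z, SyzChain (latObj Q Q' Q'' (0, 0, 0)) Z) = ⟨_, c⟩),
      (⟨_, c'.snoc (SyzRes.posStep (Q.tensor Q') Q'' s)⟩ :
        Σ Z, SyzChain (latObj Q Q' Q'' (0, 0, 0)) Z) =
          ⟨_, c.snoc (latStep Q Q' Q'' .trd (a, b, l))⟩ := by
    rintro s rfl c' hc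
    exact inner (alt i) hi c' hc
  exact outer (alt t) ht _ h

/-- The analogue of `tensor_chain_fst` for the resolution `Q.tensor (Q'.tensor Q'')`. Here the inner
resolution does not move, so that its flag `β` is arbitrary. -/
lemma tensor_chain_fst' {t i : ℕ} {p : ℕ × ℕ × ℕ} (β : Bool) (ht : alt t = (p.1, i, false))
    (hi : alt i = (p.2.1, p.2.2, β))
    {c : SyzChain (Q.syz 0 ⊗ (Q'.syz 0 ⊗ Q''.syz 0))
      (Q.syz p.1 ⊗ (Q'.syz p.2.1 ⊗ Q''.syz p.2.2))}
    (h : (⟨_, (Q.tensor (Q'.tensor Q'')).chain t⟩ :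
      Σ Z, SyzChain (Q.syz 0 ⊗ (Q'.syz 0 ⊗ Q''.syz 0)) Z) = ⟨_, c⟩) :
    (⟨_, (Q.tensor (Q'.tensor Q'')).chain (t + 1)⟩ :
      Σ Z, SyzChain (Q.syz 0 ⊗ (Q'.syz 0 ⊗ Q''.syz 0)) Z) =
        ⟨_, c.snoc (latStep' Q Q' Q'' .fst p)⟩ := by
  obtain ⟨a, b, l⟩ := p
  have inner : ∀ (s : Pos) (_ : s = (b, l, β))
      (c' : SyzChain (Q.syz 0 ⊗ (Q'.syz 0 ⊗ Q''.syz 0)) (Q.syz a ⊗ SyzRes.posSyz Q' Q'' s))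
      (_ : (⟨_, c'⟩ : Σ Z, SyzChain (Q.syz 0 ⊗ (Q'.syz 0 ⊗ Q''.syz 0)) Z) = ⟨_, c⟩),
      (⟨_, c'.snoc ((Q.step a).whiskerRight (SyzRes.posSyz Q' Q'' s))⟩ :
        Σ Z, SyzChain (Q.syz 0 ⊗ (Q'.syz 0 ⊗ Q''.syz 0)) Z) =
          ⟨_, c.snoc (latStep' Q Q' Q'' .fst (a, b, l))⟩ := by
    rintro s rfl c' hc
    obtain rfl := eq_of_heq (Sigma.mk.inj hc).2
    rfl
  have outer : ∀ (s : Pos) (_ : s = (a, i, false))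
      (c' : SyzChain (Q.syz 0 ⊗ (Q'.syz 0 ⊗ Q''.syz 0)) (SyzRes.posSyz Q (Q'.tensor Q'') s))
      (_ : (⟨_, c'⟩ : Σ Z, SyzChain (Q.syz 0 ⊗ (Q'.syz 0 ⊗ Q''.syz 0)) Z) = ⟨_, c⟩),
      (⟨_, c'.snoc (SyzRes.posStep Q (Q'.tensor Q'') s)⟩ :
        Σ Z, SyzChain (Q.syz 0 ⊗ (Q'.syz 0 ⊗ Q''.syz 0)) Z) =
          ⟨_, c.snoc (latStep' Q Q' Q'' .fst (a, b, l))⟩ := by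
    rintro s rfl c' hc
    exact inner (alt i) hi c' hc
  exact outer (alt t) ht _ h

/-- The analogue of `tensor_chain_snd` for the resolution `Q.tensor (Q'.tensor Q'')`. -/
lemma tensor_chain_snd' {t i : ℕ} {p : ℕ × ℕ × ℕ} (ht : alt t = (p.1, i, true))
    (hi : alt i = (p.2.1, p.2.2, false))
    {c : SyzChain (Q.syz 0 ⊗ (Q'.syz 0 ⊗ Q''.syz 0))
      (Q.syz p.1 ⊗ (Q'.syz p.2.1 ⊗ Q''.syz p.2.2))}
    (h : (⟨_, (Q.tensor (Q'.tensor Q'')).chain t⟩ :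
      Σ Z, SyzChain (Q.syz 0 ⊗ (Q'.syz 0 ⊗ Q''.syz 0)) Z) = ⟨_, c⟩) :
    (⟨_, (Q.tensor (Q'.tensor Q'')).chain (t + 1)⟩ :
      Σ Z, SyzChain (Q.syz 0 ⊗ (Q'.syz 0 ⊗ Q''.syz 0)) Z) =
        ⟨_, c.snoc (latStep' Q Q' Q'' .snd p)⟩ := by
  obtain ⟨a, b, l⟩ := p
  have inner : ∀ (s : Pos) (_ : s = (b, l, false))
      (c' : SyzChain (Q.syz 0 ⊗ (Q'.syz 0 ⊗ Q''.syz 0)) (Q.syz a ⊗ SyzRes.posSyz Q' Q'' s))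
      (_ : (⟨_, c'⟩ : Σ Z, SyzChain (Q.syz 0 ⊗ (Q'.syz 0 ⊗ Q''.syz 0)) Z) = ⟨_, c⟩),
      (⟨_, c'.snoc ((SyzRes.posStep Q' Q'' s).whiskerLeft (Q.syz a))⟩ :
        Σ Z, SyzChain (Q.syz 0 ⊗ (Q'.syz 0 ⊗ Q''.syz 0)) Z) =
          ⟨_, c.snoc (latStep' Q Q' Q'' .snd (a, b, l))⟩ := by
    rintro s rfl c' hc
    obtain rfl := eq_of_heq (Sigma.mk.inj hc).2
    rfl
  have outer : ∀ (s : Pos) (_ : s = (a, i, true))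
      (c' : SyzChain (Q.syz 0 ⊗ (Q'.syz 0 ⊗ Q''.syz 0)) (SyzRes.posSyz Q (Q'.tensor Q'') s))
      (_ : (⟨_, c'⟩ : Σ Z, SyzChain (Q.syz 0 ⊗ (Q'.syz 0 ⊗ Q''.syz 0)) Z) = ⟨_, c⟩),
      (⟨_, c'.snoc (SyzRes.posStep Q (Q'.tensor Q'') s)⟩ :
        Σ Z, SyzChain (Q.syz 0 ⊗ (Q'.syz 0 ⊗ Q''.syz 0)) Z) =
          ⟨_, c.snoc (latStep' Q Q' Q'' .snd (a, b, l))⟩ := by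
    rintro s rfl c' hc
    exact inner (alt i) hi c' hc
  exact outer (alt t) ht _ h

/-- The analogue of `tensor_chain_trd` for the resolution `Q.tensor (Q'.tensor Q'')`. -/
lemma tensor_chain_trd' {t i : ℕ} {p : ℕ × ℕ × ℕ} (ht : alt t = (p.1, i, true))
    (hi : alt i = (p.2.1, p.2.2, true))
    {c : SyzChain (Q.syz 0 ⊗ (Q'.syz 0 ⊗ Q''.syz 0))
      (Q.syz p.1 ⊗ (Q'.syz p.2.1 ⊗ Q''.syz p.2.2))}
    (h : (⟨_, (Q.tensor (Q'.tensor Q'')).chain t⟩ :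
      Σ Z, SyzChain (Q.syz 0 ⊗ (Q'.syz 0 ⊗ Q''.syz 0)) Z) = ⟨_, c⟩) :
    (⟨_, (Q.tensor (Q'.tensor Q'')).chain (t + 1)⟩ :
      Σ Z, SyzChain (Q.syz 0 ⊗ (Q'.syz 0 ⊗ Q''.syz 0)) Z) =
        ⟨_, c.snoc (latStep' Q Q' Q'' .trd p)⟩ := by
  obtain ⟨a, b, l⟩ := p
  have inner : ∀ (s : Pos) (_ : s = (b, l, true))
      (c' : SyzChain (Q.syz 0 ⊗ (Q'.syz 0 ⊗ Q''.syz 0)) (Q.syz a ⊗ SyzRes.posSyz Q' Q'' s))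
      (_ : (⟨_, c'⟩ : Σ Z, SyzChain (Q.syz 0 ⊗ (Q'.syz 0 ⊗ Q''.syz 0)) Z) = ⟨_, c⟩),
      (⟨_, c'.snoc ((SyzRes.posStep Q' Q'' s).whiskerLeft (Q.syz a))⟩ :
        Σ Z, SyzChain (Q.syz 0 ⊗ (Q'.syz 0 ⊗ Q''.syz 0)) Z) =
          ⟨_, c.snoc (latStep' Q Q' Q'' .trd (a, b, l))⟩ := by
    rintro s rfl c' hc
    obtain rfl := eq_of_heq (Sigma.mk.inj hc).2
    rfl
  have outer : ∀ (s : Pos) (_ : s = (a, i, true))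
      (c' : SyzChain (Q.syz 0 ⊗ (Q'.syz 0 ⊗ Q''.syz 0)) (SyzRes.posSyz Q (Q'.tensor Q'') s))
      (_ : (⟨_, c'⟩ : Σ Z, SyzChain (Q.syz 0 ⊗ (Q'.syz 0 ⊗ Q''.syz 0)) Z) = ⟨_, c⟩),
      (⟨_, c'.snoc (SyzRes.posStep Q (Q'.tensor Q'') s)⟩ :
        Σ Z, SyzChain (Q.syz 0 ⊗ (Q'.syz 0 ⊗ Q''.syz 0)) Z) =
          ⟨_, c.snoc (latStep' Q Q' Q'' .trd (a, b, l))⟩ := by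
    rintro s rfl c' hc
    exact inner (alt i) hi c' hc
  exact outer (alt t) ht _ h

/-- The first `4 * k` directions of the lattice path of `(Q.tensor Q').tensor Q''`: the steps
alternate between `Q.tensor Q'` and `Q''`, and those of `Q.tensor Q'` between `Q` and `Q'`. As in
`endPt`, the list is read from right to left. -/
def leftPath : ℕ → List Dir
  | 0 => []
  | k + 1 => .trd :: .snd :: .trd :: .fst :: leftPath k

/-- The first `4 * k` directions of the lattice path of `Q.tensor (Q'.tensor Q'')`. -/
def rightPath : ℕ → List Dir
  | 0 => []
  | k + 1 => .trd :: .fst :: .snd :: .fst :: rightPath k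

lemma endPt_leftPath : ∀ k : ℕ, endPt (0, 0, 0) (leftPath k) = (k, k, 2 * k)
  | 0 => rfl
  | k + 1 => by
    simp only [leftPath, endPt, endPt_leftPath k, Dir.next]
    rfl

lemma endPt_rightPath : ∀ k : ℕ, endPt (0, 0, 0) (rightPath k) = (2 * k, k, k)
  | 0 => rfl
  | k + 1 => by
    simp only [rightPath, endPt, endPt_rightPath k, Dir.next]
    rfl

lemma tensor_chain_leftPath : ∀ k : ℕ,
    (⟨_, ((Q.tensor Q').tensor Q'').chain (2 * (2 * k))⟩ :
      Σ Z, SyzChain (latObj Q Q' Q'' (0, 0, 0)) Z) =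
        ⟨_, latChain Q Q' Q'' (0, 0, 0) (leftPath k)⟩
  | 0 => rfl
  | k + 1 => by
    have hp := endPt_leftPath k
    have h0 : alt (2 * (2 * k)) = (2 * k, 2 * k, false) := alt_two_mul (2 * k)
    have h1 : alt (2 * (2 * k) + 1) = (2 * k + 1, 2 * k, true) := congrArg Pos.next h0
    have h2 : alt (2 * (2 * k) + 2) = (2 * k + 1, 2 * k + 1, false) := congrArg Pos.next h1
    have h3 : alt (2 * (2 * k) + 3) = (2 * k + 2, 2 * k + 1, true) := congrArg Pos.next h2
    have i0 : alt (2 * k) = (k, k, false) := alt_two_mul k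
    have i1 : alt (2 * k + 1) = (k + 1, k, true) := congrArg Pos.next i0
    have i2 : alt (2 * k + 2) = (k + 1, k + 1, false) := congrArg Pos.next i1
    refine tensor_chain_trd (i := 2 * k + 2) false (h3.trans ?_) (i2.trans ?_)
      (tensor_chain_snd (i := 2 * k + 1) (h2.trans ?_) (i1.trans ?_)
        (tensor_chain_trd (i := 2 * k + 1) true (h1.trans ?_) (i1.trans ?_)
          (tensor_chain_fst (i := 2 * k) (h0.trans ?_) (i0.trans ?_) (tensor_chain_leftPath k)))) <;>
    simp [endPt, Dir.next, hp]

lemma tensor_chain_rightPath : ∀ k : ℕ,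
    (⟨_, (Q.tensor (Q'.tensor Q'')).chain (2 * (2 * k))⟩ :
      Σ Z, SyzChain (Q.syz 0 ⊗ (Q'.syz 0 ⊗ Q''.syz 0)) Z) =
        ⟨_, latChain' Q Q' Q'' (0, 0, 0) (rightPath k)⟩
  | 0 => rfl
  | k + 1 => by
    have hp := endPt_rightPath k
    have h0 : alt (2 * (2 * k)) = (2 * k, 2 * k, false) := alt_two_mul (2 * k)
    have h1 : alt (2 * (2 * k) + 1) = (2 * k + 1, 2 * k, true) := congrArg Pos.next h0
    have h2 : alt (2 * (2 * k) + 2) = (2 * k + 1, 2 * k + 1, false) := congrArg Pos.next h1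
    have h3 : alt (2 * (2 * k) + 3) = (2 * k + 2, 2 * k + 1, true) := congrArg Pos.next h2
    have i0 : alt (2 * k) = (k, k, false) := alt_two_mul k
    have i1 : alt (2 * k + 1) = (k + 1, k, true) := congrArg Pos.next i0
    refine tensor_chain_trd' (i := 2 * k + 1) (h3.trans ?_) (i1.trans ?_)
      (tensor_chain_fst' (i := 2 * k + 1) true (h2.trans ?_) (i1.trans ?_)
        (tensor_chain_snd' (i := 2 * k) (h1.trans ?_) (i0.trans ?_)
          (tensor_chain_fst' (i := 2 * k) false (h0.trans ?_) (i0.trans ?_)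
            (tensor_chain_rightPath k)))) <;>
    simp [endPt, Dir.next, hp]

/-- Both paths can be extended to paths that end at the lattice point `(2 * k, 2 * k, 2 * k)`. -/
lemma leftPath_perm_rightPath (k : ℕ) :
    ((List.replicate k Dir.fst ++ List.replicate k Dir.snd) ++ leftPath k).Perm
      ((List.replicate k Dir.snd ++ List.replicate k Dir.trd) ++ rightPath k) := by
  classical
  have hl : ∀ (d : Dir) (k : ℕ), (leftPath k).count d =
      (if d = Dir.fst then k else 0) + (if d = Dir.snd then k else 0) +
        (if d = Dir.trd then 2 * k else 0) := by
    intro d k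
    induction k with
    | zero => simp [leftPath]
    | succ k ih => cases d <;> simp [leftPath, ih]; omega
  have hr : ∀ (d : Dir) (k : ℕ), (rightPath k).count d =
      (if d = Dir.fst then 2 * k else 0) + (if d = Dir.snd then k else 0) +
        (if d = Dir.trd then k else 0) := by
    intro d k
    induction k with
    | zero => simp [rightPath]
    | succ k ih => cases d <;> simp [rightPath, ih]; omega
  rw [List.perm_iff_count]
  intro d
  rw [List.count_append, List.count_append, List.count_append, List.count_append, hl, hr]
  cases d <;> simp [List.count_replicate] <;> omega

/-- The sign of the path is the product of the signs that enter the definition of the products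
`x ∨ y` at stage `k` and `(x ∨ y) ∨ z` at stage `2 * k`. -/
lemma pathSign_leftPath (m n : ℤ) : ∀ k : ℕ,
    pathSign m n (0, 0, 0) (leftPath k) = stageSign m k * stageSign (m + n) (2 * k)
  | 0 => rfl
  | k + 1 => by
    have h : stageSign (m + n) (2 * (k + 1)) = (m + n + (2 * k + 1 + 1 : ℕ)).negOnePow *
      ((m + n + (2 * k + 1 : ℕ)).negOnePow * stageSign (m + n) (2 * k)) := rfl
    have e : ∀ a b c d e f : ℤ, Even (a + b + c - (d + e + f)) → ∀ S T : ℤˣ,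
        a.negOnePow * (b.negOnePow * (c.negOnePow * (1 * (S * T)))) =
          d.negOnePow * S * (e.negOnePow * (f.negOnePow * T)) := by
      intro a b c d e f h S T
      have h1 := (Int.negOnePow_eq_iff _ _).2 h
      simp only [Int.negOnePow_add] at h1
      calc _ = a.negOnePow * b.negOnePow * c.negOnePow * (S * T) := by
            rw [one_mul, mul_assoc, mul_assoc]
        _ = _ := by rw [h1]; ac_rfl
    rw [h, stageSign]
    simp only [leftPath, pathSign, endPt, endPt_leftPath, Dir.next, Dir.sign,
      pathSign_leftPath m n k]
    refine e _ _ _ _ _ _ ?_ _ _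
    push_cast
    rw [Int.even_iff]
    omega

/-- The sign of the path is the product of the signs that enter the definition of the products
`y ∨ z` at stage `k` and `x ∨ (y ∨ z)` at stage `2 * k`. -/
lemma pathSign_rightPath (m n : ℤ) : ∀ k : ℕ,
    pathSign m n (0, 0, 0) (rightPath k) = stageSign n k * stageSign m (2 * k)
  | 0 => rfl
  | k + 1 => by
    have h : stageSign m (2 * (k + 1)) = (m + (2 * k + 1 + 1 : ℕ)).negOnePow *
      ((m + (2 * k + 1 : ℕ)).negOnePow * stageSign m (2 * k)) := rfl
    have e : ∀ a c d e f : ℤ, Even (a + c - (d + e + f)) → ∀ S T : ℤˣ,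
        a.negOnePow * (1 * (c.negOnePow * (1 * (S * T)))) =
          d.negOnePow * S * (e.negOnePow * (f.negOnePow * T)) := by
      intro a c d e f h S T
      have h1 := (Int.negOnePow_eq_iff _ _).2 h
      simp only [Int.negOnePow_add] at h1
      calc _ = a.negOnePow * c.negOnePow * (S * T) := by rw [one_mul, one_mul, mul_assoc]
        _ = _ := by rw [h1]; ac_rfl
    rw [h, stageSign]
    simp only [rightPath, pathSign, endPt, endPt_rightPath, Dir.next, Dir.sign,
      pathSign_rightPath m n k]
    refine e _ _ _ _ _ ?_ _ _
    push_cast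
    rw [Int.even_iff]
    omega

end Paths

/-! ### Functoriality of completed Ext groups -/

section Comap

variable {C : Type u} [Category.{v} C] [Abelian C]

/-- Homotopic chain maps induce the same map on Ext groups. -/
lemma ExtGrp.pre_eq_of_homotopy {K L : ChainComplex C ℕ} {φ ψ : K ⟶ L} (h : Homotopy φ ψ) {X : C}
    {n : ℤ} (x : ExtGrp L X n) : ExtGrp.pre X φ n x = ExtGrp.pre X ψ n x := by
  obtain ⟨u, hu, rfl⟩ := cls_surj x
  -- the cocycle condition without its sign
  have hdu : ∀ i, L.d (i + 1) i ≫ u i = 0 := fun i => by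
    have h1 := congrFun (show codiff L X u = 0 from hu.2) (i + 1)
    rw [codiff_succ] at h1
    rcases Int.units_eq_one_or ((-1 : ℤˣ) ^ (i + 1)) with e | e <;> simpa [e] using h1
  refine (cls_eq (preCoch_mem_cocycles ψ hu) (preCoch_mem_cocycles φ hu)
    (c := fun i => (-1 : ℤˣ) ^ (i + 1) • (h.hom i (i + 1) ≫ u (i + 1))) ?_ ?_).symm
  · intro i hi
    dsimp only
    rw [hu.1 (i + 1) (by push_cast; omega), comp_zero, smul_zero]
  · funext i
    rw [Pi.sub_apply, preCoch_apply, preCoch_apply, ← Preadditive.sub_comp, h.comm i,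
      add_sub_cancel_right, Homotopy.prevD_chainComplex, Preadditive.add_comp, Category.assoc, hdu,
      comp_zero, add_zero]
    cases i with
    | zero => simp
    | succ i =>
      rw [Homotopy.dNext_succ_chainComplex, codiff_succ, Linear.comp_units_smul, smul_smul,
        Int.units_mul_self, one_smul, Category.assoc]

variable {A A' A'' : C}

namespace ExtHat

/-- The functoriality of the completed Ext groups in the first variable may be computed by any
chain map that lifts the given morphism. -/
lemma comap_of {P : ProjectiveResolution A} {P' : ProjectiveResolution A'} {r : A ⟶ A'}
    {φ : P.complex ⟶ P'.complex} (h : φ ≫ P'.π = P.π ≫ (ChainComplex.single₀ C).map r)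
    (Q : SyzRes C) (n : ℤ) (k : ℕ) (x : ExtGrp P'.complex (Q.syz k) (n + k)) :
    comap r Q n (of P' Q n k x) = of P Q n k (ExtGrp.pre (Q.syz k) φ (n + k) x) := by
  rw [ExtGrp.pre_eq_of_homotopy (ProjectiveResolution.liftHomotopy r φ
    (ProjectiveResolution.lift r P P') h (ProjectiveResolution.lift_commutes r P P'))]
  rfl

lemma map_of (P : ProjectiveResolution A) {Q R : SyzRes C} (f : Q.syz 0 ⟶ R.syz 0) (n : ℤ)
    (k : ℕ) (x : ExtGrp P.complex (Q.syz k) (n + k)) :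
    map P f n (of P Q n k x) = of P R n k (ExtGrp.post P.complex ((Q.lift R f).syz k) _ x) := rfl

lemma exists_of (P : ProjectiveResolution A) (Q : SyzRes C) (n : ℤ) (x : ExtHat P Q n) :
    ∃ k y, x = of P Q n k y := by
  induction x using DirectLimit.induction with
  | _ k y => exact ⟨k, y, rfl⟩

end ExtHat

end Comap

/-! ### Associativity of products of cochains -/

section Associator

variable {C : Type u} [Category.{v} C] [Abelian C] [MonoidalCategory C] [MonoidalPreadditive C]

/-- The associativity isomorphism of the tensor product of complexes. -/
abbrev assocCx (K L M : ChainComplex C ℕ) :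
    tensorCx (tensorCx K L) M ≅ tensorCx K (tensorCx L M) :=
  HomologicalComplex.associator K L M

/-- The associator of complexes is the associator of objects on each summand. -/
lemma ι_assocCx (K L M : ChainComplex C ℕ) (i j l n : ℕ) (h : i + j + l = n) :
    ιT K L i j (i + j) rfl ▷ M.X l ≫ ιT (tensorCx K L) M (i + j) l n h ≫
        (assocCx K L M).hom.f n =
      (α_ (K.X i) (L.X j) (M.X l)).hom ≫ K.X i ◁ ιT L M j l (j + l) rfl ≫
        ιT K (tensorCx L M) i (j + l) n ((add_assoc i j l).symm.trans h) := by
  have h1 := HomologicalComplex.ι_mapBifunctorAssociatorX_hom (curriedAssociatorNatIso C) K L M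
    (.down ℕ) (.down ℕ) (.down ℕ) i j l n h
  have h2 := HomologicalComplex.mapBifunctor₁₂.ι_eq (curriedTensor C) (curriedTensor C) K L M
    (.down ℕ) (.down ℕ) i j l (i + j) n rfl h
  have h3 := HomologicalComplex.mapBifunctor₂₃.ι_eq (curriedTensor C) (curriedTensor C) K L M
    (.down ℕ) (.down ℕ) (.down ℕ) i j l (j + l) n rfl ((add_assoc i j l).symm.trans h)
  rw [h2, h3] at h1
  exact (Category.assoc _ _ _).symm.trans h1

/-- Morphisms out of a triple tensor product of complexes agree if they agree on all summands. -/
lemma tensor_ext₃ {K L M : ChainComplex C ℕ} {n : ℕ} {Z : C}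
    {f g : (tensorCx (tensorCx K L) M).X n ⟶ Z}
    (h : ∀ i j l (hijl : i + j + l = n),
      ιT K L i j (i + j) rfl ▷ M.X l ≫ ιT (tensorCx K L) M (i + j) l n hijl ≫ f =
        ιT K L i j (i + j) rfl ▷ M.X l ≫ ιT (tensorCx K L) M (i + j) l n hijl ≫ g) : f = g := by
  refine HomologicalComplex.mapBifunctor₁₂.hom_ext fun i j l hijl => ?_
  have h2 := HomologicalComplex.mapBifunctor₁₂.ι_eq (curriedTensor C) (curriedTensor C) K L M
    (.down ℕ) (.down ℕ) i j l (i + j) n rfl hijl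
  rw [h2]
  exact (Category.assoc _ _ _).trans ((h i j l hijl).trans (Category.assoc _ _ _).symm)

/-- The product of cochains is associative. -/
lemma preCoch_assocCx_cross {K L M : ChainComplex C ℕ} {X Y Z : C} (u : Coch K X) (v : Coch L Y)
    (w : Coch M Z) : preCoch (assocCx K L M).hom _ (cross u (cross v w)) =
      postCoch _ (α_ X Y Z).hom (cross (cross u v) w) := by
  funext n
  refine tensor_ext₃ fun i j l h => ?_
  have h1 : (ιT K L i j (i + j) rfl ▷ M.X l ≫ ιT (tensorCx K L) M (i + j) l n h ≫
      (assocCx K L M).hom.f n) ≫ cross u (cross v w) n =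
      (-1 : ℤˣ) ^ (i * (j + l)) • (-1 : ℤˣ) ^ (j * l) •
        ((α_ (K.X i) (L.X j) (M.X l)).hom ≫ (u i ⊗ₘ v j ⊗ₘ w l)) := by
    rw [ι_assocCx K L M i j l n h]
    have h2 := ι_cross u (cross v w) i (j + l) n ((add_assoc i j l).symm.trans h)
    have h3 : K.X i ◁ ιT L M j l (j + l) rfl ≫ (u i ⊗ₘ cross v w (j + l)) =
        (-1 : ℤˣ) ^ (j * l) • (u i ⊗ₘ v j ⊗ₘ w l) := by
      rw [← MonoidalCategory.id_tensorHom, MonoidalCategory.tensorHom_comp_tensorHom,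
        Category.id_comp, ι_cross, tensorHom_smul]
    rw [Category.assoc, Category.assoc, h2, Linear.comp_units_smul, h3, Linear.comp_units_smul,
      Linear.comp_units_smul]
  have h4 : ιT K L i j (i + j) rfl ▷ M.X l ≫ (ιT (tensorCx K L) M (i + j) l n h ≫
      cross (cross u v) w n) ≫ (α_ X Y Z).hom =
      (-1 : ℤˣ) ^ ((i + j) * l) • (-1 : ℤˣ) ^ (i * j) •
        (((u i ⊗ₘ v j) ⊗ₘ w l) ≫ (α_ X Y Z).hom) := by
    have h3 : ιT K L i j (i + j) rfl ▷ M.X l ≫ (cross u v (i + j) ⊗ₘ w l) =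
        (-1 : ℤˣ) ^ (i * j) • ((u i ⊗ₘ v j) ⊗ₘ w l) := by
      rw [← MonoidalCategory.tensorHom_id, MonoidalCategory.tensorHom_comp_tensorHom,
        Category.id_comp, ι_cross, smul_tensorHom]
    rw [ι_cross (cross u v) w (i + j) l n h, ← Category.assoc, Linear.comp_units_smul, h3,
      Linear.units_smul_comp, Linear.units_smul_comp]
  rw [preCoch_apply, postCoch_apply]
  simp only [Category.assoc] at h1 h4
  refine h1.trans (Eq.trans ?_ h4.symm)
  rw [MonoidalCategory.associator_naturality, smul_smul, smul_smul, ← pow_add, ← pow_add,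
    show i * (j + l) + j * l = (i + j) * l + i * j by ring]

end Associator

/-! ### Tensor products of resolutions -/

section TensorResolutions

variable {C : Type u} [Category.{v} C] [Abelian C] [MonoidalCategory C] [MonoidalPreadditive C]
  {A A' A'' : C}

lemma tensorAug_f_zero (P : ProjectiveResolution A) (P' : ProjectiveResolution A') :
    (tensorAug P P').f 0 = cross (aug P) (aug P') 0 :=
  ChainComplex.toSingle₀Equiv_symm_apply_f_zero _ _

lemma aug_tensorRes [TensorProjective C] (P : ProjectiveResolution A)
    (P' : ProjectiveResolution A') [IsTensorResolution P P'] :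
    aug (tensorRes P P') = cross (aug P) (aug P') := by
  funext n
  cases n with
  | zero => exact tensorAug_f_zero P P'
  | succ n => exact ((cross_mem_degPart (add_zero 0) (aug_mem P).1 (aug_mem P').1) (n + 1)
      (by push_cast; omega)).symm

/-- The tensor product of two chain maps. -/
abbrev mapCx {K K' L L' : ChainComplex C ℕ} (φ : K ⟶ K') (ψ : L ⟶ L') :
    tensorCx K L ⟶ tensorCx K' L' :=
  HomologicalComplex.mapBifunctorMap φ ψ (curriedTensor C) (.down ℕ)

lemma ι_mapCx {K K' L L' : ChainComplex C ℕ} (φ : K ⟶ K') (ψ : L ⟶ L') (i j n : ℕ)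
    (h : i + j = n) : ιT K L i j n h ≫ (mapCx φ ψ).f n =
      (φ.f i ⊗ₘ ψ.f j) ≫ ιT K' L' i j n h := by
  have h1 := HomologicalComplex.ι_mapBifunctorMap φ ψ (curriedTensor C) (.down ℕ) i j n h
  rw [MonoidalCategory.tensorHom_def, Category.assoc]
  exact h1

lemma preCoch_mapCx_cross {K K' L L' : ChainComplex C ℕ} (φ : K ⟶ K') (ψ : L ⟶ L') {X Y : C}
    (u : Coch K' X) (v : Coch L' Y) :
    preCoch (mapCx φ ψ) _ (cross u v) = cross (preCoch φ X u) (preCoch ψ Y v) := by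
  funext n
  refine tensor_ext fun i j h => ?_
  have h1 := ι_cross u v i j n h
  rw [ι_cross, preCoch_apply, ← Category.assoc, ι_mapCx, Category.assoc, h1,
    Linear.comp_units_smul, MonoidalCategory.tensorHom_comp_tensorHom]
  rfl

/-- The associator of complexes is compatible with the augmentations. -/
lemma assocCx_tensorAug [TensorProjective C] (P : ProjectiveResolution A)
    (P' : ProjectiveResolution A') (P'' : ProjectiveResolution A'') [IsTensorResolution P P']
    [IsTensorResolution P' P''] :
    (assocCx P.complex P'.complex P''.complex).hom ≫ tensorAug P (tensorRes P' P'') =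
      tensorAug (tensorRes P P') P'' ≫ (ChainComplex.single₀ C).map (α_ A A' A'').hom := by
  refine HomologicalComplex.to_single_hom_ext ?_
  rw [HomologicalComplex.comp_f, HomologicalComplex.comp_f, ChainComplex.single₀_map_f_zero,
    tensorAug_f_zero, tensorAug_f_zero, aug_tensorRes, aug_tensorRes]
  exact congrFun (preCoch_assocCx_cross (aug P) (aug P') (aug P'')) 0

/-- If `(P ⊗ P') ⊗ P''` is a resolution, then so is `P ⊗ (P' ⊗ P'')`. -/
lemma IsTensorResolution.assoc [TensorProjective C] (P : ProjectiveResolution A)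
    (P' : ProjectiveResolution A') (P'' : ProjectiveResolution A'') [IsTensorResolution P P']
    [IsTensorResolution P' P''] [h : IsTensorResolution (tensorRes P P') P''] :
    IsTensorResolution P (tensorRes P' P'') where
  quasiIso := by
    have h1 := h.quasiIso
    have h2 := assocCx_tensorAug P P' P''
    have h3 : tensorAug P (tensorRes P' P'') =
        (assocCx P.complex P'.complex P''.complex).inv ≫
          tensorAug (tensorRes P P') P'' ≫ (ChainComplex.single₀ C).map (α_ A A' A'').hom := by
      rw [← h2, Iso.inv_hom_id_assoc]
    rw [h3]
    infer_instance

lemma mapCx_tensorAug {B B' : C} {P : ProjectiveResolution A} {P' : ProjectiveResolution A'}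
    {R : ProjectiveResolution B} {R' : ProjectiveResolution B'} {r : A ⟶ B} {r' : A' ⟶ B'}
    {φ : P.complex ⟶ R.complex} {ψ : P'.complex ⟶ R'.complex}
    (h : φ ≫ R.π = P.π ≫ (ChainComplex.single₀ C).map r)
    (h' : ψ ≫ R'.π = P'.π ≫ (ChainComplex.single₀ C).map r') :
    mapCx φ ψ ≫ tensorAug R R' =
      tensorAug P P' ≫ (ChainComplex.single₀ C).map (r ⊗ₘ r') := by
  have key : ∀ {A B : C} {P : ProjectiveResolution A} {R : ProjectiveResolution B} {r : A ⟶ B}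
      {φ : P.complex ⟶ R.complex} (_ : φ ≫ R.π = P.π ≫ (ChainComplex.single₀ C).map r),
      φ.f 0 ≫ aug R 0 = aug P 0 ≫ r := fun {A B P R r φ} h => by
    have h1 := HomologicalComplex.congr_hom h 0
    rw [HomologicalComplex.comp_f, HomologicalComplex.comp_f,
      ChainComplex.single₀_map_f_zero] at h1
    exact h1
  refine HomologicalComplex.to_single_hom_ext ?_
  rw [HomologicalComplex.comp_f, HomologicalComplex.comp_f, ChainComplex.single₀_map_f_zero,
    tensorAug_f_zero, tensorAug_f_zero]
  refine tensor_ext fun i j hij => ?_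
  obtain rfl : i = 0 := by omega
  obtain rfl : j = 0 := by omega
  have h1 := congrFun (preCoch_mapCx_cross φ ψ (aug R) (aug R')) 0
  rw [preCoch_apply] at h1
  have h2 := ι_cross (aug P) (aug P') 0 0 0 hij
  refine (congrArg _ h1).trans ((ι_cross _ _ 0 0 0 hij).trans ?_)
  rw [preCoch_apply, preCoch_apply, key h, key h', ← MonoidalCategory.tensorHom_comp_tensorHom,
    ← Linear.units_smul_comp, ← h2]
  exact Category.assoc _ _ _

end TensorResolutions

/-! ### Products of Ext classes -/

section ExtGroups

variable {C : Type u} [Category.{v} C] [Abelian C] [MonoidalCategory C] [MonoidalPreadditive C]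
  {K K' L L' M : ChainComplex C ℕ} {X X' Y Y' Z : C}

lemma ExtGrp.pre_assocCx_cross {m n p a b s : ℤ} (h₁ : m + n = a) (h₂ : a + p = s)
    (h₃ : n + p = b) (h₄ : m + b = s) (x : ExtGrp K X m) (y : ExtGrp L Y n) (z : ExtGrp M Z p) :
    ExtGrp.pre _ (assocCx K L M).hom s (ExtGrp.cross K (tensorCx L M) X (Y ⊗ Z) h₄ x
        (ExtGrp.cross L M Y Z h₃ y z)) =
      ExtGrp.post _ (α_ X Y Z).hom s (ExtGrp.cross (tensorCx K L) M (X ⊗ Y) Z h₂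
        (ExtGrp.cross K L X Y h₁ x y) z) := by
  obtain ⟨u, hu, rfl⟩ := cls_surj x
  obtain ⟨v, hv, rfl⟩ := cls_surj y
  obtain ⟨w, hw, rfl⟩ := cls_surj z
  exact cls_congr _ (preCoch_assocCx_cross u v w)

lemma ExtGrp.pre_mapCx_cross (φ : K ⟶ K') (ψ : L ⟶ L') {m n s : ℤ} (h : m + n = s)
    (x : ExtGrp K' X m) (y : ExtGrp L' Y n) :
    ExtGrp.pre _ (mapCx φ ψ) s (ExtGrp.cross K' L' X Y h x y) =
      ExtGrp.cross K L X Y h (ExtGrp.pre X φ m x) (ExtGrp.pre Y ψ n y) := by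
  obtain ⟨u, hu, rfl⟩ := cls_surj x
  obtain ⟨v, hv, rfl⟩ := cls_surj y
  exact cls_congr _ (preCoch_mapCx_cross φ ψ u v)

lemma ExtGrp.cross_post_left (f : X ⟶ X') {m n s : ℤ} (h : m + n = s) (x : ExtGrp K X m)
    (y : ExtGrp L Y n) : ExtGrp.cross K L X' Y h (ExtGrp.post K f m x) y =
      ExtGrp.post _ (f ▷ Y) s (ExtGrp.cross K L X Y h x y) := by
  obtain ⟨u, hu, rfl⟩ := cls_surj x
  obtain ⟨v, hv, rfl⟩ := cls_surj y
  exact cls_congr _ (CompletedExt.post_cross_left f u v).symm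

lemma ExtGrp.cross_post_right (f : Y ⟶ Y') {m n s : ℤ} (h : m + n = s) (x : ExtGrp K X m)
    (y : ExtGrp L Y n) : ExtGrp.cross K L X Y' h x (ExtGrp.post L f n y) =
      ExtGrp.post _ (X ◁ f) s (ExtGrp.cross K L X Y h x y) := by
  obtain ⟨u, hu, rfl⟩ := cls_surj x
  obtain ⟨v, hv, rfl⟩ := cls_surj y
  exact cls_congr _ (CompletedExt.post_cross_right f u v).symm

lemma ExtGrp.cross_smul_right (r : ℤˣ) {m n s : ℤ} (h : m + n = s) (x : ExtGrp K X m)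
    (y : ExtGrp L Y n) : ExtGrp.cross K L X Y h x (r • y) = r • ExtGrp.cross K L X Y h x y :=
  map_units_smul _ _ _

end ExtGroups

/-! ### Associativity of external products -/

section Families

variable {C : Type u} [Category.{v} C] [Abelian C] {A : C} {P : ProjectiveResolution A}
  {Q : SyzRes C} {n : ℤ}

/-- An element of the completed Ext group is represented by a compatible family of classes. -/
lemma ExtHat.exists_isStable (x : ExtHat P Q n) :
    ∃ (k : ℕ) (X : ∀ i : ℕ, ExtGrp P.complex (Q.syz i) (n + i)),
      IsStable k X ∧ ∀ i, k ≤ i → x = of P Q n i (X i) := by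
  obtain ⟨k, y, rfl⟩ := ExtHat.exists_of P Q n x
  let F := fun k : ℕ => ExtGrp P.complex (Q.syz k) (n + k)
  let s : ∀ k, F k →+ F (k + 1) := fun k => conn P.complex (Q.exact k) (stage_succ n k)
  have hX : IsStable k (fun i => if h : k ≤ i then seqMap F s k i h y else 0) := by
    intro i hi
    dsimp only
    rw [dif_pos hi, dif_pos (hi.trans i.le_succ), seqMap_succ F s k i hi]
    rfl
  refine ⟨k, _, hX, fun i hi => ?_⟩
  induction i, hi using Nat.le_induction with
  | base => rw [dif_pos le_rfl, seqMap_self]; rfl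
  | succ i hi ih =>
    refine ih.trans ((ExtHat.of_succ P Q n i _).symm.trans ?_)
    exact congrArg _ (hX i hi)

lemma IsStable.mono {K : ChainComplex C ℕ} [∀ i, Projective (K.X i)]
    {X : ∀ i : ℕ, ExtGrp K (Q.syz i) (n + i)} {k l : ℕ} (h : IsStable k X) (hkl : k ≤ l) :
    IsStable l X := fun i hi => h i (hkl.trans hi)

end Families

section Products

variable {C : Type u} [Category.{v} C] [Abelian C] [MonoidalCategory C] [MonoidalPreadditive C]
  {A A' A'' : C}

lemma ExtGrp.cross_cross_congr {K L M : ChainComplex C ℕ} {X Y Z : C} {m n p a s : ℤ}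
    (h₁ : m + n = a) (h₂ : a + p = s) (h : m + n + p = s) (x : ExtGrp K X m) (y : ExtGrp L Y n)
    (z : ExtGrp M Z p) :
    ExtGrp.cross (tensorCx K L) M _ _ h₂ (ExtGrp.cross K L X Y h₁ x y) z =
      ExtGrp.cross (tensorCx K L) M _ _ h (ExtGrp.cross K L X Y rfl x y) z := by
  subst h₁
  rfl

variable [TensorProjective C] {P : ProjectiveResolution A} {P' : ProjectiveResolution A'}
  {P'' : ProjectiveResolution A''} [IsTensorResolution P P']
  [IsTensorResolution (tensorRes P P') P''] {Q Q' Q'' : SyzRes C} [Q.Admissible] [Q'.Admissible]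
  [Q''.Admissible] {m n p mn np s : ℤ}
  {X : ∀ i : ℕ, ExtGrp P.complex (Q.syz i) (m + i)}
  {Y : ∀ i : ℕ, ExtGrp P'.complex (Q'.syz i) (n + i)}
  {Z : ∀ i : ℕ, ExtGrp P''.complex (Q''.syz i) (p + i)}

/-- The product `(x ∨ y) ∨ z`, computed with representatives at stage `k` for `x` and `y` and at stage
`2 * k` for `z`, is the triple product at the end point of `leftPath k` up to the sign of the path. -/
lemma extProd_extProd_left (hmn : m + n = mn) (h : mn + p = s) (k : ℕ)
    (ha : m + (endPt (0, 0, 0) (leftPath k)).1 + (n + (endPt (0, 0, 0) (leftPath k)).2.1) +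
      (p + (endPt (0, 0, 0) (leftPath k)).2.2) = s + (2 * (2 * k) : ℕ)) :
    extProd (tensorRes P P') P'' (Q.tensor Q') Q'' h
        (extProd P P' Q Q' hmn (ExtHat.of P Q m k (X k)) (ExtHat.of P' Q' n k (Y k)))
        (ExtHat.of P'' Q'' p (2 * k) (Z (2 * k))) =
      pathSign m n (0, 0, 0) (leftPath k) •
        ExtHat.of (tensorRes (tensorRes P P') P'') ((Q.tensor Q').tensor Q'') s (2 * (2 * k))
          (ExtGrp.post _ (eqToHom (congrArg Sigma.fst (tensor_chain_leftPath k).symm)) _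
            (crossAt X Y Z (endPt (0, 0, 0) (leftPath k)) ha)) := by
  have hk : m + k + (n + k) + (p + (2 * k : ℕ)) = s + (2 * (2 * k) : ℕ) := by push_cast; omega
  have hc := crossAt_congr X Y Z (endPt_leftPath k).symm hk ha
  rw [extProd_of, stageProd, ← ExtHat.of_smul, extProd_of, stageProd, cross_smul_left,
    map_units_smul, ExtHat.of_smul, smul_smul, mul_comm, ExtGrp.cross_post_left,
    ExtGrp.cross_cross_congr _ _ hk, ExtGrp.post_post, pathSign_leftPath, hmn, ← hc,
    ExtGrp.post_post]
  have h1 : Q.tensorEq Q' k ▷ Q''.syz (2 * k) ≫ (Q.tensor Q').tensorEq Q'' (2 * k) =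
      eqToHom (congrArg (latObj Q Q' Q'') (endPt_leftPath k).symm) ≫
        eqToHom (congrArg Sigma.fst (tensor_chain_leftPath k).symm) :=
    ((congrArg (fun t => t ≫ _) (eqToHom_whiskerRight _ _)).trans (eqToHom_trans _ _)).trans
      (eqToHom_trans _ _).symm
  rw [h1]
  rfl

/-- The product `x ∨ (y ∨ z)`, computed with representatives at stage `2 * k` for `x` and at stage `k`
for `y` and `z`, is the triple product at the end point of `rightPath k` up to the sign of the
path. -/
lemma extProd_extProd_right [IsTensorResolution P' P'']
    [IsTensorResolution P (tensorRes P' P'')] (hnp : n + p = np) (h : m + np = s) (k : ℕ)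
    (ha : m + (endPt (0, 0, 0) (rightPath k)).1 + (n + (endPt (0, 0, 0) (rightPath k)).2.1) +
      (p + (endPt (0, 0, 0) (rightPath k)).2.2) = s + (2 * (2 * k) : ℕ)) :
    ExtHat.comap (P := tensorRes (tensorRes P P') P'') (P' := tensorRes P (tensorRes P' P''))
        (α_ A A' A'').hom (Q.tensor (Q'.tensor Q'')) s
        (extProd P (tensorRes P' P'') Q (Q'.tensor Q'') h (ExtHat.of P Q m (2 * k) (X (2 * k)))
          (extProd P' P'' Q' Q'' hnp (ExtHat.of P' Q' n k (Y k)) (ExtHat.of P'' Q'' p k (Z k)))) =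
      pathSign m n (0, 0, 0) (rightPath k) •
        ExtHat.of (tensorRes (tensorRes P P') P'') (Q.tensor (Q'.tensor Q'')) s (2 * (2 * k))
          (ExtGrp.post _ ((α_ _ _ _).hom ≫
              eqToHom (congrArg Sigma.fst (tensor_chain_rightPath k).symm)) _
            (crossAt X Y Z (endPt (0, 0, 0) (rightPath k)) ha)) := by
  have hk : m + (2 * k : ℕ) + (n + k) + (p + k) = s + (2 * (2 * k) : ℕ) := by push_cast; omega
  have hc := crossAt_congr X Y Z (endPt_rightPath k).symm hk ha
  have hα : ∀ {a b : ℕ × ℕ × ℕ} (hab : a = b),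
      eqToHom (congrArg (latObj Q Q' Q'') hab) ≫ (α_ (Q.syz b.1) (Q'.syz b.2.1) (Q''.syz b.2.2)).hom
        = (α_ (Q.syz a.1) (Q'.syz a.2.1) (Q''.syz a.2.2)).hom ≫ eqToHom (by rw [hab]) := by
    rintro a _ rfl
    simp
  rw [extProd_of, stageProd, ← ExtHat.of_smul, extProd_of, stageProd, ExtGrp.cross_smul_right,
    map_units_smul, map_units_smul, ExtHat.of_smul, map_units_smul, smul_smul,
    ExtHat.comap_of (φ := (assocCx P.complex P'.complex P''.complex).hom)
      (assocCx_tensorAug P P' P''), ExtGrp.pre_post, ExtGrp.cross_post_right, ExtGrp.pre_post,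
    ExtGrp.pre_assocCx_cross rfl hk, pathSign_rightPath, mul_comm, ← hc,
    ExtGrp.post_post, ExtGrp.post_post, ExtGrp.post_post]
  have h1 : (α_ _ _ _).hom ≫ Q.syz (2 * k) ◁ Q'.tensorEq Q'' k ≫
      Q.tensorEq (Q'.tensor Q'') (2 * k) =
      eqToHom (congrArg (latObj Q Q' Q'') (endPt_rightPath k).symm) ≫ (α_ _ _ _).hom ≫
        eqToHom (congrArg Sigma.fst (tensor_chain_rightPath k).symm) := by
    rw [← Category.assoc (eqToHom _), hα (endPt_rightPath k).symm, Category.assoc]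
    exact congrArg (fun t => (α_ _ _ _).hom ≫ t)
      (((congrArg (fun t => t ≫ _) (whiskerLeft_eqToHom _ _)).trans (eqToHom_trans _ _)).trans
        (eqToHom_trans _ _).symm)
  rw [← h1]
  rfl

/-- External products are associative. -/
lemma extProd_assoc [IsTensorResolution P' P''] [IsTensorResolution P (tensorRes P' P'')]
    (hmn : m + n = mn) (hnp : n + p = np) (h : mn + p = s) (h' : m + np = s)
    (x : ExtHat P Q m) (y : ExtHat P' Q' n) (z : ExtHat P'' Q'' p) :
    ExtHat.map (Q := (Q.tensor Q').tensor Q'') (R := Q.tensor (Q'.tensor Q''))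
        (tensorRes (tensorRes P P') P'') (α_ (Q.syz 0) (Q'.syz 0) (Q''.syz 0)).hom s
        (extProd (tensorRes P P') P'' (Q.tensor Q') Q'' h (extProd P P' Q Q' hmn x y) z) =
      ExtHat.comap (P := tensorRes (tensorRes P P') P'') (P' := tensorRes P (tensorRes P' P''))
        (α_ A A' A'').hom (Q.tensor (Q'.tensor Q'')) s
        (extProd P (tensorRes P' P'') Q (Q'.tensor Q'') h' x (extProd P' P'' Q' Q'' hnp y z)) := by
  obtain ⟨k₁, X, hX, hx⟩ := x.exists_isStable
  obtain ⟨k₂, Y, hY, hy⟩ := y.exists_isStable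
  obtain ⟨k₃, Z, hZ, hz⟩ := z.exists_isStable
  obtain ⟨k, hk₁, hk₂, hk₃⟩ : ∃ k, k₁ ≤ k ∧ k₂ ≤ k ∧ k₃ ≤ k := ⟨k₁ + k₂ + k₃, by omega⟩
  have el := endPt_leftPath k
  have er := endPt_rightPath k
  have ha : m + (endPt (0, 0, 0) (leftPath k)).1 + (n + (endPt (0, 0, 0) (leftPath k)).2.1) +
      (p + (endPt (0, 0, 0) (leftPath k)).2.2) = s + (2 * (2 * k) : ℕ) := by
    rw [el]; push_cast; omega
  have ha' : m + (endPt (0, 0, 0) (rightPath k)).1 + (n + (endPt (0, 0, 0) (rightPath k)).2.1) +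
      (p + (endPt (0, 0, 0) (rightPath k)).2.2) = s + (2 * (2 * k) : ℕ) := by
    rw [er]; push_cast; omega
  have h1 := extProd_extProd_left (P := P) (P' := P') (P'' := P'') (X := X) (Y := Y) (Z := Z)
    hmn h k ha
  have h2 := extProd_extProd_right (P := P) (P' := P') (P'' := P'') (X := X) (Y := Y) (Z := Z)
    hnp h' k ha'
  rw [← hx k hk₁, ← hy k hk₂, ← hz (2 * k) (by omega)] at h1
  rw [← hx (2 * k) (by omega), ← hy k hk₂, ← hz k hk₃] at h2
  rw [h1, h2, map_units_smul]
  have h3 := of_lift_crossAt (P := P) (P' := P') (P'' := P'') (R := (Q.tensor Q').tensor Q'')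
    (S := Q.tensor (Q'.tensor Q'')) (p := (0, 0, 0)) (w := leftPath k) (w' := rightPath k)
    (f := (α_ (Q.syz 0) (Q'.syz 0) (Q''.syz 0)).hom) (i := 𝟙 _) (j := (α_ _ _ _).inv)
    (t := 2 * (2 * k)) ((Category.id_comp _).trans (α_ _ _ _).hom_inv_id)
    (leftPath_perm_rightPath k) (SyzChain.lifts_eqToHom (tensor_chain_leftPath k).symm)
    (e' := eqToHom (congrArg Sigma.fst (tensor_chain_rightPath k)) ≫ (α_ _ _ _).inv)
    (e'' := (α_ _ _ _).hom ≫ eqToHom (congrArg Sigma.fst (tensor_chain_rightPath k).symm))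
    (by simp)
    (by
      have := (SyzChain.lifts_eqToHom (tensor_chain_rightPath k)).comp
        (latChain'_lifts Q Q' Q'' (0, 0, 0) (rightPath k))
      exact (congrArg (fun t => SyzChain.Lifts t _ _ _) (Category.id_comp _)).mp this)
    (hX.mono hk₁) (hY.mono hk₂) (hZ.mono hk₃) (by rw [el]) (by rw [el])
    (by rw [el]; dsimp only; omega) (by rw [er]; dsimp only; omega) (by rw [er]) (by rw [er])
    ha ha'
  refine (congrArg (pathSign m n (0, 0, 0) (leftPath k) • ·) h3).trans ?_
  dsimp only
  rw [smul_smul, ← mul_assoc, Int.units_mul_self, one_mul]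

end Products

/-! ### Cup products -/

section Functoriality

variable {C : Type u} [Category.{v} C] [Abelian C] {A A' A'' : C}

lemma ExtGrp.pre_pre {K L M : ChainComplex C ℕ} (φ : K ⟶ L) (ψ : L ⟶ M) {X : C} {n : ℤ}
    (x : ExtGrp M X n) :
    ExtGrp.pre X φ n (ExtGrp.pre X ψ n x) = ExtGrp.pre X (φ ≫ ψ) n x := by
  obtain ⟨u, hu, rfl⟩ := cls_surj x
  exact cls_congr _ (by funext i; simp)

lemma ExtGrp.pre_id {K : ChainComplex C ℕ} {X : C} {n : ℤ} (x : ExtGrp K X n) :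
    ExtGrp.pre X (𝟙 K) n x = x := by
  obtain ⟨u, hu, rfl⟩ := cls_surj x
  exact cls_congr _ (by funext i; simp)

variable {P : ProjectiveResolution A} {P' : ProjectiveResolution A'}
  {P'' : ProjectiveResolution A''} {Q R : SyzRes C} {n : ℤ}

lemma ExtHat.comap_comap (r : A ⟶ A') (r' : A' ⟶ A'') (x : ExtHat P'' Q n) :
    comap (P := P) (P' := P') r Q n (comap r' Q n x) = comap (r ≫ r') Q n x := by
  obtain ⟨k, y, rfl⟩ := ExtHat.exists_of P'' Q n x
  have h := ProjectiveResolution.lift_commutes r P P'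
  have h' := ProjectiveResolution.lift_commutes r' P' P''
  rw [comap_of h', comap_of h, ExtGrp.pre_pre, ← comap_of (r := r ≫ r')]
  rw [Category.assoc, h', ← Category.assoc, h, Category.assoc, Functor.map_comp]

lemma ExtHat.map_comap (r : A ⟶ A') (f : Q.syz 0 ⟶ R.syz 0) (x : ExtHat P' Q n) :
    map P f n (comap r Q n x) = comap r R n (map P' f n x) := by
  obtain ⟨k, y, rfl⟩ := ExtHat.exists_of P' Q n x
  have h := ProjectiveResolution.lift_commutes r P P'
  rw [comap_of h, map_of, map_of, comap_of h, ExtGrp.pre_post]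

/-- Two elements have representatives at a common stage. -/
lemma ExtHat.exists_of_of {m : ℤ} (x : ExtHat P Q m) (y : ExtHat P' R n) :
    ∃ k x' y', x = of P Q m k x' ∧ y = of P' R n k y' := by
  obtain ⟨k, X, -, hx⟩ := x.exists_isStable
  obtain ⟨l, Y, -, hy⟩ := y.exists_isStable
  exact ⟨max k l, _, _, hx _ (le_max_left _ _), hy _ (le_max_right _ _)⟩

end Functoriality

section Cup

variable {C : Type u} [Category.{v} C] [Abelian C] [MonoidalCategory C] [MonoidalPreadditive C]
  [TensorProjective C] {A A' B B' : C} {P : ProjectiveResolution A} {P' : ProjectiveResolution A'}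
  {R : ProjectiveResolution B} {R' : ProjectiveResolution B'} [IsTensorResolution P P']
  [IsTensorResolution R R'] {Q Q' : SyzRes C} [Q.Admissible] [Q'.Admissible] {m n s : ℤ}

/-- Naturality of external products in the first variables of both factors. -/
lemma extProd_comap {r : A ⟶ B} {r' : A' ⟶ B'} {φ : P.complex ⟶ R.complex}
    {ψ : P'.complex ⟶ R'.complex} (h₁ : φ ≫ R.π = P.π ≫ (ChainComplex.single₀ C).map r)
    (h₂ : ψ ≫ R'.π = P'.π ≫ (ChainComplex.single₀ C).map r') (h : m + n = s) (k : ℕ)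
    (x : ExtGrp R.complex (Q.syz k) (m + k)) (y : ExtGrp R'.complex (Q'.syz k) (n + k)) :
    extProd P P' Q Q' h (ExtHat.of P Q m k (ExtGrp.pre _ φ _ x))
        (ExtHat.of P' Q' n k (ExtGrp.pre _ ψ _ y)) =
      ExtHat.comap (P := tensorRes P P') (P' := tensorRes R R') (r ⊗ₘ r') (Q.tensor Q') s
        (extProd R R' Q Q' h (ExtHat.of R Q m k x) (ExtHat.of R' Q' n k y)) := by
  rw [extProd_of, extProd_of, stageProd, stageProd, map_units_smul,
    ExtHat.comap_of (P := tensorRes P P') (P' := tensorRes R R') (φ := mapCx φ ψ)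
      (mapCx_tensorAug h₁ h₂), ExtGrp.pre_post, ExtGrp.pre_mapCx_cross]

lemma extProd_comap_left [IsTensorResolution R P'] (r : A ⟶ B) (h : m + n = s) (x : ExtHat R Q m)
    (y : ExtHat P' Q' n) : extProd P P' Q Q' h (ExtHat.comap r Q m x) y =
      ExtHat.comap (P := tensorRes P P') (P' := tensorRes R P') (r ▷ A') (Q.tensor Q') s
        (extProd R P' Q Q' h x y) := by
  obtain ⟨k, x, y, rfl, rfl⟩ := ExtHat.exists_of_of x y
  have h₁ := ProjectiveResolution.lift_commutes r P R
  have h₂ : 𝟙 P'.complex ≫ P'.π = P'.π ≫ (ChainComplex.single₀ C).map (𝟙 A') := by simp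
  rw [ExtHat.comap_of h₁, ← MonoidalCategory.tensorHom_id, ← extProd_comap h₁ h₂, ExtGrp.pre_id]

lemma extProd_comap_right [IsTensorResolution P R'] (r : A' ⟶ B') (h : m + n = s)
    (x : ExtHat P Q m) (y : ExtHat R' Q' n) : extProd P P' Q Q' h x (ExtHat.comap r Q' n y) =
      ExtHat.comap (P := tensorRes P P') (P' := tensorRes P R') (A ◁ r) (Q.tensor Q') s
        (extProd P R' Q Q' h x y) := by
  obtain ⟨k, x, y, rfl, rfl⟩ := ExtHat.exists_of_of x y
  have h₁ := ProjectiveResolution.lift_commutes r P' R'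
  have h₂ : 𝟙 P.complex ≫ P.π = P.π ≫ (ChainComplex.single₀ C).map (𝟙 A) := by simp
  rw [ExtHat.comap_of h₁, ← MonoidalCategory.id_tensorHom, ← extProd_comap h₂ h₁, ExtGrp.pre_id]

/-- Cup products are associative. -/
lemma cup_assoc (P : ProjectiveResolution (𝟙_ C)) [IsTensorResolution P P]
    [IsTensorResolution (tensorRes P P) P] {Q Q' Q'' : SyzRes C} [Q.Admissible] [Q'.Admissible]
    [Q''.Admissible] {m n p mn np s : ℤ} (hmn : m + n = mn) (hnp : n + p = np) (h : mn + p = s)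
    (h' : m + np = s) (x : HHat P Q m) (y : HHat P Q' n) (z : HHat P Q'' p) :
    ExtHat.map (Q := (Q.tensor Q').tensor Q'') (R := Q.tensor (Q'.tensor Q'')) P
        (α_ (Q.syz 0) (Q'.syz 0) (Q''.syz 0)).hom s
        (cup P (Q.tensor Q') Q'' h (cup P Q Q' hmn x y) z) =
      cup P Q (Q'.tensor Q'') h' x (cup P Q' Q'' hnp y z) := by
  have : IsTensorResolution P (tensorRes P P) := IsTensorResolution.assoc P P P
  -- the two ways to expand `𝟙_ C` to a triple tensor product agree
  have e : ((λ_ (𝟙_ C)).inv ≫ (λ_ (𝟙_ C)).inv ▷ 𝟙_ C) ≫ (α_ (𝟙_ C) (𝟙_ C) (𝟙_ C)).hom =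
      (λ_ (𝟙_ C)).inv ≫ 𝟙_ C ◁ (λ_ (𝟙_ C)).inv := by
    monoidal
  rw [cup, cup, cup, cup, extProd_comap_left (R := tensorRes P P),
    extProd_comap_right (R' := tensorRes P P), ExtHat.comap_comap, ExtHat.comap_comap]
  refine (ExtHat.map_comap (Q := (Q.tensor Q').tensor Q'') (R := Q.tensor (Q'.tensor Q''))
    _ _ _).trans ?_
  rw [extProd_assoc hmn hnp h h', ExtHat.comap_comap, e]

end Cup

/-! ### Yoneda products -/

section Yoneda

open CochainComplex.HomComplex

variable {C : Type u} [Category.{v} C] [Abelian C] {F G H J : CochainComplex C ℤ}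

/-- Composition in the cohomology of the Hom complexes modulo bounded cochains is associative,
since composition of cochains is. -/
lemma VogelH.comp_assoc {m n p mn np s : ℤ} (hmn : m + n = mn) (hnp : n + p = np)
    (h : mn + p = s) (h' : m + np = s) (x : VogelH F G m) (y : VogelH G H n) (z : VogelH H J p) :
    VogelH.comp h z (VogelH.comp hmn y x) = VogelH.comp h' (VogelH.comp hnp z y) x := by
  obtain ⟨x, rfl⟩ := QuotientAddGroup.mk_surjective x
  obtain ⟨y, rfl⟩ := QuotientAddGroup.mk_surjective y
  obtain ⟨z, rfl⟩ := QuotientAddGroup.mk_surjective z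
  exact congrArg QuotientAddGroup.mk
    (Subtype.ext (Cochain.comp_assoc x.1 y.1 z.1 hmn hnp (by omega)))

end Yoneda

/-! ### Tensor products of resolutions of projective objects -/

section Projective

variable {D : Type u} [Category.{v} D] [Abelian D] [MonoidalCategory D] [MonoidalPreadditive D]
  {A A' : D}

/-- A projective object is its own resolution, concentrated in degree zero; there the augmentation of
the tensor product is even an isomorphism. -/
lemma isTensorResolution_self [Projective A] [Projective A'] :
    IsTensorResolution (ProjectiveResolution.self A) (ProjectiveResolution.self A') where
  quasiIso := by
    have : IsIso (tensorAug (ProjectiveResolution.self A) (ProjectiveResolution.self A')) := by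
      have haug : ∀ (X : D) [Projective X], aug (ProjectiveResolution.self X) 0 = 𝟙 X :=
        fun X _ => rfl
      have hz : ∀ {X : D} (i : ℕ),
          𝟙 (((ChainComplex.single₀ D).obj X).X (i + 1)) = 0 := fun i =>
        (HomologicalComplex.isZero_single_obj_X _ _ _ _ (Nat.succ_ne_zero i)).eq_of_src _ _
      have h0 := ι_cross (aug (ProjectiveResolution.self A))
        (aug (ProjectiveResolution.self A')) 0 0 0 rfl
      rw [haug, haug, mul_zero, pow_zero, one_smul] at h0
      replace h0 := h0.trans (MonoidalCategory.id_tensorHom_id A A')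
      suffices ∀ n, IsIso ((tensorAug (ProjectiveResolution.self A)
          (ProjectiveResolution.self A')).f n) from HomologicalComplex.Hom.isIso_of_components _
      rintro (_ | n)
      · rw [tensorAug_f_zero]
        refine ⟨ιT (ProjectiveResolution.self A).complex (ProjectiveResolution.self A').complex
          0 0 0 rfl, ?_, ?_⟩
        · refine tensor_ext fun i j hij => ?_
          obtain rfl : i = 0 := by omega
          obtain rfl : j = 0 := by omega
          refine (Category.assoc _ _ _).symm.trans ?_
          refine (congrArg (fun t => t ≫ _) h0).trans ?_
          exact (Category.id_comp _).trans (Category.comp_id _).symm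
        · exact h0
      · have h1 : IsZero (((ChainComplex.single₀ D).obj (A ⊗ A')).X (n + 1)) :=
          HomologicalComplex.isZero_single_obj_X _ _ _ _ (Nat.succ_ne_zero n)
        have h2 : IsZero ((tensorCx (ProjectiveResolution.self A).complex
            (ProjectiveResolution.self A').complex).X (n + 1)) := by
          rw [IsZero.iff_id_eq_zero]
          refine tensor_ext fun i j hij => ?_
          have h3 : 𝟙 ((ProjectiveResolution.self A).complex.X i ⊗
              (ProjectiveResolution.self A').complex.X j) = 0 := by
            rw [← MonoidalCategory.id_tensorHom_id]
            rcases i with _ | i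
            · obtain rfl : j = n + 1 := by omega
              exact (congrArg (fun t => _ ⊗ₘ t) (hz n)).trans (MonoidalPreadditive.tensor_zero _)
            · exact (congrArg (fun t => t ⊗ₘ _) (hz i)).trans (MonoidalPreadditive.zero_tensor _)
          rw [← Category.id_comp (ιT _ _ i j (n + 1) hij), h3, zero_comp, zero_comp, zero_comp]
        exact ⟨0, h2.eq_of_src _ _, h1.eq_of_src _ _⟩
    infer_instance

lemma mapCx_id (K L : ChainComplex D ℕ) : mapCx (𝟙 K) (𝟙 L) = 𝟙 (tensorCx K L) := by
  ext n : 1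
  refine tensor_ext fun i j h => ?_
  rw [ι_mapCx]
  simp

lemma mapCx_comp {K K' K'' L L' L'' : ChainComplex D ℕ} (φ : K ⟶ K') (φ' : K' ⟶ K'')
    (ψ : L ⟶ L') (ψ' : L' ⟶ L'') : mapCx φ ψ ≫ mapCx φ' ψ' = mapCx (φ ≫ φ') (ψ ≫ ψ') := by
  ext n : 1
  refine tensor_ext fun i j h => ?_
  rw [HomologicalComplex.comp_f, ← Category.assoc, ι_mapCx, ι_mapCx, Category.assoc, ι_mapCx,
    ← Category.assoc, MonoidalCategory.tensorHom_comp_tensorHom]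
  rfl

/-- The tensor product of homotopy equivalences is a homotopy equivalence. -/
def mapCxHomotopyEquiv {K K' L L' : ChainComplex D ℕ} (e : HomotopyEquiv K K')
    (e' : HomotopyEquiv L L') : HomotopyEquiv (tensorCx K L) (tensorCx K' L') where
  hom := mapCx e.hom e'.hom
  inv := mapCx e.inv e'.inv
  homotopyHomInvId := by
    refine (Homotopy.ofEq ?_).trans
      (((HomologicalComplex.mapBifunctorMapHomotopy₁ e.homotopyHomInvId (e'.hom ≫ e'.inv)
        (curriedTensor D) (.down ℕ)).trans
      (HomologicalComplex.mapBifunctorMapHomotopy₂ (𝟙 K) e'.homotopyHomInvId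
        (curriedTensor D) (.down ℕ))).trans (Homotopy.ofEq ?_))
    · exact mapCx_comp _ _ _ _
    · exact mapCx_id _ _
  homotopyInvHomId := by
    refine (Homotopy.ofEq ?_).trans
      (((HomologicalComplex.mapBifunctorMapHomotopy₁ e.homotopyInvHomId (e'.inv ≫ e'.hom)
        (curriedTensor D) (.down ℕ)).trans
      (HomologicalComplex.mapBifunctorMapHomotopy₂ (𝟙 K') e'.homotopyInvHomId
        (curriedTensor D) (.down ℕ))).trans (Homotopy.ofEq ?_))
    · exact mapCx_comp _ _ _ _
    · exact mapCx_id _ _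

/-- Resolutions of projective objects are split up to homotopy, so their tensor product is a
resolution. -/
lemma isTensorResolution_of_projective [Projective A] [Projective A']
    (P : ProjectiveResolution A) (P' : ProjectiveResolution A') : IsTensorResolution P P' where
  quasiIso := by
    let e := ProjectiveResolution.homotopyEquiv P (ProjectiveResolution.self A)
    let e' := ProjectiveResolution.homotopyEquiv P' (ProjectiveResolution.self A')
    have h := mapCx_tensorAug (P := P) (P' := P') (R := ProjectiveResolution.self A)
      (R' := ProjectiveResolution.self A') (r := 𝟙 A) (r' := 𝟙 A') (φ := e.hom) (ψ := e'.hom)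
      (by rw [ProjectiveResolution.homotopyEquiv_hom_π, CategoryTheory.Functor.map_id,
        Category.comp_id])
      (by rw [ProjectiveResolution.homotopyEquiv_hom_π, CategoryTheory.Functor.map_id,
        Category.comp_id])
    rw [MonoidalCategory.id_tensorHom_id, CategoryTheory.Functor.map_id, Category.comp_id] at h
    rw [← h]
    have h1 : QuasiIso (mapCx e.hom e'.hom) := (mapCxHomotopyEquiv e e').quasiIso_hom
    have h2 := (isTensorResolution_self (A := A) (A' := A')).quasiIso
    exact quasiIso_comp _ _

end Projective

/-! ### Monoidal functors and tensor products of complexes -/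

lemma quasiIso_of_iso_comm {D : Type u} [Category.{v} D] [Abelian D]
    {X Y Z X' Z' : ChainComplex D ℕ} (a : X ≅ Y) (b : Z ≅ Z') (c : X' ≅ Z') {f : Y ⟶ Z}
    {g : X ⟶ X'} (hg : QuasiIso g) (h : a.hom ≫ f ≫ b.hom = g ≫ c.hom) : QuasiIso f := by
  have h1 : f = a.inv ≫ g ≫ c.hom ≫ b.inv := by
    rw [← Category.assoc g, ← h]
    simp
  rw [h1]
  infer_instance

lemma map_singleObjXSelf {C : Type u} [Category.{v} C] [Abelian C] {D : Type u₁}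
    [Category.{v₁} D] [Abelian D] (F : C ⥤ D) (X : C) :
    F.map (HomologicalComplex.singleObjXSelf (.down ℕ) 0 X).hom ≫
      (HomologicalComplex.singleObjXSelf (.down ℕ) 0 (F.obj X)).inv = 𝟙 (F.obj X) :=
  (Category.comp_id _).trans (F.map_id X)

lemma aug_mapProjectiveResolution {C : Type u} [Category.{v} C] [Abelian C] {D : Type u₁}
    [Category.{v₁} D] [Abelian D] (F : C ⥤ D) [F.Additive] [F.PreservesHomology]
    [F.PreservesProjectiveObjects] {A : C} (P : ProjectiveResolution A) :
    aug (F.mapProjectiveResolution P) 0 = F.map (aug P 0) := by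
  change (F.mapProjectiveResolution P).π.f 0 = F.map (P.π.f 0)
  rw [Functor.mapProjectiveResolution_π, HomologicalComplex.comp_f,
    HomologicalComplex.singleMapHomologicalComplex_hom_app_self]
  exact (congrArg (fun t => F.map (P.π.f 0) ≫ t) (map_singleObjXSelf F A)).trans (Category.comp_id _)

section MonoidalFunctor

variable {C : Type u} [Category.{v} C] [Abelian C] [MonoidalCategory C] [MonoidalPreadditive C]
  {D : Type u₁} [Category.{v₁} D] [Abelian D] [MonoidalCategory D] [MonoidalPreadditive D]

section

variable (K L : ChainComplex C ℕ)

/-- The projection to the summand `K_i ⊗ L_{n - i}`. The truncated difference is only used for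
`i ≤ n`. -/
def projT (n i : ℕ) : (tensorCx K L).X n ⟶ K.X i ⊗ L.X (n - i) :=
  tensorDesc fun a b h => if e : i = a then
    eqToHom (by subst e; rw [show n - i = b by omega]) else 0

variable {K L} in
lemma ι_projT_self {n i j : ℕ} (h : i + j = n) :
    ιT K L i j n h ≫ projT K L n i = K.X i ◁ eqToHom (by rw [show n - i = j by omega]) := by
  refine (ι_tensorDesc _ i j h).trans ?_
  rw [dif_pos rfl]
  obtain rfl : j = n - i := by omega
  simp

variable {K L} in
lemma ι_projT_of_ne {n i j k : ℕ} (h : i + j = n) (hk : k ≠ i) :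
    ιT K L i j n h ≫ projT K L n k = 0 :=
  (ι_tensorDesc _ i j h).trans (dif_neg hk)

lemma ι_whiskerLeft_eqToHom {n i j : ℕ} (h : i + j = n) :
    K.X i ◁ eqToHom (by rw [show n - i = j by omega]) ≫ ιT K L i (n - i) n (by omega) =
      ιT K L i j n h := by
  obtain rfl : j = n - i := by omega
  simp

/-- `(K ⊗ L)_n` is the direct sum of the `K_i ⊗ L_{n - i}`. -/
lemma sum_projT_ι (n : ℕ) :
    ∑ i : Fin (n + 1), projT K L n i ≫ ιT K L i (n - i) n (by omega) = 𝟙 _ := by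
  refine tensor_ext fun i j h => ?_
  rw [Preadditive.comp_sum, Finset.sum_eq_single (⟨i, by omega⟩ : Fin (n + 1))]
  · rw [← Category.assoc, ι_projT_self h, ι_whiskerLeft_eqToHom]
    exact (Category.comp_id _).symm
  · intro k _ hk
    rw [← Category.assoc, ι_projT_of_ne h (fun h' => hk (Fin.ext h')), zero_comp]
  · simp

lemma ι_d (i j n : ℕ) (h : i + j = n + 1) :
    ιT K L i j (n + 1) h ≫ (tensorCx K L).d (n + 1) n =
      HomologicalComplex.mapBifunctor.d₁ K L (curriedTensor C) (.down ℕ) i j n +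
      HomologicalComplex.mapBifunctor.d₂ K L (curriedTensor C) (.down ℕ) i j n := by
  rw [HomologicalComplex.mapBifunctor.d_eq, Preadditive.comp_add]
  congr 1
  · exact HomologicalComplex.mapBifunctor.ι_D₁ K L (curriedTensor C) (.down ℕ) (n + 1) n i j h
  · exact HomologicalComplex.mapBifunctor.ι_D₂ K L (curriedTensor C) (.down ℕ) (n + 1) n i j h

lemma d₁_succ (i j n : ℕ) (h : i + j = n) :
    HomologicalComplex.mapBifunctor.d₁ K L (curriedTensor C) (.down ℕ) (i + 1) j n =
      K.d (i + 1) i ▷ L.X j ≫ ιT K L i j n h := by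
  rw [HomologicalComplex.mapBifunctor.d₁_eq K L (curriedTensor C) (.down ℕ)
      (i₁ := i + 1) (i₁' := i) rfl j n h]
  exact one_smul _ _

lemma d₂_succ (i j n : ℕ) (h : i + j = n) :
    HomologicalComplex.mapBifunctor.d₂ K L (curriedTensor C) (.down ℕ) i (j + 1) n =
      (-1 : ℤˣ) ^ i • (K.X i ◁ L.d (j + 1) j ≫ ιT K L i j n h) := by
  rw [HomologicalComplex.mapBifunctor.d₂_eq K L (curriedTensor C) (.down ℕ)
      i (i₂ := j + 1) (i₂' := j) rfl n h]
  rfl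

end

open Functor.LaxMonoidal Functor.OplaxMonoidal Functor.Monoidal

variable (F : C ⥤ D) [F.Monoidal] [F.Additive] (K L : ChainComplex C ℕ)

/-- The image of a chain complex under an additive functor. -/
abbrev mapComplex : ChainComplex D ℕ := (F.mapHomologicalComplex (.down ℕ)).obj K

/-- The components of the comparison map `F K ⊗ F L ⟶ F (K ⊗ L)`. -/
def μX (n : ℕ) : (tensorCx (mapComplex F K) (mapComplex F L)).X n ⟶ F.obj ((tensorCx K L).X n) :=
  tensorDesc fun i j h => μ F (K.X i) (L.X j) ≫ F.map (ιT K L i j n h)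

/-- The inclusion of the summand `F K_i ⊗ F L_j` of `F K ⊗ F L`. -/
abbrev ιMap (i j n : ℕ) (h : i + j = n) :
    F.obj (K.X i) ⊗ F.obj (L.X j) ⟶ (tensorCx (mapComplex F K) (mapComplex F L)).X n :=
  ιT (mapComplex F K) (mapComplex F L) i j n h

variable {K L}

lemma ι_μX (i j n : ℕ) (h : i + j = n) :
    ιMap F K L i j n h ≫ μX F K L n = μ F (K.X i) (L.X j) ≫ F.map (ιT K L i j n h) :=
  ι_tensorDesc _ i j h

lemma d₁_μX (i j n : ℕ) (h : i + j = n + 1) :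
    HomologicalComplex.mapBifunctor.d₁ (mapComplex F K) (mapComplex F L) (curriedTensor D)
        (.down ℕ) i j n ≫ μX F K L n =
      μ F (K.X i) (L.X j) ≫
        F.map (HomologicalComplex.mapBifunctor.d₁ K L (curriedTensor C) (.down ℕ) i j n) := by
  cases i with
  | zero =>
    rw [HomologicalComplex.mapBifunctor.d₁_eq_zero _ _ _ _ _ _ _ (by simp),
      HomologicalComplex.mapBifunctor.d₁_eq_zero _ _ _ _ _ _ _ (by simp), zero_comp]
    exact ((congrArg _ (F.map_zero _ _)).trans comp_zero).symm
  | succ i =>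
    have h3 : i + j = n := by omega
    have e : (F.map (K.d (i + 1) i) ▷ F.obj (L.X j) ≫ ιMap F K L i j n h3) ≫ μX F K L n =
        μ F (K.X (i + 1)) (L.X j) ≫ F.map (K.d (i + 1) i ▷ L.X j ≫ ιT K L i j n h3) := by
      rw [Category.assoc, ι_μX, F.map_comp, μ_natural_left_assoc]
    exact ((congrArg (fun t => t ≫ μX F K L n)
      (d₁_succ (mapComplex F K) (mapComplex F L) i j n h3)).trans e).trans
      (congrArg (fun t => μ F (K.X (i + 1)) (L.X j) ≫ F.map t) (d₁_succ K L i j n h3)).symm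

lemma d₂_μX (i j n : ℕ) (h : i + j = n + 1) :
    HomologicalComplex.mapBifunctor.d₂ (mapComplex F K) (mapComplex F L) (curriedTensor D)
        (.down ℕ) i j n ≫ μX F K L n =
      μ F (K.X i) (L.X j) ≫
        F.map (HomologicalComplex.mapBifunctor.d₂ K L (curriedTensor C) (.down ℕ) i j n) := by
  cases j with
  | zero =>
    rw [HomologicalComplex.mapBifunctor.d₂_eq_zero _ _ _ _ _ _ _ (by simp),
      HomologicalComplex.mapBifunctor.d₂_eq_zero _ _ _ _ _ _ _ (by simp), zero_comp]
    exact ((congrArg _ (F.map_zero _ _)).trans comp_zero).symm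
  | succ j =>
    have h3 : i + j = n := by omega
    have e : ((-1 : ℤˣ) ^ i • (F.obj (K.X i) ◁ F.map (L.d (j + 1) j) ≫ ιMap F K L i j n h3)) ≫
        μX F K L n = μ F (K.X i) (L.X (j + 1)) ≫
          F.map ((-1 : ℤˣ) ^ i • (K.X i ◁ L.d (j + 1) j ≫ ιT K L i j n h3)) := by
      rw [Linear.units_smul_comp, Category.assoc, ι_μX, Functor.map_units_smul,
        Linear.comp_units_smul, F.map_comp, μ_natural_right_assoc]
    exact ((congrArg (fun t => t ≫ μX F K L n)
      (d₂_succ (mapComplex F K) (mapComplex F L) i j n h3)).trans e).trans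
      (congrArg (fun t => μ F (K.X i) (L.X (j + 1)) ≫ F.map t) (d₂_succ K L i j n h3)).symm

variable (K L)

lemma μX_comm (n : ℕ) : μX F K L (n + 1) ≫ F.map ((tensorCx K L).d (n + 1) n) =
    (tensorCx (mapComplex F K) (mapComplex F L)).d (n + 1) n ≫ μX F K L n := by
  refine tensor_ext fun i j h => ?_
  have e₁ : ιMap F K L i j (n + 1) h ≫ μX F K L (n + 1) ≫ F.map ((tensorCx K L).d (n + 1) n) =
      μ F (K.X i) (L.X j) ≫ F.map
        (HomologicalComplex.mapBifunctor.d₁ K L (curriedTensor C) (.down ℕ) i j n +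
          HomologicalComplex.mapBifunctor.d₂ K L (curriedTensor C) (.down ℕ) i j n) := by
    rw [← Category.assoc, ι_μX, Category.assoc, ← F.map_comp]
    exact congrArg (fun t => μ F (K.X i) (L.X j) ≫ F.map t) (ι_d K L i j n h)
  have e₂ := congrArg (fun t => t ≫ μX F K L n)
    (ι_d (mapComplex F K) (mapComplex F L) i j n h)
  have e₃ := (Preadditive.add_comp _ _ _ _ _ _).trans
    (congrArg₂ (· + ·) (d₁_μX F i j n h (K := K) (L := L)) (d₂_μX F i j n h (K := K) (L := L)))
  refine e₁.trans (Eq.trans ?_ ((Category.assoc _ _ _).symm.trans (e₂.trans e₃)).symm)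
  exact (congrArg _ (F.map_add)).trans (Preadditive.comp_add _ _ _ _ _ _)

/-- An additive functor preserves the finite direct sum `(K ⊗ L)_n`, so the comparison map is invertible
because the `μ F (K.X i) (L.X j)` are. -/
lemma isIso_μX (n : ℕ) : IsIso (μX F K L n) := by
  refine ⟨∑ i : Fin (n + 1), F.map (projT K L n i) ≫ δ F (K.X i) (L.X (n - i)) ≫
    ιMap F K L i (n - i) n (by omega), ?_, ?_⟩
  · refine tensor_ext fun i j h => ?_
    have e : ιMap F K L i j n h ≫ μX F K L n ≫ ∑ i : Fin (n + 1), F.map (projT K L n i) ≫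
        δ F (K.X i) (L.X (n - i)) ≫ ιMap F K L i (n - i) n (by omega) = ιMap F K L i j n h := by
      rw [← Category.assoc, ι_μX, Preadditive.comp_sum,
        Finset.sum_eq_single (⟨i, by omega⟩ : Fin (n + 1))]
      · obtain rfl : j = n - i := by omega
        rw [Category.assoc, ← F.map_comp_assoc, ι_projT_self h, eqToHom_refl,
          MonoidalCategory.whiskerLeft_id, F.map_id, Category.id_comp, μ_δ_assoc]
      · intro k _ hk
        rw [Category.assoc, ← F.map_comp_assoc, ι_projT_of_ne h (fun h' => hk (Fin.ext h')),
          F.map_zero, zero_comp, comp_zero]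
      · simp
    exact e.trans (Category.comp_id _).symm
  · rw [Preadditive.sum_comp, ← F.map_id, ← sum_projT_ι K L n, F.map_sum]
    refine Finset.sum_congr rfl fun i _ => ?_
    rw [Category.assoc, Category.assoc, ι_μX, δ_μ_assoc, F.map_comp]

/-- The isomorphism of complexes `F K ⊗ F L ≅ F (K ⊗ L)` of a monoidal functor. -/
def μCx : tensorCx (mapComplex F K) (mapComplex F L) ≅ mapComplex F (tensorCx K L) :=
  HomologicalComplex.Hom.isoOfComponents
    (fun n => @asIso _ _ _ _ (μX F K L n) (isIso_μX F K L n)) (by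
      rintro _ n rfl
      exact μX_comm F K L n)

variable {A A' : C} [F.PreservesHomology] [F.PreservesProjectiveObjects]

/-- The comparison isomorphism is compatible with the augmentations. -/
lemma μCx_tensorAug (P : ProjectiveResolution A) (P' : ProjectiveResolution A') :
    (μCx F P.complex P'.complex).hom ≫ (F.mapHomologicalComplex _).map (tensorAug P P') ≫
      (HomologicalComplex.singleMapHomologicalComplex F (.down ℕ) 0).hom.app (A ⊗ A') =
    tensorAug (F.mapProjectiveResolution P) (F.mapProjectiveResolution P') ≫
      (ChainComplex.single₀ D).map (μ F A A') := by
  refine HomologicalComplex.to_single_hom_ext ?_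
  have h₀ : ((F.mapHomologicalComplex _).map (tensorAug P P') ≫
      (HomologicalComplex.singleMapHomologicalComplex F (.down ℕ) 0).hom.app (A ⊗ A')).f 0 =
      F.map (cross (aug P) (aug P') 0) := by
    rw [HomologicalComplex.comp_f,
      HomologicalComplex.singleMapHomologicalComplex_hom_app_self, ← tensorAug_f_zero]
    exact (congrArg (fun t => F.map ((tensorAug P P').f 0) ≫ t)
      (map_singleObjXSelf F (A ⊗ A'))).trans
      (Category.comp_id _)
  have h₁ : (tensorAug (F.mapProjectiveResolution P) (F.mapProjectiveResolution P') ≫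
      (ChainComplex.single₀ D).map (μ F A A')).f 0 =
      cross (aug (F.mapProjectiveResolution P)) (aug (F.mapProjectiveResolution P')) 0 ≫
        μ F A A' := by
    rw [HomologicalComplex.comp_f, ChainComplex.single₀_map_f_zero, tensorAug_f_zero]
    rfl
  rw [h₁]
  refine Eq.trans (congrArg (fun t => μX F P.complex P'.complex 0 ≫ t) h₀) ?_
  refine tensor_ext fun i j h => ?_
  obtain rfl : i = 0 := by omega
  obtain rfl : j = 0 := by omega
  have h₂ : ιMap F P.complex P'.complex 0 0 0 h ≫ μX F P.complex P'.complex 0 ≫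
      F.map (cross (aug P) (aug P') 0) = (F.map (aug P 0) ⊗ₘ F.map (aug P' 0)) ≫ μ F A A' := by
    rw [← Category.assoc, ι_μX, Category.assoc, ← F.map_comp, μ_natural]
    refine congrArg (fun t => μ F _ _ ≫ F.map t) ((ι_cross (aug P) (aug P') 0 0 0 h).trans ?_)
    rw [mul_zero, pow_zero, one_smul]
  have h₃ := ι_cross (aug (F.mapProjectiveResolution P)) (aug (F.mapProjectiveResolution P'))
    0 0 0 h
  rw [mul_zero, pow_zero, one_smul, aug_mapProjectiveResolution, aug_mapProjectiveResolution]
    at h₃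
  exact h₂.trans ((congrArg (fun t => t ≫ μ F A A') h₃).symm.trans (Category.assoc _ _ _))

/-- A monoidal functor that preserves homology and projective objects and reflects isomorphisms
detects whether the tensor product of two resolutions is a resolution. -/
lemma isTensorResolution_of_map [F.ReflectsIsomorphisms] (P : ProjectiveResolution A)
    (P' : ProjectiveResolution A')
    [h : IsTensorResolution (F.mapProjectiveResolution P) (F.mapProjectiveResolution P')] :
    IsTensorResolution P P' where
  quasiIso := by
    rw [← HomologicalComplex.quasiIso_map_iff_of_preservesHomology _ F]
    have h1 := h.quasiIso
    exact quasiIso_of_iso_comm (hg := h1) (μCx F P.complex P'.complex)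
      ((HomologicalComplex.singleMapHomologicalComplex F (.down ℕ) 0).app (A ⊗ A'))
      ((ChainComplex.single₀ D).mapIso (μIso F A A')) (μCx_tensorAug F P P')

end MonoidalFunctor

section Restriction

variable {C : Type u} [Category.{v} C] [Abelian C] [MonoidalCategory C] [MonoidalPreadditive C]
  {D : Type u₁} [Category.{v₁} D] [Abelian D] [MonoidalCategory D] [MonoidalPreadditive D]
  (F : C ⥤ D) [F.Monoidal] [F.Faithful] [PreservesFiniteLimits F] [PreservesFiniteColimits F]
  [F.PreservesProjectiveObjects]

/-- Tensor products of resolutions of objects that become projective under an exact faithful monoidal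
functor are resolutions. -/
lemma isTensorResolution_of_projective_obj {A A' : C} [Projective (F.obj A)]
    [Projective (F.obj A')] (P : ProjectiveResolution A) (P' : ProjectiveResolution A') :
    IsTensorResolution P P' := by
  have : F.Additive := F.additive_of_preserves_binary_products
  have := isTensorResolution_of_projective (F.mapProjectiveResolution P)
    (F.mapProjectiveResolution P')
  exact isTensorResolution_of_map F P P'

end Restriction

end

end CompletedExt

theorem lemma6p2 :
    -- external products on completed Ext
    (∀ (C : Type u) [Category.{v} C] [Abelian C] [MonoidalCategory C] [MonoidalPreadditive C]
      [CompletedExt.TensorProjective C] (A A' A'' : C)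
      (P : ProjectiveResolution A) (P' : ProjectiveResolution A') (P'' : ProjectiveResolution A'')
      [CompletedExt.IsTensorResolution P P'] [CompletedExt.IsTensorResolution P' P'']
      [CompletedExt.IsTensorResolution (CompletedExt.tensorRes P P') P'']
      (Q Q' Q'' : CompletedExt.SyzRes C) [Q.Admissible] [Q'.Admissible] [Q''.Admissible],
      ∃ _ : CompletedExt.IsTensorResolution P (CompletedExt.tensorRes P' P''),
        ∀ (m n p mn np s : ℤ) (hmn : m + n = mn) (hnp : n + p = np) (h : mn + p = s)
          (h' : m + np = s) (x : CompletedExt.ExtHat P Q m) (y : CompletedExt.ExtHat P' Q' n)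
          (z : CompletedExt.ExtHat P'' Q'' p),
          CompletedExt.ExtHat.map (Q := (Q.tensor Q').tensor Q'') (R := Q.tensor (Q'.tensor Q''))
              (CompletedExt.tensorRes (CompletedExt.tensorRes P P') P'')
              (α_ (Q.syz 0) (Q'.syz 0) (Q''.syz 0)).hom s
              (CompletedExt.extProd (CompletedExt.tensorRes P P') P'' (Q.tensor Q') Q'' h
                (CompletedExt.extProd P P' Q Q' hmn x y) z) =
            CompletedExt.ExtHat.comap
              (P := CompletedExt.tensorRes (CompletedExt.tensorRes P P') P'')
              (P' := CompletedExt.tensorRes P (CompletedExt.tensorRes P' P''))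
              (α_ A A' A'').hom (Q.tensor (Q'.tensor Q'')) s
              (CompletedExt.extProd P (CompletedExt.tensorRes P' P'') Q (Q'.tensor Q'') h' x
                (CompletedExt.extProd P' P'' Q' Q'' hnp y z))) ∧
    -- cup products on complete cohomology
    (∀ (C : Type u) [Category.{v} C] [Abelian C] [MonoidalCategory C] [MonoidalPreadditive C]
      [CompletedExt.TensorProjective C]
      (D : Type u₁) [Category.{v₁} D] [Abelian D] [MonoidalCategory D] [MonoidalPreadditive D]
      (Res : C ⥤ D) [Res.Monoidal] [Res.Faithful] [PreservesFiniteLimits Res]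
      [PreservesFiniteColimits Res] [Res.PreservesProjectiveObjects] [Projective (𝟙_ D)]
      (P : ProjectiveResolution (𝟙_ C)),
      ∃ _ : CompletedExt.IsTensorResolution P P,
        ∀ (Q Q' Q'' : CompletedExt.SyzRes C) [Q.Admissible] [Q'.Admissible] [Q''.Admissible]
          (m n p mn np s : ℤ) (hmn : m + n = mn) (hnp : n + p = np) (h : mn + p = s)
          (h' : m + np = s) (x : CompletedExt.HHat P Q m) (y : CompletedExt.HHat P Q' n)
          (z : CompletedExt.HHat P Q'' p),
          CompletedExt.ExtHat.map (Q := (Q.tensor Q').tensor Q'') (R := Q.tensor (Q'.tensor Q'')) P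
              (α_ (Q.syz 0) (Q'.syz 0) (Q''.syz 0)).hom s
              (CompletedExt.cup P (Q.tensor Q') Q'' h (CompletedExt.cup P Q Q' hmn x y) z) =
            CompletedExt.cup P Q (Q'.tensor Q'') h' x (CompletedExt.cup P Q' Q'' hnp y z)) ∧
    -- Yoneda products on completed Ext
    (∀ (C : Type u) [Category.{v} C] [Abelian C] (A₀ A₁ A₂ A₃ : C)
      (P₀ : ProjectiveResolution A₀) (P₁ : ProjectiveResolution A₁) (P₂ : ProjectiveResolution A₂)
      (P₃ : ProjectiveResolution A₃) (m n p mn np s : ℤ) (hmn : m + n = mn) (hnp : n + p = np)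
      (h : mn + p = s) (h' : m + np = s) (x : CompletedExt.ExtHatV P₀ P₁ m)
      (y : CompletedExt.ExtHatV P₁ P₂ n) (z : CompletedExt.ExtHatV P₂ P₃ p),
      CompletedExt.yoneda h z (CompletedExt.yoneda hmn y x) =
        CompletedExt.yoneda h' (CompletedExt.yoneda hnp z y) x) := by
  refine ⟨?_, ?_, ?_⟩
  · intro C _ _ _ _ _ A A' A'' P P' P'' _ _ _ Q Q' Q'' _ _ _
    have := CompletedExt.IsTensorResolution.assoc P P' P''
    exact ⟨this, fun m n p mn np s hmn hnp h h' x y z =>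
      CompletedExt.extProd_assoc hmn hnp h h' x y z⟩
  · intro C _ _ _ _ _ D _ _ _ _ Res _ _ _ _ _ _ P
    have h₁ : Projective (Res.obj (𝟙_ C)) :=
      Projective.of_iso (Functor.Monoidal.εIso Res) inferInstance
    have h₂ : Projective (Res.obj (𝟙_ C ⊗ 𝟙_ C)) :=
      Projective.of_iso (Res.mapIso (λ_ (𝟙_ C)).symm) inferInstance
    -- `Res` maps the unit object and its tensor square to projective objects.
    have := CompletedExt.isTensorResolution_of_projective_obj Res P P
    have := CompletedExt.isTensorResolution_of_projective_obj Res (CompletedExt.tensorRes P P) P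
    exact ⟨‹_›, fun Q Q' Q'' _ _ _ m n p mn np s hmn hnp h h' x y z =>
      CompletedExt.cup_assoc P hmn hnp h h' x y z⟩
  · intro C _ _ A₀ A₁ A₂ A₃ P₀ P₁ P₂ P₃ m n p mn np s hmn hnp h h' x y z
    exact CompletedExt.VogelH.comp_assoc hmn hnp h h' x y z
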